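/- Let $n\ge 3$ be odd and let $f(x,y)=f_0x^n+f_1x^{n-1}y+\cdots+f_ny^n$ be a binary $n$-ic form with integer coefficients that is primitive, nondegenerate (nonzero discriminant) and irreducible over $\mathbb Q$. Let $K=\mathbb Q[\theta]/(f(\theta,1))$, put $\zeta_0=1$ and $\zeta_k=f_0\theta^k+\cdots+f_{k-1}\theta$ for $k>0$, and let $\mathcal O=R_f=\langle 1,\zeta_1,\dots,\zeta_{n-1}\rangle_{\mathbb Z}$, an order in $K$, with the (invertible) fractional ideal $I_f=\langle 1,\theta,\zeta_2,\dots,\zeta_{n-1}\rangle_{\mathbb Z}$. (No hypothesis on the Galois group is needed; in particular $\mathcal O$ may be any $S_n$-order of this form.) Let $(r_1,r_2)$ be the signature of $K$. For a fractional ideal $I$ put $N(I)=[\mathcal O:I]$ (generalised index), and for $\delta\in K$ let $N(\delta)=N_{K/\mathbb Q}(\delta)$. Let $\mathrm H(\mathcal O)$ be the group, under $(I,\delta)\circ(I',\delta')=(II',\delta\delta')$, of equivalence classes of pairs $(I,\delta)$ with $I$ an invertible fractional ideal of $\mathcal O$, $\delta\in K^\times$, $I^2=(\delta)$ and $N(I)^2=N(\delta)$,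 where $(I,\delta)\sim(\kappa I,\kappa^2\delta)$ for $\kappa\in K^\times$. Let $\mathrm{Cl}_2(\mathcal O)$ be the $2$-torsion subgroup of the ideal class group of $\mathcal O$ and $\mathcal I_2(\mathcal O)$ the group of invertible fractional ideals $J$ of $\mathcal O$ with $J^2=\mathcal O$. The group $\mathrm{SL}_n(\mathbb Z)$ acts by $\gamma(A,B)=(\gamma A\gamma^t,\gamma B\gamma^t)$ on the pairs $(A,B)$ of symmetric integral $n\times n$ matrices with $\det(Ax-By)=f(x,y)$. Say that such a pair corresponds to $(I,\delta)$, where $I$ is a fractional ideal of $\mathcal O$ and $\delta\in K^\times$, if $I^2\subseteq\delta I_f^{n-3}$, $N(I)^2=N(\delta)N(I_f^{n-3})$, and $I$ has a $\mathbb Z$-basis $\alpha_1,\dots,\alpha_n$ with the same orientation as $\zeta_0,\dots,\zeta_{n-1}$ such that for all $i,j$ there are integers $c_{ij}^{(k)}$ with $$\frac{\alpha_i\alpha_j}{\delta}=c_{ij}^{(0)}+c_{ij}^{(1)}\theta+\cdots+c_{ij}^{(n-3)}\theta^{n-3}+(-1)^{(n-1)/2}\bigl(b_{ij}\zeta_{n-2}+a_{ij}\zeta_{n-1}\bigr).$$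 Call $(A,B)$, and its orbit, projective if it corresponds to some $(I,\delta)$ with $I$ invertible, and reducible if the quadrics $A$ and $B$ contain a common rational linear subspace of $\mathbb P^{n-1}(\mathbb Q)$ of dimension $(n-3)/2$. Then: 1. There is a bijection from $\mathrm H(\mathcal O)$ to the set of projective $\mathrm{SL}_n(\mathbb Z)$-orbits of pairs with invariant $f$, under which the class of $(I,\delta)$ is sent to the orbit of $(A,B)$ if and only if $(A,B)$ corresponds to $(I\cdot I_f^{(n-3)/2},\delta)$. 2. The number of these projective orbits is finite and equal to $2^{r_1+r_2-1}\,|\mathrm{Cl}_2(\mathcal O)|$. 3. There is a bijection from the set of reducible projective orbits to $\mathcal I_2(\mathcal O)$, under which the orbit of $(A,B)$ is sent to $J$ if and only if $(A,B)$ corresponds to $(\kappa J\cdot I_f^{(n-3)/2},\kappa^2)$ for some $\kappa\in K^\times$. -/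

import Mathlib

open scoped nonZeroDivisors

namespace BinaryFormOrder

/-- The generalised index `[M : N] = [M : M ∩ N] / [N : M ∩ N]` of two lattices
(`N.relIndex M` is the index of `M ∩ N` in `M`). -/
noncomputable def latticeIndex {G : Type*} [AddGroup G] (M N : AddSubgroup G) : ℚ :=
  (N.relIndex M : ℚ) / (M.relIndex N : ℚ)

section Lattice

variable {G : Type*} [AddGroup G]

/-- Two lattices are commensurable if their intersection has finite index in both. -/
def Commens (M N : AddSubgroup G) : Prop := N.relIndex M ≠ 0 ∧ M.relIndex N ≠ 0

theorem Commens.symm {M N : AddSubgroup G} (h : Commens M N) : Commens N M := ⟨h.2, h.1⟩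

theorem Commens.trans {M N P : AddSubgroup G} (h : Commens M N) (h' : Commens N P) :
    Commens M P :=
  ⟨AddSubgroup.relIndex_ne_zero_trans h'.1 h.1, AddSubgroup.relIndex_ne_zero_trans h.2 h'.2⟩

theorem latticeIndex_eq_of_le {M N Q : AddSubgroup G} (hM : Q ≤ M) (hN : Q ≤ N)
    (h : Q.relIndex M ≠ 0) : latticeIndex M N = (Q.relIndex M : ℚ) / (Q.relIndex N : ℚ) := by
  have e1 := AddSubgroup.relIndex_mul_relIndex Q (M ⊓ N) M (le_inf hM hN) inf_le_left
  have e2 := AddSubgroup.relIndex_mul_relIndex Q (M ⊓ N) N (le_inf hM hN) inf_le_right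
  rw [AddSubgroup.inf_relIndex_left] at e1
  rw [AddSubgroup.inf_relIndex_right] at e2
  have h0 : (Q.relIndex (M ⊓ N) : ℚ) ≠ 0 := by
    intro h0
    rw [Nat.cast_eq_zero] at h0
    rw [h0, zero_mul] at e1
    exact h e1.symm
  rw [← e1, ← e2, latticeIndex]
  push_cast
  rw [mul_div_mul_left _ _ h0]

theorem latticeIndex_mul {M N P : AddSubgroup G} (h : Commens M N) (h' : Commens N P) :
    latticeIndex M N * latticeIndex N P = latticeIndex M P := by
  have hMP := h.trans h'
  set Q := M ⊓ (N ⊓ P) with hQ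
  have k1 : Q.relIndex M ≠ 0 := by
    rw [hQ, AddSubgroup.inf_relIndex_left]
    exact AddSubgroup.relIndex_inf_ne_zero h.1 hMP.1
  have k2 : Q.relIndex N ≠ 0 :=
    AddSubgroup.relIndex_inf_ne_zero h.2
      (AddSubgroup.relIndex_inf_ne_zero (by simp) h'.1)
  have qM : Q ≤ M := inf_le_left
  have qN : Q ≤ N := inf_le_right.trans inf_le_left
  have qP : Q ≤ P := inf_le_right.trans inf_le_right
  rw [latticeIndex_eq_of_le qM qN k1, latticeIndex_eq_of_le qN qP k2,
    latticeIndex_eq_of_le qM qP k1]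
  have k2' : (Q.relIndex N : ℚ) ≠ 0 := by exact_mod_cast k2
  rw [div_mul_div_cancel₀ k2']

end Lattice

section Order

variable {O K : Type*} [CommRing O] [Field K] [Algebra O K]

/-- The lattice underlying a fractional ideal. -/
def toLattice (I : FractionalIdeal O⁰ K) : AddSubgroup K :=
  (I : Submodule O K).toAddSubgroup

/-- The norm `N(I) = [O : I]` of a fractional ideal: the absolute value of the determinant of a
`ℤ`-basis of `I` with respect to a `ℤ`-basis of `O`. -/
noncomputable def latticeNorm (I : FractionalIdeal O⁰ K) : ℚ :=
  latticeIndex (toLattice (1 : FractionalIdeal O⁰ K)) (toLattice I)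

theorem latticeNorm_one : latticeNorm (1 : FractionalIdeal O⁰ K) = 1 := by
  simp [latticeNorm, latticeIndex]

variable [IsDomain O] [Module.Finite ℤ O] [CharZero O] [IsFractionRing O K]

theorem relIndex_coeIdeal_mul (I : (FractionalIdeal O⁰ K)ˣ) (A : Ideal O) (hA : A ≠ ⊥) :
    (toLattice ((A : FractionalIdeal O⁰ K) * (I : FractionalIdeal O⁰ K))).relIndex (toLattice (I : FractionalIdeal O⁰ K))
      = Nat.card (O ⧸ A) := by
  have : IsAddTorsionFree O := inferInstance
  have : Module.Free ℤ O := inferInstance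
  have : Finite (O ⧸ A) := A.finiteQuotientOfFreeOfNeBot hA
  let L : (Submodule O K)ˣ := FractionalIdeal.unitsMulEquivSubmodule I
  have : Module.Invertible O (L : Submodule O K) := inferInstance
  have e2 := TensorProduct.quotTensorEquivQuotSMul (L : Submodule O K) A
  have hfree : Module.Free (O ⧸ A) (TensorProduct O (O ⧸ A) (L : Submodule O K)) := inferInstance
  obtain ⟨e1⟩ := Module.Invertible.free_iff_linearEquiv.1 hfree
  have hc : Nat.card (O ⧸ A) =
      Nat.card ((L : Submodule O K) ⧸ (A • ⊤ : Submodule O (L : Submodule O K))) :=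
    Nat.card_congr (e1.symm.toEquiv.trans e2.toEquiv)
  rw [hc]
  have hL : ((I : FractionalIdeal O⁰ K) : Submodule O K) = L := rfl
  have key : ((((A : FractionalIdeal O⁰ K) * I : FractionalIdeal O⁰ K) : Submodule O K)).comap
      (L : Submodule O K).subtype = A • ⊤ := by
    rw [FractionalIdeal.coe_mul, FractionalIdeal.coe_coeIdeal, hL]
    have : IsLocalization.coeSubmodule K A * (L : Submodule O K) = A • (L : Submodule O K) := by
      apply le_antisymm
      · rw [Submodule.mul_le]
        rintro _ ⟨a, ha, rfl⟩ x hx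
        rw [Algebra.linearMap_apply, ← Algebra.smul_def]
        exact Submodule.smul_mem_smul ha hx
      · rw [Submodule.smul_le]
        intro a ha x hx
        rw [Algebra.smul_def]
        exact Submodule.mul_mem_mul ⟨a, ha, rfl⟩ hx
    rw [this]
    apply Submodule.map_injective_of_injective (L : Submodule O K).injective_subtype
    rw [Submodule.map_smul'', Submodule.map_comap_eq, Submodule.map_top, Submodule.range_subtype]
    exact inf_eq_right.2 Submodule.smul_le_right
  rw [← key]
  rfl

theorem commens_coeIdeal_mul (I : (FractionalIdeal O⁰ K)ˣ) (A : Ideal O) (hA : A ≠ ⊥) :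
    Commens (toLattice (I : FractionalIdeal O⁰ K)) (toLattice ((A : FractionalIdeal O⁰ K) * (I : FractionalIdeal O⁰ K))) ∧
    latticeIndex (toLattice (I : FractionalIdeal O⁰ K)) (toLattice ((A : FractionalIdeal O⁰ K) * (I : FractionalIdeal O⁰ K)))
      = Nat.card (O ⧸ A) := by
  have h1 := relIndex_coeIdeal_mul I A hA
  have hle : (toLattice ((A : FractionalIdeal O⁰ K) * (I : FractionalIdeal O⁰ K))) ≤ toLattice (I : FractionalIdeal O⁰ K) := by
    have : (A : FractionalIdeal O⁰ K) * I ≤ 1 * I :=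
      mul_le_mul_left FractionalIdeal.coeIdeal_le_one _
    rw [one_mul] at this
    exact this
  have h2 := AddSubgroup.relIndex_eq_one.2 hle
  have : Module.Free ℤ O := inferInstance
  have : Finite (O ⧸ A) := A.finiteQuotientOfFreeOfNeBot hA
  have : Nat.card (O ⧸ A) ≠ 0 := Nat.card_pos.ne'
  refine ⟨⟨by rwa [h1], by rw [h2]; exact one_ne_zero⟩, ?_⟩
  rw [latticeIndex, h1, h2]; simp

/-- `[I : IJ]` does not depend on the invertible fractional ideal `I`. -/
theorem exists_latticeIndex_mul (J : (FractionalIdeal O⁰ K)ˣ) : ∃ q : ℚ,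
    ∀ I : (FractionalIdeal O⁰ K)ˣ,
      Commens (toLattice (I : FractionalIdeal O⁰ K)) (toLattice (I * J : FractionalIdeal O⁰ K)) ∧
      latticeIndex (toLattice (I : FractionalIdeal O⁰ K)) (toLattice (I * J : FractionalIdeal O⁰ K))
        = q := by
  obtain ⟨d, A, hd, hJ⟩ := FractionalIdeal.exists_eq_spanSingleton_mul (J : FractionalIdeal O⁰ K)
  have hd' : algebraMap O K d ≠ 0 := by simpa using hd
  have hA : A ≠ ⊥ := by
    rintro rfl
    have := J.ne_zero
    rw [hJ] at this
    simp at this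
  have hB : Ideal.span {d} ≠ ⊥ := by simpa using hd
  let D : (FractionalIdeal O⁰ K)ˣ := toPrincipalIdeal O K (Units.mk0 _ hd')
  have hD : (D : FractionalIdeal O⁰ K) = (Ideal.span {d} : Ideal O) := by
    simp [D, FractionalIdeal.coeIdeal_span_singleton]
  have hDi : ((D⁻¹ : (FractionalIdeal O⁰ K)ˣ) : FractionalIdeal O⁰ K)
      = FractionalIdeal.spanSingleton O⁰ (algebraMap O K d)⁻¹ := by
    simp only [D, ← map_inv, coe_toPrincipalIdeal]
    simp
  refine ⟨(Nat.card (O ⧸ Ideal.span {d}) : ℚ)⁻¹ * Nat.card (O ⧸ A), fun I => ?_⟩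
  obtain ⟨c1, i1⟩ := commens_coeIdeal_mul (D⁻¹ * I) (Ideal.span {d}) hB
  obtain ⟨c2, i2⟩ := commens_coeIdeal_mul (D⁻¹ * I) A hA
  have e1 : ((Ideal.span {d} : Ideal O) : FractionalIdeal O⁰ K) *
      ((D⁻¹ * I : (FractionalIdeal O⁰ K)ˣ) : FractionalIdeal O⁰ K) = I := by
    rw [← hD, ← Units.val_mul, mul_inv_cancel_left]
  have e2 : (A : FractionalIdeal O⁰ K) *
      ((D⁻¹ * I : (FractionalIdeal O⁰ K)ˣ) : FractionalIdeal O⁰ K) = I * J := by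
    rw [Units.val_mul, hDi, hJ]; ring
  rw [e1] at c1 i1
  rw [e2] at c2 i2
  refine ⟨c1.symm.trans c2, ?_⟩
  rw [← latticeIndex_mul c1.symm c2, i2, ← i1]
  congr 1
  simp [latticeIndex]

theorem latticeNorm_mul (I J : (FractionalIdeal O⁰ K)ˣ) :
    latticeNorm (I * J : FractionalIdeal O⁰ K) =
      latticeNorm (I : FractionalIdeal O⁰ K) * latticeNorm (J : FractionalIdeal O⁰ K) := by
  obtain ⟨q, hq⟩ := exists_latticeIndex_mul J
  obtain ⟨r, hr⟩ := exists_latticeIndex_mul I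
  have h1 := hq 1
  have h2 := hr 1
  simp only [Units.val_one, one_mul] at h1 h2
  rw [latticeNorm, latticeNorm, latticeNorm,
    ← latticeIndex_mul h2.1 (hq I).1, (hq I).2, h1.2]


end Order

section HGroup

variable (O K : Type*) [CommRing O] [IsDomain O] [Module.Finite ℤ O] [CharZero O]
  [Field K] [NumberField K] [Algebra O K] [IsFractionRing O K]

/-- The projective pairs `(I, δ)` for the order `O` in the number field `K`: `I` is an invertible
fractional ideal of `O`, `δ ∈ Kˣ`, `I² = (δ)` and `N(I)² = N(δ)`. They form a group under
`(I, δ) ∘ (I', δ') = (I I', δ δ')`. -/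
def projectivePairs : Subgroup ((FractionalIdeal O⁰ K)ˣ × Kˣ) where
  carrier := {p | (p.1 : FractionalIdeal O⁰ K) ^ 2 = FractionalIdeal.spanSingleton O⁰ (p.2 : K) ∧
    latticeNorm (p.1 : FractionalIdeal O⁰ K) ^ 2 = Algebra.norm ℚ (p.2 : K)}
  mul_mem' := by
    rintro ⟨I, a⟩ ⟨J, b⟩ ⟨h1, h2⟩ ⟨h3, h4⟩
    simp only [Set.mem_ofPred_eq, Prod.mk_mul_mk, Units.val_mul] at *
    refine ⟨?_, ?_⟩
    · rw [mul_pow, h1, h3, FractionalIdeal.spanSingleton_mul_spanSingleton]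
    · rw [latticeNorm_mul, mul_pow, h2, h4, map_mul]
  one_mem' := by
    simp [latticeNorm_one]
  inv_mem' := by
    rintro ⟨I, a⟩ ⟨h1, h2⟩
    simp only [Set.mem_ofPred_eq, Prod.inv_mk] at *
    have e1 : I ^ 2 = toPrincipalIdeal O K a := by
      apply Units.ext
      rw [Units.val_pow_eq_pow_val, h1, coe_toPrincipalIdeal]
    refine ⟨?_, ?_⟩
    · rw [← coe_toPrincipalIdeal, map_inv, ← e1, ← Units.val_pow_eq_pow_val, inv_pow]
    · have e2 := latticeNorm_mul I I⁻¹
      rw [← Units.val_mul, mul_inv_cancel, Units.val_one, latticeNorm_one] at e2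
      rw [eq_inv_of_mul_eq_one_right e2.symm, inv_pow, h2, Units.val_inv_eq_inv_val]
      exact (Algebra.norm_inv _).symm

/-- The pairs `((κ), κ²)` for `κ ∈ Kˣ`. -/
noncomputable def trivialPairs : Subgroup ((FractionalIdeal O⁰ K)ˣ × Kˣ) :=
  ((toPrincipalIdeal O K).prod (powMonoidHom 2)).range

/-- The group `H(O)` of equivalence classes of projective pairs, where `(I, δ)` and
`(κ I, κ² δ)` are equivalent for every `κ ∈ Kˣ`. -/
abbrev HGroup : Type _ :=
  projectivePairs O K ⧸ (trivialPairs O K).subgroupOf (projectivePairs O K)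

/-- The group `I₂(O)` of invertible fractional ideals `J` of `O` with `J² = O`. -/
def twoTorsionIdeals : Subgroup (FractionalIdeal O⁰ K)ˣ := (powMonoidHom 2).ker

/-- The 2-torsion subgroup `Cl₂(O)` of the ideal class group of `O`. -/
noncomputable def twoTorsionClasses (O : Type*) [CommRing O] [IsDomain O] : Subgroup (ClassGroup O) :=
  (powMonoidHom 2).ker

end HGroup

section Forms

open MvPolynomial

/-- An integral binary `n`-ic form `f₀ xⁿ + f₁ xⁿ⁻¹ y + ⋯ + fₙ yⁿ`, given by its coefficients. -/
abbrev BinaryForm (n : ℕ) : Type := Fin (n + 1) → ℤ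

namespace BinaryForm

variable {n : ℕ} (f : BinaryForm n)

/-- The coefficient `f_k`, with the convention `f_k = 0` for `k > n`. -/
def coef (k : ℕ) : ℤ := if h : k < n + 1 then f ⟨k, h⟩ else 0

/-- The form as a polynomial in `x = X 0` and `y = X 1`. -/
noncomputable def poly : MvPolynomial (Fin 2) ℤ :=
  ∑ i : Fin (n + 1), C (f i) * X 0 ^ (n - (i : ℕ)) * X 1 ^ (i : ℕ)

/-- The form is irreducible (over `ℚ`). -/
def IsIrreducible : Prop := Irreducible (MvPolynomial.map (Int.castRingHom ℚ) f.poly)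

/-- The form is primitive: its coefficients have no common prime factor. -/
def IsPrimitive : Prop := Finset.univ.gcd f = 1

/-- The form is nondegenerate: `Δ(f) ≠ 0`. The resultant of the binary `(n-1)`-ic forms
`∂f/∂x` and `∂f/∂y` is `± nⁿ⁻² Δ(f)`. -/
def IsNondegenerate : Prop :=
  Polynomial.resultant
    (MvPolynomial.aeval ![Polynomial.X, 1] (pderiv 0 f.poly) : Polynomial ℤ)
    (MvPolynomial.aeval ![Polynomial.X, 1] (pderiv 1 f.poly) : Polynomial ℤ) (n - 1) (n - 1) ≠ 0

/-- A root `θ` of `f(x, 1)` in `K`. -/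
structure Root (K : Type*) [Field K] where
  /-- the root itself -/
  val : K
  isRoot : MvPolynomial.aeval ![val, 1] f.poly = 0

end BinaryForm

namespace BinaryForm.Root

variable {n : ℕ} {f : BinaryForm n} {K : Type*} [Field K] (θ : f.Root K)

/-- `ζ₀ = 1` and `ζ_k = f₀ θᵏ + ⋯ + f_{k-1} θ` for `k > 0`. -/
def zeta (k : ℕ) : K :=
  if k = 0 then 1 else ∑ i ∈ Finset.range k, (f.coef i : K) * θ.val ^ (k - i)

theorem zeta_zero : θ.zeta 0 = 1 := by simp [zeta]

theorem zeta_of_pos {k : ℕ} (hk : 0 < k) :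
    θ.zeta k = ∑ i ∈ Finset.range k, (f.coef i : K) * θ.val ^ (k - i) := by
  simp [zeta, hk.ne']

theorem sum_succ (k : ℕ) :
    ∑ i ∈ Finset.range (k + 1), (f.coef i : K) * θ.val ^ (k + 1 - i) =
      θ.val * (∑ i ∈ Finset.range k, (f.coef i : K) * θ.val ^ (k - i)) + f.coef k * θ.val := by
  rw [Finset.sum_range_succ, Finset.mul_sum]
  congr 1
  · refine Finset.sum_congr rfl fun i hi => ?_
    have : i < k := Finset.mem_range.1 hi
    rw [show k + 1 - i = (k - i) + 1 by omega, pow_succ]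
    ring
  · simp

theorem zeta_one : θ.zeta 1 = f.coef 0 * θ.val := by simp [zeta]

theorem zeta_succ {k : ℕ} (hk : 0 < k) :
    θ.zeta (k + 1) = θ.val * θ.zeta k + f.coef k * θ.val := by
  rw [zeta_of_pos _ hk, zeta_of_pos _ k.succ_pos, sum_succ]

theorem zeta_n (hn : 0 < n) : θ.zeta n = -(f.coef n : K) := by
  have h := θ.isRoot
  rw [BinaryForm.poly, map_sum] at h
  simp only [map_mul, map_pow, aeval_X, Matrix.cons_val_zero, Matrix.cons_val_one, one_pow, mul_one,
    MvPolynomial.aeval_C] at h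
  have h2 : ∑ i ∈ Finset.range (n + 1), (f.coef i : K) * θ.val ^ (n - i) = 0 := by
    rw [← h, Finset.sum_range]
    refine Finset.sum_congr rfl fun i _ => ?_
    rw [BinaryForm.coef, dif_pos i.2]; simp
  rw [Finset.sum_range_succ] at h2
  rw [zeta_of_pos _ hn]
  simp only [Nat.sub_self, pow_zero, mul_one] at h2
  exact eq_neg_of_add_eq_zero_left h2

theorem zeta_gt {k : ℕ} (hn : 0 < n) (hk : n < k) : θ.zeta k = 0 := by
  induction k, hk using Nat.le_induction with
  | base => rw [zeta_succ _ hn, zeta_n _ hn]; ring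
  | succ m hm ih =>
    rw [zeta_succ _ (by omega), ih]
    have : ¬ m < n + 1 := by omega
    simp [BinaryForm.coef, this]

/-- The `ℤ`-module `⟨1, ζ₁, …, ζ_{n-1}⟩`. -/
def ringModule : Submodule ℤ K := Submodule.span ℤ (insert 1 (θ.zeta '' Set.Ico 1 n))

theorem one_mem_ringModule : (1 : K) ∈ θ.ringModule := Submodule.subset_span (Set.mem_insert _ _)

theorem zeta_mem_ringModule (k : ℕ) : θ.zeta k ∈ θ.ringModule := by
  rcases Nat.eq_zero_or_pos k with rfl | hk
  · rw [zeta_zero]; exact θ.one_mem_ringModule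
  rcases lt_trichotomy k n with h | h | h
  · exact Submodule.subset_span (Set.mem_insert_of_mem _ ⟨k, ⟨hk, h⟩, rfl⟩)
  · subst h
    rw [zeta_n _ hk, ← Int.cast_neg, ← zsmul_one]
    exact Submodule.smul_mem _ _ θ.one_mem_ringModule
  · rcases Nat.eq_zero_or_pos n with rfl | hn
    · have h0 : ((f.coef 0 : ℤ) : K) = 0 := by
        have h1 := θ.isRoot
        simpa [BinaryForm.poly, BinaryForm.coef] using h1
      rw [zeta_of_pos _ hk, Finset.sum_eq_zero]
      · exact zero_mem _
      · intro i _
        rcases Nat.eq_zero_or_pos i with rfl | hi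
        · rw [h0, zero_mul]
        · have : ¬ i < 0 + 1 := by omega
          simp [BinaryForm.coef, this]
    · rw [zeta_gt _ hn h]; exact zero_mem _

theorem zeta_mul_zeta (i j : ℕ) : θ.zeta i * θ.zeta j ∈ θ.ringModule := by
  induction i generalizing j with
  | zero => rw [zeta_zero, one_mul]; exact θ.zeta_mem_ringModule j
  | succ i ih =>
    rcases Nat.eq_zero_or_pos j with rfl | hj
    · rw [zeta_zero, mul_one]; exact θ.zeta_mem_ringModule _
    rcases Nat.eq_zero_or_pos i with rfl | hi
    · have : θ.zeta (0 + 1) * θ.zeta j =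
          f.coef 0 • θ.zeta (j + 1) - f.coef j • θ.zeta 1 := by
        rw [zeta_succ _ hj, zero_add, zeta_one]
        simp only [zsmul_eq_mul]
        ring
      rw [this]
      exact sub_mem (Submodule.smul_mem _ _ (θ.zeta_mem_ringModule _))
        (Submodule.smul_mem _ _ (θ.zeta_mem_ringModule _))
    · have : θ.zeta (i + 1) * θ.zeta j = θ.zeta i * θ.zeta (j + 1)
          + f.coef i • θ.zeta (j + 1) - f.coef j • θ.zeta (i + 1) := by
        rw [zeta_succ _ hj, zeta_succ _ hi]
        simp only [zsmul_eq_mul]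
        ring
      rw [this]
      exact sub_mem (add_mem (ih _) (Submodule.smul_mem _ _ (θ.zeta_mem_ringModule _)))
        (Submodule.smul_mem _ _ (θ.zeta_mem_ringModule _))

/-- The ring `R_f = ⟨1, ζ₁, …, ζ_{n-1}⟩` (as a `ℤ`-module) attached to the form `f`. -/
def ring : Subalgebra ℤ K :=
  θ.ringModule.toSubalgebra θ.one_mem_ringModule (by
    intro x y hx hy
    rw [ringModule] at hx hy
    refine Submodule.span_induction₂ (p := fun x y _ _ => x * y ∈ θ.ringModule)
      ?_ (by simp) (by simp) ?_ ?_ ?_ ?_ hx hy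
    · have gen : ∀ z ∈ insert (1 : K) (θ.zeta '' Set.Ico 1 n), ∃ k, z = θ.zeta k := by
        rintro z (rfl | ⟨k, _, rfl⟩)
        · exact ⟨0, θ.zeta_zero.symm⟩
        · exact ⟨k, rfl⟩
      intro x y hx hy
      obtain ⟨i, rfl⟩ := gen x hx
      obtain ⟨j, rfl⟩ := gen y hy
      exact θ.zeta_mul_zeta i j
    · intro x y z _ _ _ h1 h2; rw [add_mul]; exact add_mem h1 h2
    · intro x y z _ _ _ h1 h2; rw [mul_add]; exact add_mem h1 h2
    · intro r x y _ _ h; rw [smul_mul_assoc]; exact Submodule.smul_mem _ _ h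
    · intro r x y _ _ h; rw [mul_smul_comm]; exact Submodule.smul_mem _ _ h)

instance : Module.Finite ℤ θ.ring := by
  have h : θ.ringModule.FG := Submodule.fg_span (((Set.finite_Ico 1 n).image _).insert _)
  exact Module.Finite.iff_fg.2 h

/-- The `ℤ`-module `⟨1, θ, ζ₂, …, ζ_{n-1}⟩`. -/
def idealModule : Submodule ℤ K :=
  Submodule.span ℤ (insert 1 (insert θ.val (θ.zeta '' Set.Ico 2 n)))

theorem zeta_mem_idealModule (k : ℕ) : θ.zeta k ∈ θ.idealModule := by
  have hle : θ.ringModule ≤ θ.idealModule := by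
    rw [ringModule, Submodule.span_le]
    rintro z (rfl | ⟨k, hk, rfl⟩)
    · exact Submodule.subset_span (Set.mem_insert _ _)
    · rcases Nat.lt_or_ge k 2 with h | h
      · obtain rfl : k = 1 := le_antisymm (Nat.lt_succ_iff.1 h) hk.1
        rw [zeta_one, ← zsmul_eq_mul]
        exact Submodule.smul_mem _ _
          (Submodule.subset_span (Set.mem_insert_of_mem _ (Set.mem_insert _ _)))
      · exact Submodule.subset_span
          (Set.mem_insert_of_mem _ (Set.mem_insert_of_mem _ ⟨k, ⟨h, hk.2⟩, rfl⟩))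
  exact hle (θ.zeta_mem_ringModule k)

theorem zeta_mul_mem_idealModule (k : ℕ) {x : K} (hx : x ∈ θ.idealModule) :
    θ.zeta k * x ∈ θ.idealModule := by
  have hθ : θ.val ∈ θ.idealModule :=
    Submodule.subset_span (Set.mem_insert_of_mem _ (Set.mem_insert _ _))
  have hring : ∀ y ∈ θ.ringModule, y ∈ θ.idealModule := by
    intro y hy
    refine Submodule.span_le.2 ?_ hy
    rintro z (rfl | ⟨k, _, rfl⟩)
    · rw [← θ.zeta_zero]; exact θ.zeta_mem_idealModule 0
    · exact θ.zeta_mem_idealModule k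
  refine Submodule.span_induction (p := fun x _ => θ.zeta k * x ∈ θ.idealModule)
    ?_ (by simp) ?_ ?_ hx
  · rintro z (rfl | rfl | ⟨j, _, rfl⟩)
    · rw [mul_one]; exact θ.zeta_mem_idealModule k
    · rcases Nat.eq_zero_or_pos k with rfl | hk
      · rw [zeta_zero, one_mul]; exact hθ
      · have : θ.zeta k * θ.val = θ.zeta (k + 1) - f.coef k • θ.val := by
          rw [zeta_succ _ hk, zsmul_eq_mul]; ring
        rw [this]
        exact sub_mem (θ.zeta_mem_idealModule _) (Submodule.smul_mem _ _ hθ)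
    · exact hring _ (θ.zeta_mul_zeta k j)
  · intro x y _ _ h1 h2; rw [mul_add]; exact add_mem h1 h2
  · intro r x _ h; rw [mul_smul_comm]; exact Submodule.smul_mem _ _ h

/-- The distinguished ideal `I_f = ⟨1, θ, ζ₂, …, ζ_{n-1}⟩` as an `R_f`-module. -/
def idealSubmodule : Submodule θ.ring K where
  carrier := θ.idealModule
  add_mem' := add_mem
  zero_mem' := zero_mem _
  smul_mem' := by
    rintro ⟨r, hr⟩ x hx
    change r * x ∈ θ.idealModule
    refine Submodule.span_induction (p := fun r _ => r * x ∈ θ.idealModule)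
      ?_ (by simp) ?_ ?_ (show r ∈ θ.ringModule from hr)
    · rintro z (rfl | ⟨k, _, rfl⟩)
      · rwa [one_mul]
      · exact θ.zeta_mul_mem_idealModule k hx
    · intro a b _ _ h1 h2; rw [add_mul]; exact add_mem h1 h2
    · intro c a _ h; rw [smul_mul_assoc]; exact Submodule.smul_mem _ _ h

theorem idealSubmodule_fg : θ.idealSubmodule.FG := by
  have h : (θ.idealSubmodule.restrictScalars ℤ).FG :=
    Submodule.fg_span ((((Set.finite_Ico 2 n).image _).insert _).insert _)
  exact Submodule.FG.of_restrictScalars ℤ h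

/-- The distinguished fractional ideal `I_f = ⟨1, θ, ζ₂, …, ζ_{n-1}⟩` of `R_f`. -/
def ideal [IsFractionRing θ.ring K] : FractionalIdeal θ.ring⁰ K :=
  ⟨θ.idealSubmodule, FractionalIdeal.isFractional_of_fg θ.idealSubmodule_fg⟩

end BinaryForm.Root

namespace BinaryForm

variable {n : ℕ}

/-- The binary `n`-ic invariant `det (A x - B y)` of a pair of `n × n` matrices. -/
noncomputable def pairInvariant (A B : Matrix (Fin n) (Fin n) ℤ) : MvPolynomial (Fin 2) ℤ :=
  Matrix.det ((X 0 : MvPolynomial (Fin 2) ℤ) • A.map (C (σ := Fin 2)) -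
    (X 1 : MvPolynomial (Fin 2) ℤ) • B.map (C (σ := Fin 2)))

/-- The pairs `(A, B)` of symmetric integral `n × n` matrices with `det (A x - B y) = f(x, y)`. -/
@[ext]
structure FormPair (f : BinaryForm n) where
  /-- the first matrix -/
  A : Matrix (Fin n) (Fin n) ℤ
  /-- the second matrix -/
  B : Matrix (Fin n) (Fin n) ℤ
  symmA : A.IsSymm
  symmB : B.IsSymm
  invariant_eq : pairInvariant A B = f.poly

theorem pairInvariant_conj (g : Matrix.SpecialLinearGroup (Fin n) ℤ)
    (A B : Matrix (Fin n) (Fin n) ℤ) :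
    pairInvariant (g.1 * A * g.1.transpose) (g.1 * B * g.1.transpose) = pairInvariant A B := by
  have h : ∀ M : Matrix (Fin n) (Fin n) ℤ, (g.1 * M * g.1.transpose).map (C (σ := Fin 2)) =
      g.1.map C * M.map C * (g.1.map C).transpose := by
    intro M
    rw [Matrix.map_mul, Matrix.map_mul, Matrix.transpose_map]
  have hg : (g.1.map (C (σ := Fin 2))).det = 1 := by
    have := (RingHom.map_det (C (σ := Fin 2) (R := ℤ)) g.1).symm
    rw [g.2, map_one] at this
    exact this
  have key : (X 0 : MvPolynomial (Fin 2) ℤ) • (g.1 * A * g.1.transpose).map (C (σ := Fin 2)) -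
      (X 1 : MvPolynomial (Fin 2) ℤ) • (g.1 * B * g.1.transpose).map (C (σ := Fin 2)) =
      g.1.map (C (σ := Fin 2)) * ((X 0 : MvPolynomial (Fin 2) ℤ) • A.map (C (σ := Fin 2)) -
        (X 1 : MvPolynomial (Fin 2) ℤ) • B.map (C (σ := Fin 2))) *
        (g.1.map (C (σ := Fin 2))).transpose := by
    rw [h, h]
    simp only [Matrix.mul_sub, Matrix.sub_mul, Matrix.mul_smul, Matrix.smul_mul]
  rw [pairInvariant, pairInvariant, key, Matrix.det_mul, Matrix.det_mul, Matrix.det_transpose, hg,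
    one_mul, mul_one]

/-- The action `γ (A, B) = (γ A γᵗ, γ B γᵗ)` of `SL_n(ℤ)`. -/
instance (f : BinaryForm n) : MulAction (Matrix.SpecialLinearGroup (Fin n) ℤ) f.FormPair where
  smul g v :=
    { A := g.1 * v.A * g.1.transpose
      B := g.1 * v.B * g.1.transpose
      symmA := by
        rw [Matrix.IsSymm, Matrix.transpose_mul, Matrix.transpose_mul, Matrix.transpose_transpose,
          v.symmA.eq, Matrix.mul_assoc]
      symmB := by
        rw [Matrix.IsSymm, Matrix.transpose_mul, Matrix.transpose_mul, Matrix.transpose_transpose,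
          v.symmB.eq, Matrix.mul_assoc]
      invariant_eq := by rw [pairInvariant_conj, v.invariant_eq] }
  one_smul v := by
    apply FormPair.ext
    · change (1 : Matrix (Fin n) (Fin n) ℤ) * v.A * (1 : Matrix (Fin n) (Fin n) ℤ).transpose = v.A
      simp
    · change (1 : Matrix (Fin n) (Fin n) ℤ) * v.B * (1 : Matrix (Fin n) (Fin n) ℤ).transpose = v.B
      simp
  mul_smul g h v := by
    apply FormPair.ext
    · change (g.1 * h.1) * v.A * (g.1 * h.1).transpose =
        g.1 * (h.1 * v.A * h.1.transpose) * g.1.transpose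
      simp [Matrix.mul_assoc, Matrix.transpose_mul]
    · change (g.1 * h.1) * v.B * (g.1 * h.1).transpose =
        g.1 * (h.1 * v.B * h.1.transpose) * g.1.transpose
      simp [Matrix.mul_assoc, Matrix.transpose_mul]

/-- The set of `SL_n(ℤ)`-orbits of pairs `(A, B)` with invariant `f`. -/
abbrev Orbit (f : BinaryForm n) : Type :=
  MulAction.orbitRel.Quotient (Matrix.SpecialLinearGroup (Fin n) ℤ) f.FormPair

namespace FormPair

variable {f : BinaryForm n}

/-- The `SL_n(ℤ)`-orbit of a pair. -/
def orbit (v : f.FormPair) : f.Orbit := Quotient.mk _ v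

/-- `(A, B)` is reducible: the quadrics defined by `A` and `B` in `ℙⁿ⁻¹(ℚ)` contain a common
rational linear subspace of projective dimension `(n - 3) / 2`. -/
def IsReducible (v : f.FormPair) : Prop :=
  ∃ W : Submodule ℚ (Fin n → ℚ), Module.finrank ℚ W = (n - 3) / 2 + 1 ∧
    ∀ w ∈ W, w ⬝ᵥ (v.A.map (Int.cast : ℤ → ℚ)).mulVec w = 0 ∧
      w ⬝ᵥ (v.B.map (Int.cast : ℤ → ℚ)).mulVec w = 0

end FormPair

namespace Root

variable {f : BinaryForm n} {K : Type*} [Field K] [NumberField K] (θ : f.Root K)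
  [IsFractionRing θ.ring K]

/-- The correspondence between pairs `v = (A, B)` and pairs `(I, δ)`: `I² ⊆ δ I_f^{n-3}`,
`N(I)² = N(δ) N(I_f^{n-3})`, and `I` has a `ℤ`-basis `α₁, …, α_n`, oriented like
`ζ₀, …, ζ_{n-1}`, such that
`α_i α_j / δ = c_{ij}^{(0)} + ⋯ + c_{ij}^{(n-3)} θⁿ⁻³ + ε (b_{ij} ζ_{n-2} + a_{ij} ζ_{n-1})`
with integers `c_{ij}^{(k)}`. The sign `ε = (-1)^{(n-1)/2}` is the one for which the matrices on
the right satisfy `det (A x - B y) = f(x, y)` (without it this determinant would be `ε f`). -/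
def Corresponds (v : f.FormPair) (I : FractionalIdeal θ.ring⁰ K) (δ : Kˣ) : Prop :=
  I ^ 2 ≤ FractionalIdeal.spanSingleton θ.ring⁰ (δ : K) * θ.ideal ^ (n - 3) ∧
  latticeNorm I ^ 2 = Algebra.norm ℚ (δ : K) * latticeNorm (θ.ideal ^ (n - 3)) ∧
  ∃ (α : Fin n → K) (M : Matrix (Fin n) (Fin n) ℚ),
    LinearIndependent ℤ α ∧
    Submodule.span ℤ (Set.range α) = (I : Submodule θ.ring K).restrictScalars ℤ ∧
    (∀ i, α i = ∑ j, M i j • θ.zeta j) ∧ 0 < M.det ∧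
    ∀ i j, ∃ c : Fin (n - 2) → ℤ,
      α i * α j = (δ : K) * (∑ k, (c k : K) * θ.val ^ (k : ℕ) +
        (-1) ^ ((n - 1) / 2) * ((v.B i j : K) * θ.zeta (n - 2) + (v.A i j : K) * θ.zeta (n - 1)))

/-- `(A, B)` is projective: it corresponds to a pair `(I, δ)` with `I` invertible. -/
def IsProjective (v : f.FormPair) : Prop :=
  ∃ (I : FractionalIdeal θ.ring⁰ K) (δ : Kˣ), θ.Corresponds v I δ ∧ IsUnit I

/-- The set of projective `SL_n(ℤ)`-orbits with invariant `f`. -/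
def ProjectiveOrbit : Type := {o : f.Orbit // ∃ v : f.FormPair, v.orbit = o ∧ θ.IsProjective v}

/-- The set of reducible projective `SL_n(ℤ)`-orbits with invariant `f`. -/
def ReducibleProjectiveOrbit : Type :=
  {o : θ.ProjectiveOrbit // ∃ v : f.FormPair, v.orbit = o.1 ∧ v.IsReducible}

end Root

end BinaryForm

end Forms

end BinaryFormOrder

set_option linter.unusedSectionVars false

/-! Let λ : K → ℚ be the functional taking the coefficient of ζ_{n-1}; it is 1/f₀ on θ^{n-1} and
kills the lower powers of θ. Since I_f^{n-3} has the ℤ-basis 1, θ, …, θ^{n-3}, ζ_{n-2}, ζ_{n-1}, the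
coefficients of ζ_{n-1} and ζ_{n-2} in an element z of it are λ(z) and λ(θz). Hence (A,B)
corresponds to (I,δ) exactly when, up to the sign ε = (-1)^{(n-1)/2}, A and B are the Gram matrices
of λ(xy/δ) and λ(θxy/δ) on an oriented basis of I (`corresponds_iff`).

Orbits. The Gram determinant of λ((x-yθ)·/δ) is computed from a Hankel matrix (`det_form`); with the
norm condition on (I,δ) it becomes f₀N(x-yθ) = f(x,y), so every admissible (I,δ) yields a pair
(`exists_formPair`). Conversely, if one (A,B) comes from two such data, the change of basis
preserves both forms. It therefore commutes with θ and is multiplication by some κ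
(`IsGram.unique`). For invertible I, the inclusion I² ⊆ δI_f^{n-3} together with the norm condition
is an equality. Since f is primitive, I_f is invertible, and division by I_f^{(n-3)/2} identifies
these data with H(O).

Counting. The map (I,δ) ↦ [I] sends H(O) onto Cl₂(O): n is odd, so δ may be replaced by -δ to make
its norm positive. Its kernel is the group of units of norm one modulo squares, and these units form
a free group of rank r₁+r₂-1 (`index_sq_normOneUnits`, `card_HGroup`).

Reducibility. A common isotropic space V of dimension m = (n-1)/2 contains w, θw, …, θ^{m-1}w for
some w ≠ 0 by a dimension count (`exists_cyclic`). Then λ(w²θ^k/δ) = 0 for all k ≤ n-2, so w²/δ is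
rational; as n is odd and N(δ) is a square, δ is a square. So the reducible classes are those of the
pairs (J,1) with J² = O. -/

namespace BinaryFormOrder

/-! ### Dehomogenisation and irreducibility. -/

namespace BinaryForm

variable {n : ℕ} (f : BinaryForm n)

/-- The dehomogenisation `f(x, 1)` with rational coefficients. -/
noncomputable def dehomogenize : Polynomial ℚ :=
  ∑ i : Fin (n + 1), Polynomial.C (f i : ℚ) * Polynomial.X ^ (n - (i : ℕ))

theorem natDegree_dehomogenize_le : f.dehomogenize.natDegree ≤ n := by
  refine Polynomial.natDegree_sum_le_of_forall_le _ _ fun i _ => ?_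
  exact (Polynomial.natDegree_C_mul_X_pow_le _ _).trans (Nat.sub_le _ _)

theorem map_poly_eq :
    MvPolynomial.map (Int.castRingHom ℚ) f.poly = f.dehomogenize.homogenize n := by
  rw [poly, dehomogenize, Polynomial.homogenize_finsetSum, map_sum]
  refine Finset.sum_congr rfl fun i _ => ?_
  rw [Polynomial.homogenize_C_mul, Polynomial.homogenize_X_pow (Nat.sub_le _ _),
    Nat.sub_sub_self (Nat.lt_succ_iff.1 i.2)]
  simp [mul_assoc]

theorem coeff_dehomogenize_n : f.dehomogenize.coeff n = f.coef 0 := by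
  rw [dehomogenize, Polynomial.finsetSum_coeff, Finset.sum_eq_single 0]
  · simp [coef]
  · intro i _ hi
    have h1 : (i : ℕ) ≠ 0 := fun h => hi (Fin.ext h)
    have h2 := i.2
    rw [Polynomial.coeff_C_mul_X_pow, if_neg (by omega)]
  · simp

theorem natDegree_dehomogenize (h0 : f.coef 0 ≠ 0) : f.dehomogenize.natDegree = n := by
  refine le_antisymm f.natDegree_dehomogenize_le (Polynomial.le_natDegree_of_ne_zero ?_)
  rw [coeff_dehomogenize_n]
  exact_mod_cast h0

variable {f}

/-- If f₀ = 0 then y divides f, and the cofactor has degree n-1 ≥ 1, so neither factor is a unit. -/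
theorem IsIrreducible.coef_zero_ne (h : f.IsIrreducible) (hn : 2 ≤ n) : f.coef 0 ≠ 0 := by
  intro h0
  rw [IsIrreducible, map_poly_eq] at h
  have hdeg : f.dehomogenize.natDegree ≤ n - 1 := by
    have h1 := f.natDegree_dehomogenize_le
    rcases h1.lt_or_eq with h1 | h1
    · omega
    · have h2 : f.dehomogenize.leadingCoeff = 0 := by
        rw [Polynomial.leadingCoeff, h1, coeff_dehomogenize_n, h0]; simp
      rw [Polynomial.leadingCoeff_eq_zero] at h2
      simp [h2]
  have e : f.dehomogenize.homogenize n =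
      f.dehomogenize.homogenize (n - 1) * MvPolynomial.X 1 := by
    have := Polynomial.homogenize_mul f.dehomogenize 1 hdeg (n := 1) (by simp)
    rwa [mul_one, Nat.sub_add_cancel (by omega), Polynomial.homogenize_one, pow_one] at this
  rcases h.isUnit_or_isUnit e with h1 | h1
  · have h2 := f.dehomogenize.isHomogeneous_homogenize (n := n - 1)
    have h3 : (f.dehomogenize.homogenize (n - 1)) ≠ 0 := h1.ne_zero
    have h4 := h2.totalDegree h3
    obtain ⟨c, -, hc⟩ := MvPolynomial.isUnit_iff_eq_C_of_isReduced.1 h1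
    rw [hc, MvPolynomial.totalDegree_C] at h4
    omega
  · obtain ⟨c, -, hc⟩ := MvPolynomial.isUnit_iff_eq_C_of_isReduced.1 h1
    have h4 := congrArg MvPolynomial.totalDegree hc
    rw [MvPolynomial.totalDegree_X, MvPolynomial.totalDegree_C] at h4
    omega

/-- Because f₀ ≠ 0, the degrees of the factors of f(x,1) add up to n, so a factorisation homogenises
to one of f. Setting y = 1 carries units back to units. -/
theorem IsIrreducible.dehomogenize (h : f.IsIrreducible) (hn : 2 ≤ n) :
    Irreducible f.dehomogenize := by
  have hdeg := f.natDegree_dehomogenize (h.coef_zero_ne hn)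
  rw [IsIrreducible, map_poly_eq] at h
  have hunit : ∀ (p : Polynomial ℚ) (m : ℕ), p.natDegree ≤ m →
      IsUnit (p.homogenize m) → IsUnit p := by
    intro p m hp hu
    have := hu.map (MvPolynomial.aeval ![Polynomial.X, 1] :
      MvPolynomial (Fin 2) ℚ →ₐ[ℚ] Polynomial ℚ)
    rwa [Polynomial.aeval_homogenize_X_one _ hp] at this
  constructor
  · intro hu
    have := Polynomial.natDegree_eq_zero_of_isUnit hu
    omega
  · intro p q e
    have hne : f.dehomogenize ≠ 0 := by
      intro h0; rw [h0, Polynomial.natDegree_zero] at hdeg; omega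
    have hp : p ≠ 0 := by rintro rfl; simp_all
    have hq : q ≠ 0 := by rintro rfl; simp_all
    have hd : p.natDegree + q.natDegree = n := by
      rw [← Polynomial.natDegree_mul hp hq, ← e, hdeg]
    have e2 := Polynomial.homogenize_mul p q le_rfl le_rfl
    rw [← e, hd] at e2
    exact (h.isUnit_or_isUnit e2).imp (hunit _ _ le_rfl) (hunit _ _ le_rfl)

theorem eval_poly (f : BinaryForm n) (x y : ℤ) : MvPolynomial.eval ![x, y] f.poly =
    ∑ i : Fin (n + 1), f i * x ^ (n - (i : ℕ)) * y ^ (i : ℕ) := by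
  simp [poly]

end BinaryForm

/-! ### The power basis of K and the leading functional λ. -/

namespace BinaryForm.Root

variable {n : ℕ} {f : BinaryForm n} {K : Type*} [Field K] [NumberField K] (θ : f.Root K)

theorem aeval_dehomogenize : Polynomial.aeval θ.val f.dehomogenize = 0 := by
  rw [← θ.isRoot, BinaryForm.dehomogenize, BinaryForm.poly, map_sum, map_sum]
  refine Finset.sum_congr rfl fun i _ => ?_
  simp

theorem minpoly_eq (hirr : f.IsIrreducible) (hn : 2 ≤ n) :
    Polynomial.C (f.coef 0 : ℚ) * minpoly ℚ θ.val = f.dehomogenize := by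
  have h := minpoly.eq_of_irreducible (hirr.dehomogenize hn) θ.aeval_dehomogenize
  have h0 : (f.coef 0 : ℚ) ≠ 0 := by exact_mod_cast hirr.coef_zero_ne hn
  rw [← h, Polynomial.leadingCoeff, f.natDegree_dehomogenize (hirr.coef_zero_ne hn),
    BinaryForm.coeff_dehomogenize_n, mul_comm, mul_assoc, ← Polynomial.C_mul,
    inv_mul_cancel₀ h0, Polynomial.C_1, mul_one]

theorem natDegree_minpoly (hirr : f.IsIrreducible) (hn : 2 ≤ n) :
    (minpoly ℚ θ.val).natDegree = n := by
  have h := congrArg Polynomial.natDegree (θ.minpoly_eq hirr hn)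
  rwa [Polynomial.natDegree_C_mul (by exact_mod_cast hirr.coef_zero_ne hn),
    f.natDegree_dehomogenize (hirr.coef_zero_ne hn)] at h

/-- The elements of `θ.ring` are polynomials in θ and K is its fraction field. This is what makes
the degree of K equal to n. -/
theorem adjoin_eq_top [IsFractionRing θ.ring K] :
    IntermediateField.adjoin ℚ {θ.val} = ⊤ := by
  have hθ : θ.val ∈ IntermediateField.adjoin ℚ {θ.val} :=
    IntermediateField.mem_adjoin_simple_self _ _
  have hz : ∀ k, θ.zeta k ∈ IntermediateField.adjoin ℚ {θ.val} := by
    intro k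
    rw [zeta]
    split_ifs
    · exact one_mem _
    · exact sum_mem fun i _ => mul_mem (intCast_mem _ _) (pow_mem hθ _)
  have hr : ∀ x ∈ θ.ring, x ∈ IntermediateField.adjoin ℚ {θ.val} := by
    intro x hx
    refine Submodule.span_induction (p := fun x _ => x ∈ IntermediateField.adjoin ℚ {θ.val})
      ?_ (zero_mem _) (fun _ _ _ _ => add_mem) ?_ (show x ∈ θ.ringModule from hx)
    · rintro z (rfl | ⟨k, _, rfl⟩)
      · exact one_mem _
      · exact hz k
    · intro a x _ h; exact zsmul_mem h a
  rw [eq_top_iff]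
  intro x _
  obtain ⟨a, b, _, rfl⟩ := IsFractionRing.div_surjective (A := θ.ring) x
  exact div_mem (hr _ a.2) (hr _ b.2)

theorem exists_basis [IsFractionRing θ.ring K] (hirr : f.IsIrreducible) (hn : 2 ≤ n) :
    ∃ b : Module.Basis (Fin n) ℚ K, ∀ i, b i = θ.val ^ (i : ℕ) := by
  have hint : IsIntegral ℚ θ.val := IsIntegral.of_finite ℚ θ.val
  have hd := θ.natDegree_minpoly hirr hn
  have hli : LinearIndependent ℚ fun i : Fin n => θ.val ^ (i : ℕ) := by
    have := linearIndependent_pow (K := ℚ) θ.val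
    rwa [hd] at this
  have hfr : Module.finrank ℚ K = n := by
    rw [← hd, ← IntermediateField.adjoin.finrank hint, θ.adjoin_eq_top,
      IntermediateField.finrank_top']
  have : Nonempty (Fin n) := ⟨⟨0, by omega⟩⟩
  exact ⟨basisOfLinearIndependentOfCardEqFinrank hli (by simp [hfr]), fun i => by simp⟩

/-- A rational basis of `K` consisting of the powers of `θ`, for a form with `f₀ ≠ 0` and
`n ≥ 3` odd. -/
structure Frame where
  basis : Module.Basis (Fin n) ℚ K
  basis_apply : ∀ i, basis i = θ.val ^ (i : ℕ)
  coef_zero_ne : f.coef 0 ≠ 0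
  odd : Odd n
  three_le : 3 ≤ n
  minpoly_eq : Polynomial.C (f.coef 0 : ℚ) * minpoly ℚ θ.val = f.dehomogenize

namespace Frame

variable {θ} (b : θ.Frame)

include b in
theorem coef_zero_ne' : (f.coef 0 : ℚ) ≠ 0 := by exact_mod_cast b.coef_zero_ne

include b in
theorem finrank_eq : Module.finrank ℚ K = n := by
  rw [Module.finrank_eq_card_basis b.basis, Fintype.card_fin]

/-- The functional taking the coefficient of `ζ_{n-1}`. -/
noncomputable def lead : K →ₗ[ℚ] ℚ :=
  -- Among the ζ_k with k < n only ζ_{n-1} involves θ^{n-1}, with coefficient f₀; hence the value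
  -- 1/f₀.
  b.basis.constr ℚ fun i => if (i : ℕ) + 1 = n then (f.coef 0 : ℚ)⁻¹ else 0

theorem lead_pow_lt {k : ℕ} (hk : k + 1 < n) : b.lead (θ.val ^ k) = 0 := by
  have := b.basis.constr_basis ℚ
    (fun i => if (i : ℕ) + 1 = n then (f.coef 0 : ℚ)⁻¹ else 0) ⟨k, by omega⟩
  rw [b.basis_apply] at this
  simp only at this
  rw [if_neg (by omega)] at this
  exact this

theorem lead_pow {k : ℕ} (hk : k + 1 = n) : b.lead (θ.val ^ k) = (f.coef 0 : ℚ)⁻¹ := by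
  have := b.basis.constr_basis ℚ
    (fun i => if (i : ℕ) + 1 = n then (f.coef 0 : ℚ)⁻¹ else 0) ⟨k, by omega⟩
  rw [b.basis_apply] at this
  simp only at this
  rw [if_pos hk] at this
  exact this

theorem lead_int_mul (c : ℤ) (x : K) : b.lead (c * x) = c * b.lead x := by
  rw [← zsmul_eq_mul, map_zsmul, zsmul_eq_mul]

theorem lead_zeta {k : ℕ} (hk : 0 < k) (hkn : k < n) :
    b.lead (θ.zeta k) = if k + 1 = n then 1 else 0 := by
  rw [θ.zeta_of_pos hk, map_sum]
  split_ifs with h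
  · rw [Finset.sum_eq_single 0]
    · rw [lead_int_mul, Nat.sub_zero, b.lead_pow h, mul_inv_cancel₀ b.coef_zero_ne']
    · intro i hi h0
      rw [lead_int_mul, b.lead_pow_lt (by omega), mul_zero]
    · intro h0; exact absurd (Finset.mem_range.2 hk) h0
  · refine Finset.sum_eq_zero fun i hi => ?_
    rw [lead_int_mul, b.lead_pow_lt (by omega), mul_zero]

/-- By θζ_k = ζ_{k+1} - f_kθ, multiplication by θ moves the coefficient of ζ_{n-2} to where λ sees
it. The term θ is invisible to λ because n ≥ 3, and so is the constant ζ_n = -f_n. -/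
theorem lead_mul_zeta {k : ℕ} (hk : 0 < k) (hkn : k < n) :
    b.lead (θ.val * θ.zeta k) = if k + 2 = n then 1 else 0 := by
  have h3 := b.three_le
  have e : θ.val * θ.zeta k = θ.zeta (k + 1) - f.coef k * θ.val ^ 1 := by
    rw [zeta_succ _ hk]; ring
  rw [e, map_sub, lead_int_mul, b.lead_pow_lt (by omega), mul_zero, sub_zero]
  rcases Nat.lt_or_ge (k + 1) n with h | h
  · rw [b.lead_zeta (by omega) h]
  · have hk' : k + 1 = n := by omega
    rw [if_neg (by omega), hk', zeta_n _ (by omega)]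
    have := b.lead_int_mul (-f.coef n) (θ.val ^ 0)
    rw [b.lead_pow_lt (by omega)] at this
    simpa using this

/-- Nondegeneracy of the pairing λ(xy): for z ≠ 0 the element y = z⁻¹θ^{n-1} gives the value 1/f₀ ≠
0. -/
theorem eq_zero_of_lead {z : K} (h : ∀ y, b.lead (z * y) = 0) : z = 0 := by
  by_contra hz
  have h1 := h (z⁻¹ * θ.val ^ (n - 1))
  rw [mul_inv_cancel_left₀ hz, b.lead_pow (by have := b.three_le; omega)] at h1
  exact inv_ne_zero b.coef_zero_ne' h1

/-- The two functionals that recover the coefficients of `ζ_{n-1}` and `ζ_{n-2}`. -/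
theorem lead_combination (c : Fin (n - 2) → ℤ) (u v w : ℤ) :
    b.lead (∑ k, (c k : K) * θ.val ^ (k : ℕ) +
        (w : K) * ((u : K) * θ.zeta (n - 2) + (v : K) * θ.zeta (n - 1))) = w * v ∧
    b.lead (θ.val * (∑ k, (c k : K) * θ.val ^ (k : ℕ) +
        (w : K) * ((u : K) * θ.zeta (n - 2) + (v : K) * θ.zeta (n - 1)))) = w * u := by
  have h3 := b.three_le
  constructor
  · rw [map_add, map_sum, Finset.sum_eq_zero, lead_int_mul, map_add, lead_int_mul, lead_int_mul,
      b.lead_zeta (by omega) (by omega), b.lead_zeta (by omega) (by omega),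
      if_neg (by omega), if_pos (by omega)]
    · ring
    · intro i _
      rw [lead_int_mul, b.lead_pow_lt (by omega), mul_zero]
  · have e : θ.val * (∑ k, (c k : K) * θ.val ^ (k : ℕ) +
        (w : K) * ((u : K) * θ.zeta (n - 2) + (v : K) * θ.zeta (n - 1))) =
        ∑ k, (c k : K) * θ.val ^ ((k : ℕ) + 1) + (w : K) * ((u : K) * (θ.val * θ.zeta (n - 2)) +
          (v : K) * (θ.val * θ.zeta (n - 1))) := by
      rw [mul_add, Finset.mul_sum]
      congr 1
      · exact Finset.sum_congr rfl fun i _ => by ring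
      · ring
    rw [e, map_add, map_sum, Finset.sum_eq_zero, lead_int_mul, map_add, lead_int_mul, lead_int_mul,
      b.lead_mul_zeta (by omega) (by omega), b.lead_mul_zeta (by omega) (by omega),
      if_pos (by omega), if_neg (by omega)]
    · ring
    · intro i _
      rw [lead_int_mul, b.lead_pow_lt (by omega), mul_zero]

end Frame

theorem nonempty_frame [IsFractionRing θ.ring K] (hirr : f.IsIrreducible) (hn : 3 ≤ n)
    (hodd : Odd n) : Nonempty θ.Frame := by
  obtain ⟨b, hb⟩ := θ.exists_basis hirr (by omega)
  exact ⟨⟨b, hb, hirr.coef_zero_ne (by omega), hodd, hn, θ.minpoly_eq hirr (by omega)⟩⟩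

end BinaryForm.Root


instance {R P : Type*} [CommRing R] {S : Submonoid R} [CommRing P] [Algebra R P] :
    AddSubgroupClass (FractionalIdeal S P) P where
  add_mem {I} _ _ hx hy := add_mem (S := Submodule R P) (s := I) hx hy
  zero_mem I := zero_mem (I : Submodule R P)
  neg_mem {I} _ hx := neg_mem (S := Submodule R P) (s := I) hx

/-! ### The index of two full lattices as a determinant. -/

section Index

variable {ι E : Type*} [Fintype ι] [DecidableEq ι] [AddCommGroup E] [Module ℚ E]

theorem latticeIndex_of_basis_of_le (b b' : Module.Basis ι ℚ E)
    (h : AddSubgroup.closure (Set.range b') ≤ AddSubgroup.closure (Set.range b)) :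
    Commens (AddSubgroup.closure (Set.range b)) (AddSubgroup.closure (Set.range b')) ∧
    latticeIndex (AddSubgroup.closure (Set.range b)) (AddSubgroup.closure (Set.range b')) =
      |b.det b'| := by
  have h1 := AddSubgroup.relIndex_eq_abs_det _ _ h b' b rfl rfl
  have h2 := AddSubgroup.relIndex_eq_one.2 h
  have h3 : |b.det b'| ≠ 0 := abs_ne_zero.2 (Module.Basis.isUnit_det b b').ne_zero
  refine ⟨⟨?_, by rw [h2]; exact one_ne_zero⟩, ?_⟩
  · rw [← h1] at h3
    exact_mod_cast h3
  · rw [latticeIndex, h1, h2]; simp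

theorem Basis_det_mul_det (b b' b'' : Module.Basis ι ℚ E) :
    b.det b' * b'.det b'' = b.det b'' := by
  rw [Module.Basis.det_apply, Module.Basis.det_apply, Module.Basis.det_apply, ← Matrix.det_mul,
    Module.Basis.toMatrix_mul_toMatrix]

/-- With d a common denominator of the coordinates of b', the lattice spanned by d·b' lies in both
lattices. The nested case and multiplicativity of index and determinant then give the general one.
-/
theorem latticeIndex_of_basis (b b' : Module.Basis ι ℚ E) :
    Commens (AddSubgroup.closure (Set.range b)) (AddSubgroup.closure (Set.range b')) ∧
    latticeIndex (AddSubgroup.closure (Set.range b)) (AddSubgroup.closure (Set.range b')) =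
      |b.det b'| := by
  obtain ⟨⟨d, hd⟩, h⟩ := IsLocalization.exist_integer_multiples_of_finset (nonZeroDivisors ℤ)
    (Finset.univ.image fun p : ι × ι => b.repr (b' p.1) p.2)
  have hd0 : (d : ℚ) ≠ 0 := by exact_mod_cast nonZeroDivisors.ne_zero hd
  let c : Module.Basis ι ℚ E := b'.unitsSMul fun _ => Units.mk0 (d : ℚ) hd0
  have hc : ∀ i, c i = (d : ℚ) • b' i := fun i => by simp [c, Module.Basis.unitsSMul_apply]
  have hcb' : AddSubgroup.closure (Set.range c) ≤ AddSubgroup.closure (Set.range b') := by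
    rw [AddSubgroup.closure_le]
    rintro _ ⟨i, rfl⟩
    rw [hc, Int.cast_smul_eq_zsmul]
    exact zsmul_mem (AddSubgroup.subset_closure (Set.mem_range_self i)) _
  have hcb : AddSubgroup.closure (Set.range c) ≤ AddSubgroup.closure (Set.range b) := by
    rw [AddSubgroup.closure_le]
    rintro _ ⟨i, rfl⟩
    rw [hc, ← b.sum_repr (b' i), Finset.smul_sum]
    refine sum_mem fun j _ => ?_
    obtain ⟨m, hm⟩ := h (b.repr (b' i) j) (Finset.mem_image.2 ⟨(i, j), Finset.mem_univ _, rfl⟩)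
    have : (d : ℚ) • b.repr (b' i) j • b j = m • b j := by
      rw [smul_smul, ← Int.cast_smul_eq_zsmul ℚ]
      congr 1
      rw [eq_intCast] at hm
      rw [hm, zsmul_eq_mul]
    rw [this]
    exact zsmul_mem (AddSubgroup.subset_closure (Set.mem_range_self j)) _
  obtain ⟨k1, i1⟩ := latticeIndex_of_basis_of_le b c hcb
  obtain ⟨k2, i2⟩ := latticeIndex_of_basis_of_le b' c hcb'
  refine ⟨k1.trans k2.symm, ?_⟩
  have i3 := latticeIndex_mul (k1.trans k2.symm) k2
  rw [i1, i2, ← Basis_det_mul_det b b' c, abs_mul] at i3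
  exact mul_right_cancel₀ (abs_ne_zero.2 (Module.Basis.isUnit_det b' c).ne_zero) i3

end Index

/-! ### Explicit ℤ-bases of the powers of I_f, and its invertibility. -/

namespace BinaryForm.Root

variable {n : ℕ} {f : BinaryForm n} {K : Type*} [Field K] [NumberField K] (θ : f.Root K)

/-- The `ℤ`-basis `1, θ, …, θᵏ, ζ_{k+1}, …, ζ_{n-1}` of `I_fᵏ`. -/
def powZeta (k i : ℕ) : K := if i ≤ k then θ.val ^ i else θ.zeta i

theorem powZeta_zero (i : ℕ) : θ.powZeta 0 i = θ.zeta i := by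
  rw [powZeta]
  split_ifs with h
  · obtain rfl : i = 0 := by omega
    rw [zeta_zero, pow_zero]
  · rfl

/-- The lattice `⟨1, θ, …, θᵏ, ζ_{k+1}, …, ζ_{n-1}⟩`. -/
def powModule (k : ℕ) : Submodule ℤ K :=
  Submodule.span ℤ (Set.range fun i : Fin n => θ.powZeta k i)

theorem powZeta_mem (k : ℕ) {i : ℕ} (hi : i < n) : θ.powZeta k i ∈ θ.powModule k :=
  Submodule.subset_span ⟨⟨i, hi⟩, rfl⟩

theorem pow_mem_powModule {k i : ℕ} (hi : i ≤ k) (hin : i < n) :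
    θ.val ^ i ∈ θ.powModule k := by
  have := θ.powZeta_mem k hin
  rwa [powZeta, if_pos hi] at this

theorem zeta_mem_powModule (hn : 0 < n) (k i : ℕ) : θ.zeta i ∈ θ.powModule k := by
  rcases Nat.lt_or_ge n i with h | h
  · rw [zeta_gt _ hn h]; exact zero_mem _
  rcases h.eq_or_lt with rfl | h
  · rw [zeta_n _ hn, ← Int.cast_neg, ← mul_one ((-f.coef i : ℤ) : K), ← zsmul_eq_mul, ← pow_zero θ.val]
    exact Submodule.smul_mem _ _ (θ.pow_mem_powModule (Nat.zero_le _) hn)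
  rcases Nat.lt_or_ge k i with hk | hk
  · have := θ.powZeta_mem k h
    rwa [powZeta, if_neg (by omega)] at this
  · rcases Nat.eq_zero_or_pos i with rfl | hi
    · rw [zeta_zero, ← pow_zero θ.val]; exact θ.pow_mem_powModule hk h
    rw [zeta_of_pos _ hi]
    refine sum_mem fun j hj => ?_
    rw [← zsmul_eq_mul]
    exact Submodule.smul_mem _ _ (θ.pow_mem_powModule (by omega) (by omega))

theorem powModule_mono (hn : 0 < n) (k : ℕ) : θ.powModule k ≤ θ.powModule (k + 1) := by
  rw [powModule, Submodule.span_le]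
  rintro _ ⟨i, rfl⟩
  simp only [powZeta]
  split_ifs with h
  · exact θ.pow_mem_powModule (by omega) i.2
  · exact θ.zeta_mem_powModule hn _ _

theorem mul_mem_powModule (hn : 2 ≤ n) {k : ℕ} (hk : k + 1 < n) {x : K} (hx : x ∈ θ.powModule k) :
    θ.val * x ∈ θ.powModule (k + 1) := by
  refine Submodule.span_induction (p := fun x _ => θ.val * x ∈ θ.powModule (k + 1))
    ?_ (by simp) ?_ ?_ hx
  · rintro _ ⟨i, rfl⟩
    simp only [powZeta]
    split_ifs with h
    · rw [← pow_succ']; exact θ.pow_mem_powModule (by omega) (by omega)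
    · have : θ.val * θ.zeta i = θ.zeta (i + 1) - f.coef i • θ.val ^ 1 := by
        rw [zeta_succ _ (by omega), zsmul_eq_mul]; ring
      rw [this]
      exact sub_mem (θ.zeta_mem_powModule (by omega) _ _)
        (Submodule.smul_mem _ _ (θ.pow_mem_powModule (by omega) (by omega)))
  · intro x y _ _ h1 h2; rw [mul_add]; exact add_mem h1 h2
  · intro r x _ h; rw [mul_smul_comm]; exact Submodule.smul_mem _ _ h

theorem ringModule_eq (hn : 0 < n) : θ.ringModule = θ.powModule 0 := by
  apply le_antisymm
  · rw [ringModule, Submodule.span_le]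
    rintro _ (rfl | ⟨k, _, rfl⟩)
    · rw [← zeta_zero θ]; exact θ.zeta_mem_powModule hn _ _
    · exact θ.zeta_mem_powModule hn _ _
  · rw [powModule, Submodule.span_le]
    rintro _ ⟨i, rfl⟩
    simp only [powZeta_zero]
    exact θ.zeta_mem_ringModule _

variable [IsFractionRing θ.ring K]

theorem mem_one_iff (x : K) : x ∈ (1 : FractionalIdeal θ.ring⁰ K) ↔ x ∈ θ.ringModule := by
  rw [FractionalIdeal.mem_one_iff]
  exact ⟨by rintro ⟨y, rfl⟩; exact y.2, fun h => ⟨⟨x, h⟩, rfl⟩⟩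

theorem mem_ideal_iff (x : K) : x ∈ θ.ideal ↔ x ∈ θ.idealModule := Iff.rfl

theorem one_mem_ideal : (1 : K) ∈ θ.ideal :=
  Submodule.subset_span (Set.mem_insert _ _)

theorem val_mem_ideal : θ.val ∈ θ.ideal :=
  Submodule.subset_span (Set.mem_insert_of_mem _ (Set.mem_insert _ _))

/-- Multiplication by the generators 1 and θ of I_f raises the level of the explicit lattice by at
most one, and the generators ζ_j lie in the order, which preserves I_f^k. Conversely θ^i = θ^{i-1}·θ
and ζ_i = 1·ζ_i are products of the required kind. -/
theorem mem_ideal_pow_iff (hn : 2 ≤ n) {k : ℕ} (hk : k < n) (x : K) :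
    x ∈ θ.ideal ^ k ↔ x ∈ θ.powModule k := by
  induction k generalizing x with
  | zero => rw [pow_zero, mem_one_iff, ringModule_eq _ (by omega)]
  | succ k ih =>
    have ih := fun x => ih (by omega) x
    have h1 : (1 : K) ∈ θ.ideal ^ k := by
      rw [ih, ← pow_zero θ.val]; exact θ.pow_mem_powModule (Nat.zero_le _) (by omega)
    constructor
    · intro hx
      rw [pow_succ] at hx
      refine FractionalIdeal.mul_induction_on hx ?_ fun _ _ => add_mem
      intro x hx y hy
      have hxk := (ih x).1 hx
      refine Submodule.span_induction (p := fun y _ => x * y ∈ θ.powModule (k + 1))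
        ?_ (by simp) ?_ ?_ ((θ.mem_ideal_iff y).1 hy)
      · rintro _ (rfl | rfl | ⟨j, _, rfl⟩)
        · rw [mul_one]; exact θ.powModule_mono (by omega) _ hxk
        · rw [mul_comm]; exact θ.mul_mem_powModule hn hk hxk
        · apply θ.powModule_mono (by omega)
          rw [← ih, mul_comm]
          exact Submodule.smul_mem (((θ.ideal ^ k : FractionalIdeal θ.ring⁰ K) :
            Submodule θ.ring K)) (⟨θ.zeta j, θ.zeta_mem_ringModule j⟩ : θ.ring) hx
      · intro x y _ _ h1 h2; rw [mul_add]; exact add_mem h1 h2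
      · intro r x _ h; rw [mul_smul_comm]; exact Submodule.smul_mem _ _ h
    · intro hx
      refine Submodule.span_induction (p := fun x _ => x ∈ θ.ideal ^ (k + 1))
        ?_ (zero_mem _) (fun _ _ _ _ => add_mem) (fun c x _ h => zsmul_mem h c) hx
      rintro _ ⟨i, rfl⟩
      simp only [powZeta]
      rw [pow_succ]
      split_ifs with h
      · rcases Nat.eq_zero_or_pos (i : ℕ) with h0 | h0
        · rw [h0, pow_zero, ← mul_one (1 : K)]
          exact FractionalIdeal.mul_mem_mul h1 θ.one_mem_ideal
        · rw [← Nat.sub_add_cancel h0, pow_succ]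
          refine FractionalIdeal.mul_mem_mul ?_ θ.val_mem_ideal
          rw [ih]
          exact θ.pow_mem_powModule (by omega) (by omega)
      · rw [← one_mul (θ.zeta i)]
        exact FractionalIdeal.mul_mem_mul h1 (θ.zeta_mem_idealModule _)

/-- The inverse is generated by z₀ = f₀ and z_k = ζ_k + f_k for 0 < k < n. Since θz_k = ζ_{k+1}, the
product with I_f lies in the order. It contains f₀ = 1·z₀, the differences z_k - θz_{k-1} = f_k, and
-θz_{n-1} = f_n, hence 1 by primitivity. -/
theorem isUnit_ideal (hn : 0 < n) (hprim : f.IsPrimitive) : IsUnit θ.ideal := by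
  classical
  -- The convention ζ₀ = 1 stands in place of the empty sum 0, so at k = 0 the correction is f₀ - 1.
  let z : ℕ → K := fun k => θ.zeta k + if k = 0 then f.coef 0 - 1 else f.coef k
  have hz : ∀ k, z k ∈ θ.ringModule := by
    intro k
    have hc : ∀ c : ℤ, (c : K) ∈ θ.ringModule := fun c => by
      rw [← mul_one (c : K), ← zsmul_eq_mul]; exact Submodule.smul_mem _ _ θ.one_mem_ringModule
    refine add_mem (θ.zeta_mem_ringModule k) ?_
    split_ifs
    · exact_mod_cast hc (f.coef 0 - 1)
    · exact hc _
  have hz0 : z 0 = f.coef 0 := by simp [z, zeta_zero]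
  have hzk : ∀ k, 0 < k → z k = θ.zeta k + f.coef k := fun k hk => by simp [z, hk.ne']
  have hθz : ∀ k, θ.val * z k = θ.zeta (k + 1) := by
    intro k
    rcases Nat.eq_zero_or_pos k with rfl | hk
    · rw [hz0, zeta_one, mul_comm]
    · rw [hzk k hk, zeta_succ _ hk]; ring
  let S : Submodule θ.ring K := Submodule.span θ.ring (z '' (Finset.range n : Set ℕ))
  have hS : S.FG := Submodule.fg_span ((Finset.range n).finite_toSet.image z)
  let J : FractionalIdeal θ.ring⁰ K := ⟨S, FractionalIdeal.isFractional_of_fg hS⟩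
  have hmemz : ∀ k < n, z k ∈ J := fun k hk =>
    Submodule.subset_span ⟨k, by simpa using hk, rfl⟩
  have hle : θ.ideal * J ≤ 1 := by
    rw [FractionalIdeal.mul_le]
    intro x hx y hy
    refine Submodule.span_induction (p := fun y _ => x * y ∈ (1 : FractionalIdeal θ.ring⁰ K))
      ?_ ?_ ?_ ?_ (show y ∈ S from hy)
    · rintro _ ⟨k, _, rfl⟩
      rw [mem_one_iff]
      refine Submodule.span_induction (p := fun x _ => x * z k ∈ θ.ringModule)
        ?_ (by simp) ?_ ?_ ((θ.mem_ideal_iff x).1 hx)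
      · rintro _ (rfl | rfl | ⟨j, _, rfl⟩)
        · rw [one_mul]; exact hz k
        · rw [hθz]; exact θ.zeta_mem_ringModule _
        · exact θ.ring.mul_mem (θ.zeta_mem_ringModule j) (hz k)
      · intro x y _ _ h1 h2; rw [add_mul]; exact add_mem h1 h2
      · intro r x _ h; rw [smul_mul_assoc]; exact Submodule.smul_mem _ _ h
    · rw [mul_zero]; exact zero_mem _
    · intro x y _ _ h1 h2; rw [mul_add]; exact add_mem h1 h2
    · intro r x _ h; rw [mul_smul_comm]
      exact Submodule.smul_mem ((1 : FractionalIdeal θ.ring⁰ K) : Submodule θ.ring K) r h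
  have hcoef : ∀ k ≤ n, (f.coef k : K) ∈ θ.ideal * J := by
    intro k hk
    rcases Nat.eq_zero_or_pos k with rfl | hk0
    · rw [← hz0, ← one_mul (z 0)]
      exact FractionalIdeal.mul_mem_mul θ.one_mem_ideal (hmemz 0 hn)
    have h1 : θ.zeta k ∈ θ.ideal * J := by
      rw [← Nat.sub_add_cancel hk0, ← hθz]
      exact FractionalIdeal.mul_mem_mul θ.val_mem_ideal (hmemz _ (by omega))
    rcases hk.eq_or_lt with rfl | hk
    · rw [zeta_n _ hn] at h1
      have := neg_mem h1
      rwa [neg_neg] at this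
    · have h2 : z k ∈ θ.ideal * J := by
        rw [← one_mul (z k)]
        exact FractionalIdeal.mul_mem_mul θ.one_mem_ideal (hmemz k hk)
      have h3 := sub_mem h2 h1
      rwa [hzk k hk0, add_sub_cancel_left] at h3
  have hone : (1 : K) ∈ θ.ideal * J := by
    obtain ⟨g, hg⟩ := Finset.gcd_eq_sum_mul (Finset.univ : Finset (Fin (n + 1))) f
    rw [show Finset.univ.gcd f = 1 from hprim] at hg
    have : (1 : K) = ∑ i, g i • ((f i : ℤ) : K) := by
      rw [← Int.cast_one, hg, Int.cast_sum]
      refine Finset.sum_congr rfl fun i _ => ?_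
      rw [zsmul_eq_mul, Int.cast_mul, mul_comm]
    rw [this]
    refine sum_mem fun i _ => zsmul_mem ?_ _
    have := hcoef i (Nat.lt_succ_iff.1 i.2)
    rwa [BinaryForm.coef, dif_pos i.2] at this
  exact IsUnit.of_mul_eq_one J (le_antisymm hle (FractionalIdeal.one_le.2 hone))

end BinaryForm.Root


/-! ### Determinants of the explicit bases and norms of ideals. -/

namespace BinaryForm.Root

variable {n : ℕ} {f : BinaryForm n} {K : Type*} [Field K] [NumberField K] {θ : f.Root K}

namespace Frame

variable (b : θ.Frame)

include b in
theorem n_pos : 0 < n := by have := b.three_le; omega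

theorem repr_pow {k : ℕ} (hk : k < n) (j : Fin n) :
    b.basis.repr (θ.val ^ k) j = if (j : ℕ) = k then 1 else 0 := by
  have : θ.val ^ k = b.basis ⟨k, hk⟩ := by rw [b.basis_apply]
  rw [this, Module.Basis.repr_self, Finsupp.single_apply]
  simp [Fin.ext_iff, eq_comm]

theorem repr_zeta {k : ℕ} (hk : 0 < k) (hkn : k < n) (j : Fin n) (hj : k ≤ j) :
    b.basis.repr (θ.zeta k) j = if (j : ℕ) = k then (f.coef 0 : ℚ) else 0 := by
  have e : ∀ (c : ℤ) (x : K), b.basis.repr (c * x) j = c * b.basis.repr x j := by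
    intro c x
    rw [← zsmul_eq_mul, map_zsmul, Finsupp.smul_apply, zsmul_eq_mul]
  rw [θ.zeta_of_pos hk, map_sum, Finsupp.finsetSum_apply, Finset.sum_eq_single 0]
  · rw [e, Nat.sub_zero, b.repr_pow hkn]
    split_ifs <;> simp
  · intro i hi h0
    rw [e, b.repr_pow (by omega), if_neg (by omega), mul_zero]
  · intro h0; exact absurd (Finset.mem_range.2 hk) h0

/-- The matrix is upper triangular: the powers of θ contribute 1 to the diagonal and the n-1-k
elements ζ_i contribute f₀. -/
theorem det_powZeta {k : ℕ} (hk : k < n) :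
    b.basis.det (fun i : Fin n => θ.powZeta k i) = (f.coef 0 : ℚ) ^ (n - 1 - k) := by
  rw [Module.Basis.det_apply, Matrix.det_of_isUpperTriangular]
  · have : ∀ i : Fin n, b.basis.toMatrix (fun i : Fin n => θ.powZeta k i) i i =
        if (i : ℕ) ≤ k then 1 else (f.coef 0 : ℚ) := by
      intro i
      rw [Module.Basis.toMatrix_apply, powZeta]
      split_ifs with h
      · rw [b.repr_pow i.2, if_pos rfl]
      · rw [b.repr_zeta (by omega) i.2 i le_rfl, if_pos rfl]
    rw [Finset.prod_congr rfl fun i _ => this i,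
      Fin.prod_univ_eq_prod_range (fun i => if i ≤ k then (1 : ℚ) else f.coef 0) n,
      ← Finset.prod_range_mul_prod_Ico _ (show k + 1 ≤ n from hk),
      Finset.prod_eq_one, one_mul, Finset.prod_congr rfl (g := fun _ => (f.coef 0 : ℚ)),
      Finset.prod_const, Nat.card_Ico]
    · congr 1; omega
    · intro i hi
      rw [Finset.mem_Ico] at hi
      rw [if_neg (by omega)]
    · intro i hi
      rw [Finset.mem_range] at hi
      rw [if_pos (by omega)]
  · intro i j hij
    have hij : (j : ℕ) < i := hij
    rw [Module.Basis.toMatrix_apply, powZeta]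
    split_ifs with h
    · rw [b.repr_pow j.2, if_neg (by omega)]
    · rw [b.repr_zeta (by omega) j.2 i hij.le, if_neg (by omega)]

/-- A family with nonzero determinant with respect to the power basis is a basis. -/
noncomputable def basisOfDet (v : Fin n → K) (hv : b.basis.det v ≠ 0) : Module.Basis (Fin n) ℚ K :=
  Module.Basis.mk ((Module.Basis.is_basis_iff_det b.basis).2 hv.isUnit).1
    ((Module.Basis.is_basis_iff_det b.basis).2 hv.isUnit).2.ge

theorem basisOfDet_apply (v : Fin n → K) (hv : b.basis.det v ≠ 0) :
    (b.basisOfDet v hv : Fin n → K) = v := Module.Basis.coe_mk _ _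

/-- The rational basis `1, θ, …, θᵏ, ζ_{k+1}, …, ζ_{n-1}`. -/
noncomputable def powBasis (k : ℕ) (hk : k < n) : Module.Basis (Fin n) ℚ K :=
  b.basisOfDet (fun i => θ.powZeta k i) (by
    rw [b.det_powZeta hk]; exact pow_ne_zero _ b.coef_zero_ne')

theorem coe_powBasis (k : ℕ) (hk : k < n) :
    (b.powBasis k hk : Fin n → K) = fun i : Fin n => θ.powZeta k i := b.basisOfDet_apply _ _

/-- The rational basis `ζ₀, …, ζ_{n-1}`. -/
noncomputable def zetaBasis : Module.Basis (Fin n) ℚ K := b.powBasis 0 b.n_pos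

theorem zetaBasis_apply (i : Fin n) : b.zetaBasis i = θ.zeta i := by
  rw [zetaBasis, coe_powBasis]
  exact θ.powZeta_zero i

theorem det_zetaBasis : b.basis.det b.zetaBasis = (f.coef 0 : ℚ) ^ (n - 1) := by
  rw [zetaBasis, coe_powBasis, b.det_powZeta b.n_pos, Nat.sub_zero]

theorem det_zetaBasis_powBasis (k : ℕ) (hk : k < n) :
    b.zetaBasis.det (b.powBasis k hk) = ((f.coef 0 : ℚ) ^ k)⁻¹ := by
  have h := Basis_det_mul_det b.basis b.zetaBasis (b.powBasis k hk)
  rw [det_zetaBasis, coe_powBasis, b.det_powZeta hk] at h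
  rw [coe_powBasis]
  have h0 := b.coef_zero_ne'
  rw [← mul_eq_one_iff_eq_inv₀ (pow_ne_zero _ h0)]
  apply mul_left_cancel₀ (pow_ne_zero (n - 1 - k) h0)
  have e : (f.coef 0 : ℚ) ^ (n - 1) = (f.coef 0 : ℚ) ^ (n - 1 - k) * (f.coef 0 : ℚ) ^ k := by
    rw [← pow_add, Nat.sub_add_cancel (by omega)]
  rw [e] at h
  linear_combination h

variable [IsFractionRing θ.ring K]

theorem toLattice_one : toLattice (1 : FractionalIdeal θ.ring⁰ K) =
    AddSubgroup.closure (Set.range b.zetaBasis) := by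
  have e : (b.zetaBasis : Fin n → K) = fun i : Fin n => θ.powZeta 0 i := b.coe_powBasis 0 b.n_pos
  rw [← Submodule.span_int_eq_addSubgroupClosure, e]
  ext x
  rw [Submodule.mem_toAddSubgroup]
  exact (θ.mem_one_iff x).trans (by rw [ringModule_eq _ b.n_pos]; rfl)

/-- The norm of a fractional ideal is the absolute value of the determinant of a basis. -/
theorem latticeNorm_eq (I : FractionalIdeal θ.ring⁰ K) (v : Module.Basis (Fin n) ℚ K)
    (h : toLattice I = AddSubgroup.closure (Set.range v)) :
    latticeNorm I = |b.zetaBasis.det v| := by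
  rw [latticeNorm, b.toLattice_one, h, (latticeIndex_of_basis _ _).2]

-- For general k the norm is |f₀|^{-k}; an even exponent removes the absolute value. The case needed
-- is k = n-3.
include b in
theorem latticeNorm_ideal_pow {k : ℕ} (hk : k < n) (he : Even k) :
    latticeNorm (θ.ideal ^ k) = ((f.coef 0 : ℚ) ^ k)⁻¹ := by
  rw [b.latticeNorm_eq _ (b.powBasis k hk), det_zetaBasis_powBasis, abs_of_nonneg]
  · exact inv_nonneg.2 (he.pow_nonneg _)
  · rw [← Submodule.span_int_eq_addSubgroupClosure, coe_powBasis]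
    ext x
    rw [Submodule.mem_toAddSubgroup]
    exact θ.mem_ideal_pow_iff (by have := b.three_le; omega) hk x

include b in
theorem latticeNorm_spanSingleton (δ : Kˣ) :
    latticeNorm (FractionalIdeal.spanSingleton θ.ring⁰ (δ : K)) = |Algebra.norm ℚ (δ : K)| := by
  let v : Module.Basis (Fin n) ℚ K := b.zetaBasis.map
    ((LinearEquiv.smulOfNeZero K K (δ : K) δ.ne_zero).restrictScalars ℚ)
  have hv : ∀ i, v i = (δ : K) * b.zetaBasis i := fun i => rfl
  rw [b.latticeNorm_eq _ v, show (v : Fin n → K) = Algebra.lmul ℚ K (δ : K) ∘ b.zetaBasis from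
    funext hv, Module.Basis.det_comp, Module.Basis.det_self, mul_one, Algebra.norm_apply]
  · have h2 : AddSubgroup.closure (Set.range v) =
        (AddSubgroup.closure (Set.range b.zetaBasis)).map (AddMonoidHom.mulLeft (δ : K)) := by
      rw [AddMonoidHom.map_closure]
      congr 1
      exact Set.range_comp (AddMonoidHom.mulLeft (δ : K)) b.zetaBasis
    rw [h2, ← b.toLattice_one]
    ext x
    refine (FractionalIdeal.mem_spanSingleton θ.ring⁰).trans ?_
    constructor
    · rintro ⟨z, rfl⟩
      exact ⟨z, (θ.mem_one_iff _).2 z.2, by simp [mul_comm, Subalgebra.smul_def]⟩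
    · rintro ⟨z, hz, rfl⟩
      exact ⟨⟨z, (θ.mem_one_iff _).1 hz⟩, by simp [mul_comm, Subalgebra.smul_def]⟩

include b in
theorem latticeNorm_ne_zero (I : (FractionalIdeal θ.ring⁰ K)ˣ) :
    latticeNorm (I : FractionalIdeal θ.ring⁰ K) ≠ 0 := by
  intro h
  have h2 := latticeNorm_mul I I⁻¹
  rw [← Units.val_mul, mul_inv_cancel, Units.val_one, latticeNorm_one, h, zero_mul] at h2
  exact one_ne_zero h2

end Frame

end BinaryForm.Root

theorem latticeNorm_nonneg {O K : Type*} [CommRing O] [Field K] [Algebra O K]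
    (I : FractionalIdeal O⁰ K) : 0 ≤ latticeNorm I := by
  rw [latticeNorm, latticeIndex]; positivity

/-- An integral fractional ideal of norm one is trivial. -/
theorem eq_one_of_latticeNorm {O K : Type*} [CommRing O] [Field K] [Algebra O K]
    {I : FractionalIdeal O⁰ K} (hI : I ≤ 1) (h : latticeNorm I = 1) : I = 1 := by
  have hle : toLattice I ≤ toLattice (1 : FractionalIdeal O⁰ K) := hI
  rw [latticeNorm, latticeIndex, AddSubgroup.relIndex_eq_one.2 hle, Nat.cast_one, div_one,
    Nat.cast_eq_one, AddSubgroup.relIndex_eq_one] at h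
  exact le_antisymm hI h


/-! ### Gram determinants of the trace-like forms λ(zxy), and the norm form. -/

theorem sign_revPerm {n : ℕ} (hn : Odd n) :
    Equiv.Perm.sign (Fin.revPerm : Equiv.Perm (Fin n)) = (-1) ^ ((n - 1) / 2) := by
  obtain ⟨m, rfl⟩ := hn
  rw [Equiv.Perm.sign_eq_prod_prod_Iio]
  have h : ∀ j : Fin (2 * m + 1), ∏ i ∈ Finset.Iio j,
      (if (Fin.revPerm i : Fin (2 * m + 1)) < Fin.revPerm j then (1 : ℤˣ) else -1) = (-1) ^ (j : ℕ) := by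
    intro j
    rw [Finset.prod_congr rfl (g := fun _ => (-1 : ℤˣ)), Finset.prod_const, Fin.card_Iio]
    intro i hi
    rw [Finset.mem_Iio] at hi
    rw [if_neg]
    simpa using hi.le
  rw [Finset.prod_congr rfl fun j _ => h j, Fin.prod_univ_eq_prod_range (fun j => (-1 : ℤˣ) ^ j),
    Finset.prod_pow_eq_pow_sum, show (2 * m + 1 - 1) / 2 = m by omega]
  -- All n(n-1)/2 pairs are inverted, and for n = 2m+1 this number is m + 2m², of the parity of m.
  have hs := Finset.sum_range_id_mul_two (2 * m + 1)
  have : ∑ i ∈ Finset.range (2 * m + 1), i = m + 2 * (m * m) := by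
    rw [Nat.add_sub_cancel] at hs; nlinarith
  rw [this, pow_add, pow_mul]
  simp

namespace BinaryForm.Root

variable {n : ℕ} {f : BinaryForm n} {K : Type*} [Field K] [NumberField K] {θ : f.Root K}

namespace Frame

variable (b : θ.Frame)

/-- The bilinear form `(x, y) ↦ λ(z x y)`, where `λ` is the leading functional. -/
noncomputable def form (z : K) : K →ₗ[ℚ] K →ₗ[ℚ] ℚ :=
  (LinearMap.mul ℚ K).compr₂ (b.lead ∘ₗ LinearMap.mulLeft ℚ z)

theorem form_apply (z x y : K) : b.form z x y = b.lead (z * (x * y)) := rfl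

theorem form_mul (z x y w : K) : b.form (w * z) x y = b.form z (w * x) y := by
  rw [form_apply, form_apply]; congr 1; ring

theorem eq_zero_of_form {z x : K} (hz : z ≠ 0) (h : ∀ y, b.form z x y = 0) : x = 0 := by
  have : z * x = 0 := b.eq_zero_of_lead fun y => by rw [mul_assoc]; exact h y
  exact (mul_eq_zero.1 this).resolve_left hz

/-- The Hankel matrix λ(θ^{i+j}) vanishes for i+j < n-1 and equals 1/f₀ on the antidiagonal.
Reversing its columns makes it lower triangular, and the sign of the reversal is the ε of
`Corresponds`. -/
theorem det_form_basis : (Matrix.of fun i j : Fin n => b.form 1 (b.basis i) (b.basis j)).det =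
    (-1) ^ ((n - 1) / 2) * ((f.coef 0 : ℚ) ^ n)⁻¹ := by
  have h3 := b.three_le
  set H : Matrix (Fin n) (Fin n) ℚ := Matrix.of fun i j => b.form 1 (b.basis i) (b.basis j) with hH
  have hlow : (H.submatrix id (Fin.revPerm : Equiv.Perm (Fin n))).det = (f.coef 0 : ℚ)⁻¹ ^ n := by
    rw [Matrix.det_of_isLowerTriangular, Finset.prod_congr rfl (g := fun _ => (f.coef 0 : ℚ)⁻¹),
      Finset.prod_const, Finset.card_univ, Fintype.card_fin]
    · intro i _
      rw [Matrix.submatrix_apply, hH, Matrix.of_apply, form_apply, b.basis_apply, b.basis_apply,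
        one_mul, ← pow_add, b.lead_pow]
      simp only [id, Fin.revPerm_apply, Fin.val_rev]
      omega
    · intro i j hij
      have hij : (i : ℕ) < j := hij
      rw [Matrix.submatrix_apply, hH, Matrix.of_apply, form_apply, b.basis_apply, b.basis_apply,
        one_mul, ← pow_add, b.lead_pow_lt]
      simp only [id, Fin.revPerm_apply, Fin.val_rev]
      omega
  rw [Matrix.det_permute', sign_revPerm b.odd] at hlow
  push_cast at hlow
  rw [← inv_pow, ← hlow, ← mul_assoc, ← mul_pow]
  simp

/-- The Gram determinant of `(x, y) ↦ λ(z x y)`. -/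
theorem det_form (z : K) (v : Module.Basis (Fin n) ℚ K) :
    (Matrix.of fun i j : Fin n => b.form z (v i) (v j)).det =
      Algebra.norm ℚ z * b.zetaBasis.det v ^ 2 *
        ((-1) ^ ((n - 1) / 2) * (f.coef 0 : ℚ) ^ (n - 2)) := by
  have h3 := b.three_le
  set P := b.basis.toMatrix v with hP
  set N := Algebra.leftMulMatrix b.basis z with hN
  have hv : ∀ i, v i = ∑ k, P k i • b.basis k := fun i => by
    rw [hP]; simp only [Module.Basis.toMatrix_apply]; rw [b.basis.sum_repr]
  have hz : ∀ i, z * b.basis i = ∑ k, N k i • b.basis k := fun i => by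
    rw [← b.basis.sum_repr (z * b.basis i)]
    refine Finset.sum_congr rfl fun k _ => ?_
    rw [hN, Algebra.leftMulMatrix_eq_repr_mul]
  have key : (Matrix.of fun i j : Fin n => b.form z (v i) (v j)) =
      P.transpose * (N.transpose * (Matrix.of fun i j : Fin n => b.form 1 (b.basis i) (b.basis j)))
        * P := by
    have h2 : (Matrix.of fun i j : Fin n => b.form z (b.basis i) (b.basis j)) =
        N.transpose * (Matrix.of fun i j : Fin n => b.form 1 (b.basis i) (b.basis j)) := by
      ext i j
      rw [Matrix.of_apply, ← mul_one z, form_mul, hz, map_sum, LinearMap.sum_apply,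
        Matrix.mul_apply]
      refine Finset.sum_congr rfl fun k _ => ?_
      rw [map_smul, LinearMap.smul_apply, smul_eq_mul]
      rfl
    rw [← h2]
    ext i j
    rw [Matrix.of_apply, hv i, hv j, Matrix.mul_apply]
    simp only [map_sum, map_smul, LinearMap.sum_apply, LinearMap.smul_apply, smul_eq_mul,
      Matrix.mul_apply, Matrix.transpose_apply, Matrix.of_apply, Finset.sum_mul]
    refine Finset.sum_congr rfl fun k _ => ?_
    rw [Finset.mul_sum]
    refine Finset.sum_congr rfl fun l _ => ?_
    ring
  have hdet : P.det = (f.coef 0 : ℚ) ^ (n - 1) * b.zetaBasis.det v := by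
    rw [hP, ← Module.Basis.det_apply, ← Basis_det_mul_det b.basis b.zetaBasis v, det_zetaBasis]
  rw [key, Matrix.det_mul, Matrix.det_mul, Matrix.det_mul, Matrix.det_transpose,
    Matrix.det_transpose, b.det_form_basis, hdet, Algebra.norm_eq_matrix_det b.basis z, ← hN]
  have h0 := b.coef_zero_ne'
  -- The two factors det P contribute f₀^{2(n-1)} and the Hankel determinant f₀^{-n}, which leaves
  -- f₀^{n-2}.
  have e1 : (f.coef 0 : ℚ) ^ (n - 1) = (f.coef 0 : ℚ) ^ (n - 2) * f.coef 0 := by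
    rw [← pow_succ]; congr 1; omega
  have e2 : (f.coef 0 : ℚ) ^ n = (f.coef 0 : ℚ) ^ (n - 2) * f.coef 0 ^ 2 := by
    rw [← pow_add]; congr 1; omega
  rw [e1, e2]
  field_simp

/-- The power basis of `K` given by `θ`. -/
noncomputable def powerBasis : PowerBasis ℚ K where
  gen := θ.val
  dim := n
  basis := b.basis
  basis_eq_pow := b.basis_apply

-- For y ≠ 0 the norm of x - yθ is yⁿ times the minimal polynomial of θ at x/y, and f₀ times that
-- polynomial is f(x,1). The case y = 0 is N(x) = xⁿ.
include b in
theorem coef_mul_norm (x y : ℤ) :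
    (f.coef 0 : ℚ) * Algebra.norm ℚ ((x : K) - y * θ.val) =
      (MvPolynomial.eval ![x, y] f.poly : ℤ) := by
  rw [BinaryForm.eval_poly]
  rcases eq_or_ne y 0 with rfl | hy
  · rw [Finset.sum_eq_single 0]
    · have : ((x : ℤ) : K) - ((0 : ℤ) : K) * θ.val = algebraMap ℚ K x := by simp
      rw [this, Algebra.norm_algebraMap, b.finrank_eq]
      simp [BinaryForm.coef]
    · intro i _ hi
      have : (i : ℕ) ≠ 0 := fun h => hi (Fin.ext h)
      rw [zero_pow this, mul_zero]
    · simp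
  · have hy' : (y : ℚ) ≠ 0 := by exact_mod_cast hy
    have e : (x : K) - y * θ.val = algebraMap ℚ K y * (algebraMap ℚ K (x / y) - θ.val) := by
      have : (y : K) ≠ 0 := by exact_mod_cast hy
      rw [map_div₀]
      simp only [map_intCast]
      field_simp
    have hN : Algebra.norm ℚ (algebraMap ℚ K (x / y) - θ.val) =
        (minpoly ℚ θ.val).eval ((x : ℚ) / y) := by
      have := charpoly_leftMulMatrix b.powerBasis
      rw [show θ.val = b.powerBasis.gen from rfl, ← this, Matrix.eval_charpoly,
        Algebra.norm_eq_matrix_det b.powerBasis.basis, map_sub, AlgHom.commutes]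
      rfl
    rw [e, map_mul, hN, Algebra.norm_algebraMap, b.finrank_eq]
    have hm := congrArg (Polynomial.eval ((x : ℚ) / y)) b.minpoly_eq
    rw [Polynomial.eval_mul, Polynomial.eval_C] at hm
    rw [mul_left_comm, hm, BinaryForm.dehomogenize, Polynomial.eval_finsetSum, Finset.mul_sum]
    push_cast
    refine Finset.sum_congr rfl fun i _ => ?_
    simp only [Polynomial.eval_mul, Polynomial.eval_C, Polynomial.eval_pow, Polynomial.eval_X]
    have e3 : (y : ℚ) ^ n = y ^ (n - (i : ℕ)) * y ^ (i : ℕ) := by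
      rw [← pow_add]; congr 1; omega
    rw [e3, div_pow]
    field_simp

end Frame

end BinaryForm.Root


/-! ### The correspondence in terms of Gram matrices. -/

theorem toLattice_spanSingleton_mul {O K : Type*} [CommRing O] [Field K] [Algebra O K]
    [IsLocalization O⁰ K]
    (κ : K) (I : FractionalIdeal O⁰ K) :
    toLattice (FractionalIdeal.spanSingleton O⁰ κ * I) =
      (toLattice I).map (AddMonoidHom.mulLeft κ) := by
  ext x
  refine FractionalIdeal.mem_singleton_mul.trans ?_
  exact ⟨fun ⟨y, hy, h⟩ => ⟨y, hy, h.symm⟩, fun ⟨y, hy, h⟩ => ⟨y, hy, h.symm⟩⟩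

theorem toLattice_injective {O K : Type*} [CommRing O] [Field K] [Algebra O K]
    {I J : FractionalIdeal O⁰ K} (h : toLattice I = toLattice J) : I = J := by
  ext x
  exact (SetLike.ext_iff.1 h x)

namespace BinaryForm.Root

variable {n : ℕ} {f : BinaryForm n} {K : Type*} [Field K] [NumberField K] {θ : f.Root K}

/-- At level n-3 exactly two generators, ζ_{n-2} and ζ_{n-1}, are not powers of θ; this is the shape
of the expansion in `Corresponds`. -/
theorem exists_of_mem_powModule (hn : 3 ≤ n) {x : K} (hx : x ∈ θ.powModule (n - 3)) :
    ∃ (c : Fin (n - 2) → ℤ) (u v : ℤ), x = ∑ k, (c k : K) * θ.val ^ (k : ℕ) +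
      ((u : K) * θ.zeta (n - 2) + (v : K) * θ.zeta (n - 1)) := by
  refine Submodule.span_induction (p := fun x _ => ∃ (c : Fin (n - 2) → ℤ) (u v : ℤ),
    x = ∑ k, (c k : K) * θ.val ^ (k : ℕ) +
      ((u : K) * θ.zeta (n - 2) + (v : K) * θ.zeta (n - 1))) ?_ ?_ ?_ ?_ hx
  · rintro _ ⟨i, rfl⟩
    simp only [powZeta]
    split_ifs with h
    · refine ⟨Pi.single ⟨i, by omega⟩ 1, 0, 0, ?_⟩
      rw [Finset.sum_eq_single (⟨i, by omega⟩ : Fin (n - 2))]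
      · simp
      · intro j _ hj
        rw [Pi.single_eq_of_ne hj]; simp
      · simp
    · rcases (show (i : ℕ) = n - 2 ∨ (i : ℕ) = n - 1 by omega) with h | h
      · exact ⟨0, 1, 0, by simp [h]⟩
      · exact ⟨0, 0, 1, by simp [h]⟩
  · exact ⟨0, 0, 0, by simp⟩
  · rintro x y _ _ ⟨c, u, v, rfl⟩ ⟨c', u', v', rfl⟩
    refine ⟨c + c', u + u', v + v', ?_⟩
    simp only [Pi.add_apply, Int.cast_add, add_mul, Finset.sum_add_distrib]
    ring
  · rintro r x _ ⟨c, u, v, rfl⟩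
    refine ⟨r • c, r * u, r * v, ?_⟩
    simp only [Pi.smul_apply, smul_eq_mul, Int.cast_mul, zsmul_eq_mul, mul_add, Finset.mul_sum,
      mul_assoc]

variable [IsFractionRing θ.ring K]

/-- `(A, B)` consists of the Gram matrices, with respect to the oriented basis `α` of `I`, of the
forms `λ(x y / δ)` and `λ(θ x y / δ)` up to the sign `(-1)^((n-1)/2)`. -/
structure Frame.IsGram (b : θ.Frame) (v : f.FormPair) (I : FractionalIdeal θ.ring⁰ K) (δ : Kˣ)
    (α : Module.Basis (Fin n) ℚ K) : Prop where
  toLattice_eq : toLattice I = AddSubgroup.closure (Set.range α)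
  det_pos : 0 < b.zetaBasis.det α
  A_eq : ∀ i j, (v.A i j : ℚ) = (-1) ^ ((n - 1) / 2) * b.form (δ : K)⁻¹ (α i) (α j)
  B_eq : ∀ i j, (v.B i j : ℚ) = (-1) ^ ((n - 1) / 2) * b.form (θ.val * (δ : K)⁻¹) (α i) (α j)

namespace Frame

variable (b : θ.Frame)

/-- Applying λ and λ(θ·) to the expansion of α_iα_j/δ isolates a_ij and b_ij up to ε. In the other
direction, I² ⊆ δI_f^{n-3} supplies an expansion with integer coefficients, and the Gram identities
say that its last two are the prescribed ones. -/
theorem corresponds_iff (v : f.FormPair) (I : FractionalIdeal θ.ring⁰ K) (δ : Kˣ) :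
    θ.Corresponds v I δ ↔
      I ^ 2 ≤ FractionalIdeal.spanSingleton θ.ring⁰ (δ : K) * θ.ideal ^ (n - 3) ∧
      latticeNorm I ^ 2 = Algebra.norm ℚ (δ : K) * latticeNorm (θ.ideal ^ (n - 3)) ∧
      ∃ α, b.IsGram v I δ α := by
  have h3 := b.three_le
  have hsq : ((-1 : ℚ) ^ ((n - 1) / 2)) * (-1 : ℚ) ^ ((n - 1) / 2) = 1 := by
    rw [← mul_pow]; simp
  have hsqK : ((-1 : K) ^ ((n - 1) / 2)) * (-1 : K) ^ ((n - 1) / 2) = 1 := by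
    rw [← mul_pow]; simp
  refine and_congr_right fun hI => and_congr_right fun _ => ?_
  constructor
  · rintro ⟨α, M, -, hspan, hM, hdet, hc⟩
    have e : b.zetaBasis.det α = M.det := by
      rw [Module.Basis.det_apply, ← Matrix.det_transpose M]
      congr 1
      ext i j
      rw [Module.Basis.toMatrix_apply, hM j, Matrix.transpose_apply]
      simp_rw [← b.zetaBasis_apply]
      rw [Module.Basis.repr_sum_self]
    have hu : IsUnit (b.zetaBasis.det α) := by rw [e]; exact hdet.ne'.isUnit
    have hα := (Module.Basis.is_basis_iff_det b.zetaBasis).2 hu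
    have hcoe : (Module.Basis.mk hα.1 hα.2.ge : Fin n → K) = α := Module.Basis.coe_mk _ _
    have hsplit : ∀ i j, ∃ c : Fin (n - 2) → ℤ, (δ : K)⁻¹ * (α i * α j) =
        (∑ k, (c k : K) * θ.val ^ (k : ℕ) + (((-1) ^ ((n - 1) / 2) : ℤ) : K) *
          ((v.B i j : K) * θ.zeta (n - 2) + (v.A i j : K) * θ.zeta (n - 1))) := by
      intro i j
      obtain ⟨c, hc⟩ := hc i j
      refine ⟨c, ?_⟩
      rw [hc, inv_mul_cancel_left₀ δ.ne_zero]
      push_cast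
      rfl
    refine ⟨Module.Basis.mk hα.1 hα.2.ge, ?_, ?_, ?_, ?_⟩
    · rw [hcoe, ← Submodule.span_int_eq_addSubgroupClosure, hspan]; rfl
    · rwa [hcoe, e]
    · intro i j
      obtain ⟨c, hc⟩ := hsplit i j
      rw [hcoe, form_apply, hc, (b.lead_combination c _ _ _).1]
      push_cast
      rw [← mul_assoc, hsq, one_mul]
    · intro i j
      obtain ⟨c, hc⟩ := hsplit i j
      rw [hcoe, form_apply, mul_assoc, hc, (b.lead_combination c _ _ _).2]
      push_cast
      rw [← mul_assoc, hsq, one_mul]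
  · rintro ⟨α, hα⟩
    refine ⟨α, (b.zetaBasis.toMatrix α).transpose, ?_, ?_, ?_, ?_, ?_⟩
    · exact α.linearIndependent.restrict_scalars' ℤ
    · apply Submodule.toAddSubgroup_injective
      rw [Submodule.span_int_eq_addSubgroupClosure, ← hα.toLattice_eq]
      rfl
    · intro i
      simp only [Matrix.transpose_apply, Module.Basis.toMatrix_apply]
      simp_rw [← b.zetaBasis_apply]
      rw [Module.Basis.sum_repr]
    · rw [Matrix.det_transpose, ← Module.Basis.det_apply]
      exact hα.det_pos
    · intro i j
      have hmem : ∀ k, α k ∈ I := fun k => by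
        have : α k ∈ toLattice I := by
          rw [hα.toLattice_eq]; exact AddSubgroup.subset_closure (Set.mem_range_self k)
        exact this
      have h2 : α i * α j ∈ FractionalIdeal.spanSingleton θ.ring⁰ (δ : K) * θ.ideal ^ (n - 3) :=
        hI (by rw [pow_two]; exact FractionalIdeal.mul_mem_mul (hmem i) (hmem j))
      obtain ⟨y, hy, hxy⟩ := FractionalIdeal.mem_singleton_mul.1 h2
      obtain ⟨c, u, w, rfl⟩ :=
        exists_of_mem_powModule h3 ((θ.mem_ideal_pow_iff (by omega) (by omega) y).1 hy)
      have hl := b.lead_combination c u w 1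
      have hA := hα.A_eq i j
      have hB := hα.B_eq i j
      rw [form_apply, hxy, inv_mul_cancel_left₀ δ.ne_zero] at hA
      rw [form_apply, hxy, mul_assoc, inv_mul_cancel_left₀ δ.ne_zero] at hB
      simp only [Int.cast_one, one_mul] at hl
      rw [hl.1] at hA
      rw [hl.2] at hB
      have hA' : (v.A i j : K) = (-1) ^ ((n - 1) / 2) * w := by exact_mod_cast hA
      have hB' : (v.B i j : K) = (-1) ^ ((n - 1) / 2) * u := by exact_mod_cast hB
      refine ⟨c, ?_⟩
      rw [hxy, hA', hB']
      congr 2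
      linear_combination (-(u * θ.zeta (n - 2) + w * θ.zeta (n - 1))) * hsqK

variable {b}

theorem IsGram.toLattice_spanSingleton {v : f.FormPair} {I : FractionalIdeal θ.ring⁰ K} {δ : Kˣ}
    {α : Module.Basis (Fin n) ℚ K} (h : b.IsGram v I δ α) {β : Fin n → K} {κ : K}
    (hβ : ∀ i, β i = κ * α i) :
    toLattice (FractionalIdeal.spanSingleton θ.ring⁰ κ * I) =
      AddSubgroup.closure (Set.range β) := by
  rw [toLattice_spanSingleton_mul, h.toLattice_eq, AddMonoidHom.map_closure]
  congr 1
  rw [funext hβ]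
  exact (Set.range_comp (AddMonoidHom.mulLeft κ) α).symm

/-- A pair `(A, B)` determines `(I, δ)` up to equivalence. -/
theorem IsGram.unique {v : f.FormPair} {I I' : FractionalIdeal θ.ring⁰ K} {δ δ' : Kˣ}
    {α α' : Module.Basis (Fin n) ℚ K} (h : b.IsGram v I δ α) (h' : b.IsGram v I' δ' α') :
    ∃ κ : Kˣ, I' = FractionalIdeal.spanSingleton θ.ring⁰ (κ : K) * I ∧ δ' = κ ^ 2 * δ := by
  let g : K ≃ₗ[ℚ] K := α.equiv α' (Equiv.refl _)
  have hg : ∀ i, g (α i) = α' i := fun i => by simp [g]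
  have hs : ((-1 : ℚ) ^ ((n - 1) / 2)) ≠ 0 := pow_ne_zero _ (by norm_num)
  have hext : ∀ z z' : K, (∀ i j, b.form z (α i) (α j) = b.form z' (α' i) (α' j)) →
      ∀ x y, b.form z x y = b.form z' (g x) (g y) := by
    intro z z' hzz x y
    have : b.form z = (b.form z').compl₁₂ g.toLinearMap g.toLinearMap := by
      refine LinearMap.ext_basis α α fun i j => ?_
      rw [LinearMap.compl₁₂_apply, LinearEquiv.coe_coe, hg, hg, hzz]
    rw [this]; rfl
  have hA := hext (δ : K)⁻¹ (δ' : K)⁻¹ fun i j =>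
    mul_left_cancel₀ hs ((h.A_eq i j).symm.trans (h'.A_eq i j))
  have hB := hext (θ.val * (δ : K)⁻¹) (θ.val * (δ' : K)⁻¹) fun i j =>
    mul_left_cancel₀ hs ((h.B_eq i j).symm.trans (h'.B_eq i j))
  -- The second form is the first with θ inserted, and g preserves both; nondegeneracy then forces g
  -- to commute with θ. Hence g is K-linear, that is, multiplication by g(1).
  have hθ : ∀ x, g (θ.val * x) = θ.val * g x := by
    intro x
    rw [← sub_eq_zero]
    apply b.eq_zero_of_form (inv_ne_zero δ'.ne_zero)
    intro y
    obtain ⟨y, rfl⟩ := g.surjective y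
    rw [map_sub, LinearMap.sub_apply, ← hA, ← form_mul, ← form_mul, ← hB, sub_self]
  have hpow : ∀ k : ℕ, g (θ.val ^ k) = g 1 * θ.val ^ k := by
    intro k
    induction k with
    | zero => rw [pow_zero, mul_one]
    | succ k ih => rw [pow_succ', hθ, ih]; ring
  have hmul : ∀ x, g x = g 1 * x := by
    have : g.toLinearMap = LinearMap.mulLeft ℚ (g 1) := b.basis.ext fun i => by
      rw [b.basis_apply]; exact hpow i
    intro x
    exact LinearMap.congr_fun this x
  have hκ : g 1 ≠ 0 := fun h0 => one_ne_zero (g.injective (h0.trans (map_zero g).symm))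
  refine ⟨Units.mk0 (g 1) hκ, ?_, ?_⟩
  · apply toLattice_injective
    rw [Units.val_mk0, h.toLattice_spanSingleton fun i => ((hg i).symm.trans (hmul (α i))),
      h'.toLattice_eq]
  -- Invariance of the first form at (1, y) reads λ(y/δ) = λ(g(1)²y/δ') for all y.
  · have : (δ : K)⁻¹ - (δ' : K)⁻¹ * g 1 ^ 2 = 0 := by
      apply b.eq_zero_of_lead
      intro y
      have := hA 1 y
      rw [hmul y, form_apply, form_apply, one_mul] at this
      rw [sub_mul, map_sub, this, sub_eq_zero]
      congr 1
      ring
    apply Units.ext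
    rw [Units.val_mul, Units.val_pow_eq_pow_val, Units.val_mk0]
    have h1 := δ.ne_zero
    have h2 := δ'.ne_zero
    field_simp at this
    linear_combination this

end Frame

end BinaryForm.Root


/-! ### Changes of basis, scaling, and the construction of (A,B) from (I,δ). -/

namespace BinaryForm.Root

variable {n : ℕ} {f : BinaryForm n} {K : Type*} [Field K] [NumberField K] {θ : f.Root K}

theorem mem_closure_range_iff {ι : Type*} [Fintype ι] {E : Type*} [AddCommGroup E] (v : ι → E)
    (x : E) : x ∈ AddSubgroup.closure (Set.range v) ↔ ∃ c : ι → ℤ, ∑ i, c i • v i = x := by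
  rw [← Submodule.span_int_eq_addSubgroupClosure, Submodule.mem_toAddSubgroup,
    Submodule.mem_span_range_iff_exists_fun]

namespace Frame

variable (b : θ.Frame)

/-- Two rational bases of the same lattice with the same orientation differ by an element of
`SL_n(ℤ)`. -/
theorem exists_specialLinear (α α' : Module.Basis (Fin n) ℚ K)
    (h : AddSubgroup.closure (Set.range α) = AddSubgroup.closure (Set.range α'))
    (hα : 0 < b.zetaBasis.det α) (hα' : 0 < b.zetaBasis.det α') :
    ∃ g : Matrix.SpecialLinearGroup (Fin n) ℤ, ∀ i, α' i = ∑ j, g.1 i j • α j := by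
  have key : ∀ β β' : Module.Basis (Fin n) ℚ K,
      AddSubgroup.closure (Set.range β) = AddSubgroup.closure (Set.range β') →
      ∃ g : Matrix (Fin n) (Fin n) ℤ, ((g.det : ℤ) : ℚ) = β.det β' ∧
        ∀ i, β' i = ∑ j, g i j • β j := by
    intro β β' hβ
    have : ∀ i, ∃ c : Fin n → ℤ, ∑ j, c j • β j = β' i := fun i => by
      rw [← mem_closure_range_iff, hβ]
      exact AddSubgroup.subset_closure (Set.mem_range_self i)
    choose g hg using this
    refine ⟨Matrix.of g, ?_, fun i => (hg i).symm⟩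
    have e : β.toMatrix β' = ((Matrix.of g).map (Int.cast : ℤ → ℚ)).transpose := by
      ext i j
      rw [Module.Basis.toMatrix_apply, ← hg j]
      have : ∑ k, g j k • β k = ∑ k, (g j k : ℚ) • β k :=
        Finset.sum_congr rfl fun k _ => (Int.cast_smul_eq_zsmul ℚ _ _).symm
      rw [this, Module.Basis.repr_sum_self]
      rfl
    rw [Module.Basis.det_apply, e, Matrix.det_transpose]
    exact (Int.castRingHom ℚ).map_det (Matrix.of g)
  obtain ⟨g, hg, hgα⟩ := key α α' h
  obtain ⟨g', hg', -⟩ := key α' α h.symm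
  -- The two integral base changes are mutually inverse, so the determinant is ±1; equal
  -- orientations select +1.
  have h1 : g.det * g'.det = 1 := by
    have : ((g.det * g'.det : ℤ) : ℚ) = 1 := by
      rw [Int.cast_mul, hg, hg', Basis_det_mul_det, Module.Basis.det_self]
    exact_mod_cast this
  have h2 : 0 < g.det := by
    have : 0 < ((g.det : ℤ) : ℚ) := by
      rw [hg]
      have := Basis_det_mul_det b.zetaBasis α α'
      rw [← this] at hα'
      exact pos_of_mul_pos_right hα' hα.le
    exact_mod_cast this
  have h3 : g.det = 1 := by
    rcases Int.eq_one_or_neg_one_of_mul_eq_one h1 with h3 | h3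
    · exact h3
    · omega
  exact ⟨⟨g, h3⟩, hgα⟩

variable [IsFractionRing θ.ring K]

variable {b}

theorem form_sum_sum (z : K) (α : Module.Basis (Fin n) ℚ K) (c d : Fin n → ℤ) :
    b.form z (∑ k, c k • α k) (∑ l, d l • α l) =
      ∑ l, (∑ k, (c k : ℚ) * b.form z (α k) (α l)) * d l := by
  simp only [← Int.cast_smul_eq_zsmul ℚ, map_sum, map_smul, LinearMap.sum_apply,
    LinearMap.smul_apply, smul_eq_mul, Finset.sum_mul, Finset.mul_sum]
  exact Finset.sum_congr rfl fun k _ => Finset.sum_congr rfl fun l _ => by ring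

theorem gram_conj {ε : ℚ} {z : K} {α : Module.Basis (Fin n) ℚ K} {A : Matrix (Fin n) (Fin n) ℤ}
    (hA : ∀ i j, (A i j : ℚ) = ε * b.form z (α i) (α j)) (g : Matrix (Fin n) (Fin n) ℤ)
    (i j : Fin n) : (((g * A * g.transpose) i j : ℤ) : ℚ) =
      ε * b.form z (∑ k, g i k • α k) (∑ k, g j k • α k) := by
  rw [form_sum_sum, Matrix.mul_apply, Int.cast_sum, Finset.mul_sum]
  refine Finset.sum_congr rfl fun l _ => ?_
  rw [Int.cast_mul, Matrix.mul_apply, Int.cast_sum, ← mul_assoc, Finset.mul_sum,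
    Matrix.transpose_apply]
  congr 1
  refine Finset.sum_congr rfl fun k _ => ?_
  rw [Int.cast_mul, hA]
  ring

/-- Pairs `(A, B)` that correspond to the same `(I, δ)` lie in the same orbit. -/
theorem IsGram.orbit_eq {v v' : f.FormPair} {I : FractionalIdeal θ.ring⁰ K} {δ : Kˣ}
    {α α' : Module.Basis (Fin n) ℚ K} (h : b.IsGram v I δ α) (h' : b.IsGram v' I δ α') :
    v'.orbit = v.orbit := by
  obtain ⟨g, hg⟩ := b.exists_specialLinear α α' (h.toLattice_eq.symm.trans h'.toLattice_eq)
    h.det_pos h'.det_pos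
  refine Quotient.sound ⟨g, ?_⟩
  apply FormPair.ext
  · ext i j
    have := gram_conj h.A_eq g.1 i j
    rw [← hg, ← hg, ← h'.A_eq] at this
    exact_mod_cast this
  · ext i j
    have := gram_conj h.B_eq g.1 i j
    rw [← hg, ← hg, ← h'.B_eq] at this
    exact_mod_cast this

/-- The correspondence only depends on the orbit of `(A, B)`. -/
theorem IsGram.smul {v : f.FormPair} {I : FractionalIdeal θ.ring⁰ K} {δ : Kˣ}
    {α : Module.Basis (Fin n) ℚ K} (h : b.IsGram v I δ α)
    (g : Matrix.SpecialLinearGroup (Fin n) ℤ) : ∃ α', b.IsGram (g • v) I δ α' := by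
  let w : Fin n → K := fun i => ∑ j, g.1 i j • α j
  let w' : Fin n → K := fun i => ∑ j, (g⁻¹).1 i j • α j
  have hw : ∀ (g h : Matrix.SpecialLinearGroup (Fin n) ℤ) i,
      ∑ j, g.1 i j • ∑ k, h.1 j k • α k = ∑ k, (g * h).1 i k • α k := by
    intro g h i
    simp only [Finset.smul_sum, smul_smul]
    rw [Finset.sum_comm]
    refine Finset.sum_congr rfl fun k _ => ?_
    rw [← Finset.sum_smul]
    rfl
  have hdet : b.zetaBasis.det w = b.zetaBasis.det α := by
    have e : b.zetaBasis.toMatrix w =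
        b.zetaBasis.toMatrix α * (g.1.map (Int.cast : ℤ → ℚ)).transpose := by
      ext i j
      simp only [w, ← Int.cast_smul_eq_zsmul ℚ, Module.Basis.toMatrix_apply, Matrix.mul_apply,
        map_sum, map_smul, Finsupp.finsetSum_apply, Finsupp.smul_apply, smul_eq_mul,
        Matrix.transpose_apply, Matrix.map_apply]
      exact Finset.sum_congr rfl fun k _ => mul_comm _ _
    have hg : (g.1.map (Int.cast : ℤ → ℚ)).det = 1 := by
      have := (Int.castRingHom ℚ).map_det g.1
      rw [g.2] at this
      exact this.symm.trans (map_one _)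
    rw [Module.Basis.det_apply, e, Matrix.det_mul, Matrix.det_transpose, hg, mul_one,
      Module.Basis.det_apply]
  have hu : IsUnit (b.zetaBasis.det w) := by rw [hdet]; exact h.det_pos.ne'.isUnit
  have hα := (Module.Basis.is_basis_iff_det b.zetaBasis).2 hu
  have hcoe : (Module.Basis.mk hα.1 hα.2.ge : Fin n → K) = w := Module.Basis.coe_mk _ _
  refine ⟨Module.Basis.mk hα.1 hα.2.ge, ?_, ?_, ?_, ?_⟩
  · rw [hcoe, h.toLattice_eq]
    apply le_antisymm
    · rw [AddSubgroup.closure_le]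
      rintro _ ⟨i, rfl⟩
      refine (mem_closure_range_iff _ _).2 ⟨(g⁻¹).1 i, ?_⟩
      rw [hw, inv_mul_cancel]
      rw [Finset.sum_eq_single i]
      · simp
      · intro j _ hj
        simp [Matrix.one_apply_ne hj.symm]
      · simp
    · rw [AddSubgroup.closure_le]
      rintro _ ⟨i, rfl⟩
      exact (mem_closure_range_iff _ _).2 ⟨g.1 i, rfl⟩
  · rw [hcoe, hdet]; exact h.det_pos
  · intro i j; rw [hcoe]; exact gram_conj h.A_eq g.1 i j
  · intro i j; rw [hcoe]; exact gram_conj h.B_eq g.1 i j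

/-- Replacing `(I, δ)` by `(κ I, κ² δ)` preserves the correspondence. -/
theorem IsGram.scale {v : f.FormPair} {I : FractionalIdeal θ.ring⁰ K} {δ : Kˣ}
    {α : Module.Basis (Fin n) ℚ K} (h : b.IsGram v I δ α) (κ : Kˣ) :
    ∃ α', b.IsGram v (FractionalIdeal.spanSingleton θ.ring⁰ (κ : K) * I) (κ ^ 2 * δ) α' := by
  -- The orientation of κα differs from that of α by the sign of N(κ). As n is odd, N(-κ) = -N(κ),
  -- while -κ gives the same ideal κI and the same κ²δ.
  wlog hκ : 0 < Algebra.norm ℚ (κ : K) generalizing κ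
  · have hN : Algebra.norm ℚ (-(κ : K)) = - Algebra.norm ℚ (κ : K) := by
      have e : -(κ : K) = algebraMap ℚ K (-1) * κ := by simp
      rw [e, map_mul, Algebra.norm_algebraMap, b.finrank_eq, b.odd.neg_one_pow, neg_one_mul]
    have h0 : Algebra.norm ℚ (κ : K) ≠ 0 := Algebra.norm_ne_zero_iff.2 κ.ne_zero
    have h1 := this (-κ) (by
      rw [Units.val_neg, hN, neg_pos]
      exact lt_of_le_of_ne (not_lt.1 hκ) h0)
    have e : FractionalIdeal.spanSingleton θ.ring⁰ (-(κ : K)) =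
        FractionalIdeal.spanSingleton θ.ring⁰ (κ : K) := by
      ext x
      rw [FractionalIdeal.mem_spanSingleton, FractionalIdeal.mem_spanSingleton]
      exact ⟨fun ⟨z, hz⟩ => ⟨-z, by rw [← hz]; simp⟩, fun ⟨z, hz⟩ => ⟨-z, by rw [← hz]; simp⟩⟩
    rwa [Units.val_neg, e, neg_sq] at h1
  let α' : Module.Basis (Fin n) ℚ K := α.map
    ((LinearEquiv.smulOfNeZero K K (κ : K) κ.ne_zero).restrictScalars ℚ)
  have hv : ∀ i, α' i = (κ : K) * α i := fun i => rfl
  have hform : ∀ z x y, b.form (z * ((κ ^ 2 * δ : Kˣ) : K)⁻¹) (κ * x) (κ * y) =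
      b.form (z * (δ : K)⁻¹) x y := by
    intro z x y
    rw [form_apply, form_apply]
    congr 1
    have := κ.ne_zero
    have := δ.ne_zero
    push_cast
    field_simp
  refine ⟨α', h.toLattice_spanSingleton hv, ?_, ?_, ?_⟩
  · have e : (α' : Fin n → K) = Algebra.lmul ℚ K (κ : K) ∘ α := funext hv
    rw [e, Module.Basis.det_comp]
    exact mul_pos hκ h.det_pos
  · intro i j
    have := hform 1 (α i) (α j)
    rw [one_mul, one_mul] at this
    rw [hv, hv, this, h.A_eq]
  · intro i j
    rw [hv, hv, hform, h.B_eq]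

variable (b)

/-- An invertible fractional ideal has a positively oriented `ℤ`-basis. -/
theorem exists_oriented_basis (I : (FractionalIdeal θ.ring⁰ K)ˣ) :
    ∃ α : Module.Basis (Fin n) ℚ K,
      toLattice (I : FractionalIdeal θ.ring⁰ K) = AddSubgroup.closure (Set.range α) ∧
        0 < b.zetaBasis.det α := by
  let L : Submodule θ.ring K := ((I : FractionalIdeal θ.ring⁰ K) : Submodule θ.ring K)
  have : Module.Finite θ.ring L := Module.Finite.iff_fg.2 (FractionalIdeal.fg_unit I)
  have : Module.Finite ℤ L := Module.Finite.trans θ.ring L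
  have hfree : Module.Free ℤ L := inferInstance
  let c := Module.Free.chooseBasis ℤ L
  let w := fun i => (c i : K)
  have hli : LinearIndependent ℤ w :=
    c.linearIndependent.map' (L.subtype.restrictScalars ℤ)
      (LinearMap.ker_eq_bot.2 Subtype.val_injective)
  have hli' : LinearIndependent ℚ w := (LinearIndependent.iff_fractionRing ℤ ℚ).1 hli
  have hclos : toLattice (I : FractionalIdeal θ.ring⁰ K) = AddSubgroup.closure (Set.range w) := by
    ext x
    rw [mem_closure_range_iff]
    constructor
    · intro hx
      refine ⟨fun i => c.repr ⟨x, hx⟩ i, ?_⟩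
      have := congrArg (L.subtype.restrictScalars ℤ) (c.sum_repr ⟨x, hx⟩)
      rw [map_sum] at this
      refine Eq.trans (Finset.sum_congr rfl fun i _ => ?_) this
      rw [map_smul]
      rfl
    · rintro ⟨d, rfl⟩
      exact sum_mem fun i _ => zsmul_mem (c i).2 _
  have hmem : ∀ x ∈ (I : FractionalIdeal θ.ring⁰ K), x ∈ Submodule.span ℚ (Set.range w) := by
    intro x hx
    have hx : x ∈ toLattice (I : FractionalIdeal θ.ring⁰ K) := hx
    rw [hclos, mem_closure_range_iff] at hx
    obtain ⟨d, rfl⟩ := hx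
    exact sum_mem fun i _ => zsmul_mem (Submodule.subset_span (Set.mem_range_self i)) _
  -- For a nonzero a in I the elements aζ_i lie in I and span K over ℚ.
  have hspan : ⊤ ≤ Submodule.span ℚ (Set.range w) := by
    obtain ⟨a, ha, ha0⟩ : ∃ a ∈ (I : FractionalIdeal θ.ring⁰ K), a ≠ 0 := by
      by_contra! hcon
      exact I.ne_zero (FractionalIdeal.eq_zero_iff.2 hcon)
    intro x _
    have e : x = ∑ i, b.zetaBasis.repr (x / a) i • (b.zetaBasis i * a) := by
      simp_rw [← smul_mul_assoc]
      rw [← Finset.sum_mul, Module.Basis.sum_repr, div_mul_cancel₀ _ ha0]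
    rw [e]
    refine sum_mem fun i _ => Submodule.smul_mem _ _ (hmem _ ?_)
    rw [zetaBasis_apply]
    exact L.smul_mem (⟨θ.zeta i, θ.zeta_mem_ringModule i⟩ : θ.ring) ha
  let β := Module.Basis.mk hli' hspan
  have hcard : Fintype.card (Module.Free.ChooseBasisIndex ℤ L) = n := by
    rw [← Module.finrank_eq_card_basis β, b.finrank_eq]
  let α := β.reindex (Fintype.equivFinOfCardEq hcard)
  have hα : Set.range α = Set.range w := by
    rw [Module.Basis.range_reindex, Module.Basis.coe_mk]
  have h0 : b.zetaBasis.det α ≠ 0 := (Module.Basis.isUnit_det _ _).ne_zero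
  -- Negating every basis vector multiplies the determinant by (-1)ⁿ = -1.
  rcases h0.lt_or_gt with h0 | h0
  · let α' : Module.Basis (Fin n) ℚ K := α.map (LinearEquiv.neg ℚ)
    have hv : ∀ i, α' i = - α i := fun i => rfl
    refine ⟨α', ?_, ?_⟩
    · have : Set.range α' = - Set.range w := by
        rw [← hα]
        ext x
        simp only [Set.mem_range, Set.mem_neg, hv, neg_eq_iff_eq_neg]
      rw [this, AddSubgroup.closure_neg, hclos]
    · have e : (α' : Fin n → K) = ((-1 : ℚ) • LinearMap.id : K →ₗ[ℚ] K) ∘ α :=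
        funext fun i => by rw [hv]; simp
      rw [e, Module.Basis.det_comp, LinearMap.det_smul, b.finrank_eq, b.odd.neg_one_pow]
      simpa using h0
  · exact ⟨α, by rw [hα, hclos], h0⟩

include b in
/-- Every invertible solution of `I² = δ I_f^{n-3}`, `N(I)² = N(δ) N(I_f^{n-3})` comes from a
pair `(A, B)`. -/
theorem exists_formPair (I : (FractionalIdeal θ.ring⁰ K)ˣ) (δ : Kˣ)
    (h1 : (I : FractionalIdeal θ.ring⁰ K) ^ 2 ≤
      FractionalIdeal.spanSingleton θ.ring⁰ (δ : K) * θ.ideal ^ (n - 3))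
    (h2 : latticeNorm (I : FractionalIdeal θ.ring⁰ K) ^ 2 =
      Algebra.norm ℚ (δ : K) * latticeNorm (θ.ideal ^ (n - 3))) :
    ∃ v : f.FormPair, θ.Corresponds v I δ := by
  have h3 := b.three_le
  have h0 := b.coef_zero_ne'
  obtain ⟨α, hα, hpos⟩ := b.exists_oriented_basis I
  set ε : ℤ := (-1) ^ ((n - 1) / 2) with hε
  have hεQ : (ε : ℚ) = (-1) ^ ((n - 1) / 2) := by rw [hε]; push_cast; rfl
  have hsq : (ε : ℚ) * ε = 1 := by rw [hεQ, ← mul_pow]; simp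
  -- The quotients α_iα_j/δ lie in I_f^{n-3}, on which λ and λ(θ·) take integer values.
  have hint : ∀ i j, ∃ a c : ℤ, (a : ℚ) = ε * b.form (δ : K)⁻¹ (α i) (α j) ∧
      (c : ℚ) = ε * b.form (θ.val * (δ : K)⁻¹) (α i) (α j) := by
    intro i j
    have hmem : ∀ k, α k ∈ (I : FractionalIdeal θ.ring⁰ K) := fun k => by
      have : α k ∈ toLattice (I : FractionalIdeal θ.ring⁰ K) := by
        rw [hα]; exact AddSubgroup.subset_closure (Set.mem_range_self k)
      exact this
    have hm : α i * α j ∈ FractionalIdeal.spanSingleton θ.ring⁰ (δ : K) * θ.ideal ^ (n - 3) :=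
      h1 (by rw [pow_two]; exact FractionalIdeal.mul_mem_mul (hmem i) (hmem j))
    obtain ⟨y, hy, hxy⟩ := FractionalIdeal.mem_singleton_mul.1 hm
    obtain ⟨c, u, w, rfl⟩ :=
      exists_of_mem_powModule h3 ((θ.mem_ideal_pow_iff (by omega) (by omega) y).1 hy)
    have hl := b.lead_combination c u w 1
    simp only [Int.cast_one, one_mul] at hl
    refine ⟨ε * w, ε * u, ?_, ?_⟩
    · rw [form_apply, hxy, inv_mul_cancel_left₀ δ.ne_zero, hl.1]; push_cast; rfl
    · rw [form_apply, hxy, mul_assoc, inv_mul_cancel_left₀ δ.ne_zero, hl.2]; push_cast; rfl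
  choose A B hA hB using hint
  have hsymm : ∀ z x y, b.form z x y = b.form z y x := fun z x y => by
    rw [form_apply, form_apply, mul_comm x]
  have hdetv : b.zetaBasis.det α ^ 2 = Algebra.norm ℚ (δ : K) * ((f.coef 0 : ℚ) ^ (n - 3))⁻¹ := by
    rw [← b.latticeNorm_ideal_pow (by omega) (by obtain ⟨m, hm⟩ := b.odd; exact ⟨m - 1, by omega⟩),
      ← h2, b.latticeNorm_eq _ α hα, sq_abs]
  let v : f.FormPair :=
    { A := Matrix.of A
      B := Matrix.of B
      symmA := by
        ext i j
        have : ((A j i : ℤ) : ℚ) = A i j := by rw [hA, hA, hsymm]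
        exact_mod_cast this
      symmB := by
        ext i j
        have : ((B j i : ℤ) : ℚ) = B i j := by rw [hB, hB, hsymm]
        exact_mod_cast this
      invariant_eq := by
        apply MvPolynomial.funext
        intro x
        obtain ⟨x, y, rfl⟩ : ∃ s t, x = ![s, t] := ⟨x 0, x 1, by ext i; fin_cases i <;> rfl⟩
        have e1 : MvPolynomial.eval ![x, y] (pairInvariant (Matrix.of A) (Matrix.of B)) =
            (x • Matrix.of A - y • Matrix.of B).det := by
          rw [pairInvariant, RingHom.map_det]
          congr 1
          ext i j
          simp
        have e2 : ((x • Matrix.of A - y • Matrix.of B).map (Int.cast : ℤ → ℚ)) =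
            (ε : ℚ) • Matrix.of fun i j : Fin n =>
              b.form (((x : K) - y * θ.val) * (δ : K)⁻¹) (α i) (α j) := by
          ext i j
          simp only [Matrix.map_apply, Matrix.sub_apply, Matrix.smul_apply, Matrix.of_apply,
            smul_eq_mul, Int.cast_sub, Int.cast_mul, hA, hB, form_apply]
          have : ((x : K) - y * θ.val) * (δ : K)⁻¹ * (α i * α j) =
              (x : K) * ((δ : K)⁻¹ * (α i * α j)) -
                (y : K) * (θ.val * (δ : K)⁻¹ * (α i * α j)) := by ring
          rw [this, map_sub, lead_int_mul, lead_int_mul]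
          ring
        have e3 : (((x • Matrix.of A - y • Matrix.of B).det : ℤ) : ℚ) =
            ((x • Matrix.of A - y • Matrix.of B).map (Int.cast : ℤ → ℚ)).det :=
          (Int.castRingHom ℚ).map_det _
        rw [e1]
        -- The scalar ε contributes εⁿ = ε, which cancels the sign of the Gram determinant. By
        -- `hdetv` the norm of δ cancels too, and f₀^{n-2}·f₀^{-(n-3)} leaves f₀N(x-yθ) = f(x,y).
        have : (((x • Matrix.of A - y • Matrix.of B).det : ℤ) : ℚ) =
            (MvPolynomial.eval ![x, y] f.poly : ℤ) := by
          rw [e3, e2, Matrix.det_smul, b.det_form, hdetv, ← b.coef_mul_norm, map_mul,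
            Algebra.norm_inv, Fintype.card_fin, ← hεQ]
          have hN : Algebra.norm ℚ (δ : K) ≠ 0 := Algebra.norm_ne_zero_iff.2 δ.ne_zero
          have hεn : (ε : ℚ) ^ n = ε := by
            obtain ⟨m, hm⟩ := b.odd
            rw [hm, pow_succ, pow_mul, pow_two, hsq, one_pow, one_mul]
          have e4 : (f.coef 0 : ℚ) ^ (n - 2) = (f.coef 0 : ℚ) ^ (n - 3) * f.coef 0 := by
            rw [← pow_succ]; congr 1; omega
          rw [hεn, e4]
          field_simp
          linear_combination (Algebra.norm ℚ ((x : K) - y * θ.val)) * hsq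
        exact_mod_cast this }
  refine ⟨v, (b.corresponds_iff v I δ).2 ⟨h1, h2, α, hα, hpos, ?_, ?_⟩⟩
  · intro i j; rw [← hεQ]; exact hA i j
  · intro i j; rw [← hεQ]; exact hB i j

end Frame

end BinaryForm.Root


/-! ### Projective orbits and H(O). -/

namespace BinaryForm.Root

variable {n : ℕ} {f : BinaryForm n} {K : Type*} [Field K] [NumberField K] {θ : f.Root K}
  [IsFractionRing θ.ring K]

namespace Frame

variable (b : θ.Frame)

include b

theorem orbit_eq_of_corresponds {v v' : f.FormPair} {I : FractionalIdeal θ.ring⁰ K} {δ : Kˣ}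
    (h : θ.Corresponds v I δ) (h' : θ.Corresponds v' I δ) : v.orbit = v'.orbit := by
  obtain ⟨-, -, α, hα⟩ := (b.corresponds_iff _ _ _).1 h
  obtain ⟨-, -, α', hα'⟩ := (b.corresponds_iff _ _ _).1 h'
  exact hα'.orbit_eq hα

theorem corresponds_of_orbit_eq {v v' : f.FormPair} {I : FractionalIdeal θ.ring⁰ K} {δ : Kˣ}
    (h : θ.Corresponds v I δ) (hv : v.orbit = v'.orbit) : θ.Corresponds v' I δ := by
  obtain ⟨h1, h2, α, hα⟩ := (b.corresponds_iff _ _ _).1 h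
  obtain ⟨g, rfl⟩ := Quotient.exact hv.symm
  exact (b.corresponds_iff _ _ _).2 ⟨h1, h2, hα.smul g⟩

theorem corresponds_scale {v : f.FormPair} {I : (FractionalIdeal θ.ring⁰ K)ˣ} {δ : Kˣ}
    (h : θ.Corresponds v I δ) (κ : Kˣ) :
    θ.Corresponds v (FractionalIdeal.spanSingleton θ.ring⁰ (κ : K) * I) (κ ^ 2 * δ) := by
  obtain ⟨h1, h2, α, hα⟩ := (b.corresponds_iff _ _ _).1 h
  refine (b.corresponds_iff _ _ _).2 ⟨?_, ?_, hα.scale κ⟩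
  · rw [mul_pow, FractionalIdeal.spanSingleton_pow, Units.val_mul, Units.val_pow_eq_pow_val,
      ← FractionalIdeal.spanSingleton_mul_spanSingleton, mul_assoc]
    exact mul_le_mul_right h1 _
  · rw [← coe_toPrincipalIdeal, latticeNorm_mul, mul_pow, h2, coe_toPrincipalIdeal,
      b.latticeNorm_spanSingleton, sq_abs, Units.val_mul, Units.val_pow_eq_pow_val, map_mul,
      map_pow, mul_assoc]

theorem corresponds_unique {v : f.FormPair} {I I' : FractionalIdeal θ.ring⁰ K} {δ δ' : Kˣ}
    (h : θ.Corresponds v I δ) (h' : θ.Corresponds v I' δ') :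
    ∃ κ : Kˣ, I' = FractionalIdeal.spanSingleton θ.ring⁰ (κ : K) * I ∧ δ' = κ ^ 2 * δ := by
  obtain ⟨-, -, α, hα⟩ := (b.corresponds_iff _ _ _).1 h
  obtain ⟨-, -, α', hα'⟩ := (b.corresponds_iff _ _ _).1 h'
  exact hα.unique hα'

theorem two_mul_half : 2 * ((n - 3) / 2) = n - 3 := by
  obtain ⟨m, hm⟩ := b.odd; omega

variable (U : (FractionalIdeal θ.ring⁰ K)ˣ) (hU : (U : FractionalIdeal θ.ring⁰ K) = θ.ideal)

include hU

/-- Twisting by I_f^{(n-3)/2} turns I² = (δ) into I² = δI_f^{n-3} and multiplies the norm condition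
accordingly; the exponent is integral because n is odd. -/
theorem exists_corresponds (p : projectivePairs θ.ring K) :
    ∃ v : f.FormPair, θ.Corresponds v (p.1.1 * θ.ideal ^ ((n - 3) / 2)) p.1.2 := by
  obtain ⟨⟨I, δ⟩, h1, h2⟩ := p
  have e : (((I * U ^ ((n - 3) / 2) : (FractionalIdeal θ.ring⁰ K)ˣ)) : FractionalIdeal θ.ring⁰ K) =
      I * θ.ideal ^ ((n - 3) / 2) := by
    rw [Units.val_mul, Units.val_pow_eq_pow_val, hU]
  have := b.exists_formPair (I * U ^ ((n - 3) / 2)) δ ?_ ?_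
  · rw [e] at this
    exact this
  · rw [e, mul_pow, ← pow_mul', b.two_mul_half, show (I : FractionalIdeal θ.ring⁰ K) ^ 2 = _ from h1]
  · rw [Units.val_mul, latticeNorm_mul, mul_pow,
      show latticeNorm (I : FractionalIdeal θ.ring⁰ K) ^ 2 = _ from h2, sq,
      ← latticeNorm_mul, ← Units.val_mul, ← sq, ← pow_mul', b.two_mul_half,
      Units.val_pow_eq_pow_val, hU]

theorem mk_eq_of_corresponds {p q : projectivePairs θ.ring K} {v : f.FormPair}
    (hp : θ.Corresponds v (p.1.1 * θ.ideal ^ ((n - 3) / 2)) p.1.2)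
    (hq : θ.Corresponds v (q.1.1 * θ.ideal ^ ((n - 3) / 2)) q.1.2) :
    (QuotientGroup.mk p : HGroup θ.ring K) = QuotientGroup.mk q := by
  obtain ⟨κ, h1, h2⟩ := b.corresponds_unique hp hq
  rw [QuotientGroup.eq, Subgroup.mem_subgroupOf]
  refine ⟨κ, ?_⟩
  have e : q.1.1 = toPrincipalIdeal θ.ring K κ * p.1.1 := by
    apply mul_right_cancel (b := U ^ ((n - 3) / 2))
    apply Units.ext
    simp only [Units.val_mul, Units.val_pow_eq_pow_val, hU, coe_toPrincipalIdeal]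
    rw [h1, mul_assoc]
  apply Prod.ext
  · change toPrincipalIdeal θ.ring K κ = p.1.1⁻¹ * q.1.1
    rw [e, mul_comm, mul_inv_cancel_right]
  · change κ ^ 2 = p.1.2⁻¹ * q.1.2
    rw [h2, mul_comm, mul_inv_cancel_right]

theorem corresponds_of_mk_eq {p q : projectivePairs θ.ring K} {v : f.FormPair}
    (hp : θ.Corresponds v (p.1.1 * θ.ideal ^ ((n - 3) / 2)) p.1.2)
    (h : (QuotientGroup.mk p : HGroup θ.ring K) = QuotientGroup.mk q) :
    θ.Corresponds v (q.1.1 * θ.ideal ^ ((n - 3) / 2)) q.1.2 := by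
  rw [QuotientGroup.eq, Subgroup.mem_subgroupOf] at h
  obtain ⟨κ, hκ⟩ := h
  have h1 : toPrincipalIdeal θ.ring K κ = p.1.1⁻¹ * q.1.1 := congrArg Prod.fst hκ
  have h2 : κ ^ 2 = p.1.2⁻¹ * q.1.2 := congrArg Prod.snd hκ
  have e1 : q.1.1 = toPrincipalIdeal θ.ring K κ * p.1.1 := by
    rw [h1, mul_comm, mul_inv_cancel_left]
  have e2 : q.1.2 = κ ^ 2 * p.1.2 := by
    rw [h2, mul_comm, mul_inv_cancel_left]
  have := b.corresponds_scale (I := p.1.1 * U ^ ((n - 3) / 2)) (v := v) (δ := p.1.2)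
    (by rwa [Units.val_mul, Units.val_pow_eq_pow_val, hU]) κ
  rw [e1, e2, Units.val_mul, coe_toPrincipalIdeal, mul_assoc]
  rwa [Units.val_mul, Units.val_pow_eq_pow_val, hU] at this

/-- The invertible ideal I²(δI_f^{n-3})⁻¹ is integral of norm one, hence trivial. So I is a
projective pair's ideal times I_f^{(n-3)/2}, which is the surjectivity in `exists_equiv`. -/
theorem exists_projectivePair {v : f.FormPair} (h : θ.IsProjective v) :
    ∃ p : projectivePairs θ.ring K,
      θ.Corresponds v (p.1.1 * θ.ideal ^ ((n - 3) / 2)) p.1.2 := by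
  obtain ⟨_, δ, hv, I, rfl⟩ := h
  have hd : 2 * ((n - 3) / 2) = n - 3 := b.two_mul_half
  have hv' := hv
  obtain ⟨h1, h2, -⟩ := hv'
  let D := toPrincipalIdeal θ.ring K δ * U ^ (n - 3)
  have hD : (D : FractionalIdeal θ.ring⁰ K) =
      FractionalIdeal.spanSingleton θ.ring⁰ (δ : K) * θ.ideal ^ (n - 3) := by
    rw [Units.val_mul, coe_toPrincipalIdeal, Units.val_pow_eq_pow_val, hU]
  have hunit : I ^ 2 = D := by
    rw [← mul_inv_eq_one]
    apply Units.ext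
    apply eq_one_of_latticeNorm
    · rw [← hD] at h1
      rw [Units.val_mul, Units.val_pow_eq_pow_val]
      calc _ ≤ (D : FractionalIdeal θ.ring⁰ K) * (D⁻¹ : (FractionalIdeal θ.ring⁰ K)ˣ) :=
            mul_le_mul_left h1 _
        _ = 1 := by rw [← Units.val_mul, mul_inv_cancel, Units.val_one]
    · have hND : latticeNorm (D : FractionalIdeal θ.ring⁰ K) =
          latticeNorm ((I ^ 2 : (FractionalIdeal θ.ring⁰ K)ˣ) : FractionalIdeal θ.ring⁰ K) := by
        -- The ideal (δ) has norm |N(δ)|; the absolute value disappears because N(δ)N(I_f^{n-3}) is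
        -- the square N(I)².
        have h3 : (0 : ℚ) ≤ Algebra.norm ℚ (δ : K) := by
          have h4 := latticeNorm_nonneg (θ.ideal ^ (n - 3))
          have h5 : latticeNorm (θ.ideal ^ (n - 3)) ≠ 0 := by
            have := b.latticeNorm_ne_zero (U ^ (n - 3))
            rwa [Units.val_pow_eq_pow_val, hU] at this
          exact nonneg_of_mul_nonneg_left (h2 ▸ sq_nonneg _) (lt_of_le_of_ne h4 h5.symm)
        rw [Units.val_mul, latticeNorm_mul, coe_toPrincipalIdeal, b.latticeNorm_spanSingleton,
          abs_of_nonneg h3, Units.val_pow_eq_pow_val, hU, ← h2, sq, ← latticeNorm_mul,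
          ← Units.val_mul, ← sq]
      have h6 := latticeNorm_mul D D⁻¹
      rw [← Units.val_mul, mul_inv_cancel, Units.val_one, latticeNorm_one] at h6
      rw [Units.val_mul, latticeNorm_mul, ← hND, ← h6]
  let J := I * (U ^ ((n - 3) / 2))⁻¹
  have hJ : (J : FractionalIdeal θ.ring⁰ K) * θ.ideal ^ ((n - 3) / 2) = I := by
    rw [← hU, ← Units.val_pow_eq_pow_val, ← Units.val_mul, inv_mul_cancel_right]
  have hJ2 : J ^ 2 = toPrincipalIdeal θ.ring K δ := by
    rw [mul_pow, hunit, inv_pow, ← pow_mul', hd, mul_inv_cancel_right]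
  have hp : ((J, δ) : (FractionalIdeal θ.ring⁰ K)ˣ × Kˣ) ∈ projectivePairs θ.ring K := by
    constructor
    · change (J : FractionalIdeal θ.ring⁰ K) ^ 2 = _
      rw [← Units.val_pow_eq_pow_val, hJ2, coe_toPrincipalIdeal]
    · change latticeNorm (J : FractionalIdeal θ.ring⁰ K) ^ 2 = Algebra.norm ℚ (δ : K)
      have h7 : latticeNorm (θ.ideal ^ (n - 3)) =
          latticeNorm (θ.ideal ^ ((n - 3) / 2)) ^ 2 := by
        rw [← hU, ← Units.val_pow_eq_pow_val, ← Units.val_pow_eq_pow_val, sq, ← latticeNorm_mul,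
          ← Units.val_mul, ← sq, ← pow_mul', hd]
      have h8 : latticeNorm (θ.ideal ^ ((n - 3) / 2)) ≠ 0 := by
        have := b.latticeNorm_ne_zero (U ^ ((n - 3) / 2))
        rwa [Units.val_pow_eq_pow_val, hU] at this
      have h9 : latticeNorm (I : FractionalIdeal θ.ring⁰ K) =
          latticeNorm (J : FractionalIdeal θ.ring⁰ K) * latticeNorm (θ.ideal ^ ((n - 3) / 2)) := by
        rw [← hJ, ← hU, ← Units.val_pow_eq_pow_val, latticeNorm_mul]
      rw [h7, h9, mul_pow] at h2
      exact mul_right_cancel₀ (pow_ne_zero 2 h8) h2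
  refine ⟨⟨(J, δ), hp⟩, ?_⟩
  change θ.Corresponds v (J * θ.ideal ^ ((n - 3) / 2)) δ
  rw [hJ]
  exact hv

/-- The bijection between `H(O)` and the projective orbits. -/
theorem exists_equiv : ∃ Φ : HGroup θ.ring K ≃ θ.ProjectiveOrbit,
    ∀ (p : projectivePairs θ.ring K) (v : f.FormPair),
      (Φ (QuotientGroup.mk p)).1 = v.orbit ↔
        θ.Corresponds v (p.1.1 * θ.ideal ^ ((n - 3) / 2)) p.1.2 := by
  choose V hV using b.exists_corresponds U hU
  let F : HGroup θ.ring K → θ.ProjectiveOrbit := fun h =>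
    ⟨(V h.out).orbit, V h.out, rfl, _, _, hV h.out,
      ⟨h.out.1.1 * U ^ ((n - 3) / 2), by rw [Units.val_mul, Units.val_pow_eq_pow_val, hU]⟩⟩
  have hF : ∀ (p : projectivePairs θ.ring K) (v : f.FormPair),
      (F (QuotientGroup.mk p)).1 = v.orbit ↔
        θ.Corresponds v (p.1.1 * θ.ideal ^ ((n - 3) / 2)) p.1.2 := by
    intro p v
    have h1 := b.corresponds_of_mk_eq U hU (hV (QuotientGroup.mk p : HGroup θ.ring K).out)
      (QuotientGroup.out_eq' _)
    exact ⟨fun h => b.corresponds_of_orbit_eq h1 h, fun h => b.orbit_eq_of_corresponds h1 h⟩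
  have hbij : Function.Bijective F := by
    constructor
    · intro x y hxy
      obtain ⟨p, rfl⟩ := QuotientGroup.mk_surjective x
      obtain ⟨q, rfl⟩ := QuotientGroup.mk_surjective y
      refine b.mk_eq_of_corresponds U hU (v := V p) (hV p) ((hF q _).1 ?_)
      rw [← hxy]
      exact (hF p _).2 (hV p)
    · rintro ⟨o, v, rfl, hv⟩
      obtain ⟨p, hp⟩ := b.exists_projectivePair U hU hv
      exact ⟨QuotientGroup.mk p, Subtype.ext ((hF p v).2 hp)⟩
  exact ⟨Equiv.ofBijective F hbij, hF⟩

end Frame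

end BinaryForm.Root


/-! ### Finiteness of the class group of an order, not assumed maximal. -/

/-- The ideal class group of an order is finite. -/
theorem finite_classGroup (O : Type*) [CommRing O] [IsDomain O] [Module.Finite ℤ O] [CharZero O] :
    Finite (ClassGroup O) := by
  classical
  have : IsAddTorsionFree O := inferInstance
  have : Module.Free ℤ O := inferInstance
  let bS := Module.Free.chooseBasis ℤ O
  let adm := AbsoluteValue.absIsAdmissible
  set M : O := algebraMap ℤ O (∏ m ∈ ClassGroup.finsetApprox bS adm, m) with hMdef
  have hM : M ≠ 0 := ClassGroup.prod_finsetApprox_ne_zero bS adm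
  let K := FractionRing O
  -- Each class has an integral representative containing the fixed element M, namely (M/b)A with b
  -- a nonzero element of A of minimal norm. It contains M because b ∈ A. Only finitely many ideals
  -- contain M, since O/(M) is finite.
  have key : ∀ x : ClassGroup O, ∃ J : {J : Ideal O // Ideal.span {M} ≤ J},
      ∃ U : (FractionalIdeal O⁰ K)ˣ, (U : FractionalIdeal O⁰ K) = (J.1 : FractionalIdeal O⁰ K) ∧
        ClassGroup.mk K U = x := by
    intro x
    refine ClassGroup.induction (K := K) (fun I => ?_) x
    obtain ⟨d, A, hd, hI⟩ := FractionalIdeal.exists_eq_spanSingleton_mul (I : FractionalIdeal O⁰ K)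
    have hA : A ≠ 0 := by
      rintro rfl
      have := I.ne_zero
      rw [hI] at this
      simp at this
    obtain ⟨b, hbA, hb, hmin⟩ := ClassGroup.exists_min (R := ℤ) AbsoluteValue.abs
      ⟨A, mem_nonZeroDivisors_iff_ne_zero.2 hA⟩
    have hdvd : ∀ a ∈ A, b ∣ M * a := by
      intro a ha
      obtain ⟨q, r, hr, lt⟩ := ClassGroup.exists_mem_finset_approx' bS adm a hb
      -- The element ra - qb of A has smaller norm than b, so it vanishes; as r divides M, it
      -- follows that b divides Ma.
      have h0 := hmin _ (A.sub_mem (A.smul_of_tower_mem r ha) (A.mul_mem_left q hbA)) lt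
      have h1 : (r : O) * a = q * b := by
        rw [← zsmul_eq_mul]; exact sub_eq_zero.1 h0
      have h2 : (r : O) ∣ M := by
        have := map_dvd (algebraMap ℤ O) (Finset.dvd_prod_of_mem (fun m => m) hr)
        simpa [hMdef] using this
      exact (Dvd.intro_left q h1.symm).trans (mul_dvd_mul_right h2 a)
    have hne : ∀ z : O, z ≠ 0 → algebraMap O K z ≠ 0 := fun z hz => by simpa using hz
    let κ : Kˣ := Units.mk0 (algebraMap O K M * algebraMap O K d / algebraMap O K b)
      (div_ne_zero (mul_ne_zero (hne _ hM) (hne _ hd)) (hne _ hb))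
    let U := toPrincipalIdeal O K κ * I
    have hU : (U : FractionalIdeal O⁰ K) =
        FractionalIdeal.spanSingleton O⁰ (algebraMap O K M / algebraMap O K b) * A := by
      rw [Units.val_mul, coe_toPrincipalIdeal, hI, ← mul_assoc,
        FractionalIdeal.spanSingleton_mul_spanSingleton]
      congr 2
      simp only [κ, Units.val_mk0]
      rw [div_mul_eq_mul_div, mul_inv_cancel_right₀ (hne _ hd)]
    have hle : (U : FractionalIdeal O⁰ K) ≤ 1 := by
      rw [hU, FractionalIdeal.spanSingleton_mul_le_iff]
      intro z hz
      obtain ⟨a, ha, rfl⟩ := (FractionalIdeal.mem_coeIdeal _).1 hz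
      obtain ⟨c, hc⟩ := hdvd a ha
      refine (FractionalIdeal.mem_one_iff _).2 ⟨c, ?_⟩
      rw [div_mul_eq_mul_div, ← map_mul, hc, map_mul, mul_div_cancel_left₀ _ (hne _ hb)]
    obtain ⟨J, hJ⟩ := FractionalIdeal.le_one_iff_exists_coeIdeal.1 hle
    refine ⟨⟨J, ?_⟩, U, hJ.symm, ?_⟩
    · rw [Ideal.span_singleton_le_iff_mem]
      have : algebraMap O K M ∈ (J : FractionalIdeal O⁰ K) := by
        rw [hJ, hU]
        exact FractionalIdeal.mem_singleton_mul.2 ⟨algebraMap O K b,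
          FractionalIdeal.mem_coeIdeal_of_mem _ hbA, (div_mul_cancel₀ _ (hne _ hb)).symm⟩
      obtain ⟨y, hy, hyM⟩ := (FractionalIdeal.mem_coeIdeal _).1 this
      rwa [← IsFractionRing.injective O K hyM]
    · rw [map_mul, (ClassGroup.mk_eq_one_iff (K := K)).2, one_mul]
      rw [coe_toPrincipalIdeal]
      exact ⟨(κ : K), by rw [FractionalIdeal.coe_spanSingleton]⟩
  have : Finite (O ⧸ Ideal.span {M}) := Ideal.finiteQuotientOfFreeOfNeBot _ (by simpa using hM)
  have : Finite (Ideal (O ⧸ Ideal.span {M})) := inferInstance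
  have : Finite {J : Ideal O // Ideal.span {M} ≤ J} := by
    refine Finite.of_injective (fun J => J.1.map (Ideal.Quotient.mk (Ideal.span {M}))) ?_
    intro J J' h
    apply Subtype.ext
    have h := congrArg (Ideal.comap (Ideal.Quotient.mk (Ideal.span {M}))) h
    simp only at h
    rwa [Ideal.comap_map_mk J.2, Ideal.comap_map_mk J'.2] at h
  choose J U h1 h2 using key
  refine Finite.of_injective J fun x y hxy => ?_
  rw [← h2 x, ← h2 y]
  congr 1
  apply Units.ext
  rw [h1, h1, hxy]

/-! ### Units of norm one in an order. -/

section Units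

variable (O K : Type*) [CommRing O] [IsDomain O] [Module.Finite ℤ O] [CharZero O]
  [Field K] [NumberField K] [Algebra O K] [IsFractionRing O K]

open NumberField

/-- The units of the order `O` of norm one. -/
noncomputable def normOneUnits : Subgroup Oˣ :=
  ((((Algebra.norm ℚ : K →* ℚ)).comp (algebraMap O K : O →* K)).comp (Units.coeHom O)).ker

variable {O K} in
theorem mem_normOneUnits {u : Oˣ} :
    u ∈ normOneUnits O K ↔ Algebra.norm ℚ (algebraMap O K u) = 1 := Iff.rfl

/-- The inclusion of an order in the maximal order. -/
noncomputable def toRingOfIntegers : O →ₐ[ℤ] 𝓞 K := IsIntegralClosure.lift ℤ (𝓞 K) K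

theorem toRingOfIntegers_apply (x : O) :
    algebraMap (𝓞 K) K (toRingOfIntegers O K x) = algebraMap O K x :=
  IsIntegralClosure.algebraMap_lift _ _ _ _

theorem toRingOfIntegers_injective : Function.Injective (toRingOfIntegers O K) := by
  intro x y h
  apply IsFractionRing.injective O K
  rw [← toRingOfIntegers_apply O K x, h, toRingOfIntegers_apply]

/-- The maximal order multiplied by a suitable positive integer is contained in `O`. -/
theorem exists_conductor : ∃ m : ℤ, m ≠ 0 ∧ ∀ y : 𝓞 K, ∃ x : O, toRingOfIntegers O K x = m * y := by
  have h1 : ∀ y : 𝓞 K, ∃ m : ℤ, m ≠ 0 ∧ ∃ x : O, toRingOfIntegers O K x = m * y := by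
    intro y
    obtain ⟨a, c, hc, hac⟩ := IsFractionRing.div_surjective (A := O) (algebraMap (𝓞 K) K y)
    have hc0 : c ≠ 0 := nonZeroDivisors.ne_zero hc
    obtain ⟨x, m, hm, hx⟩ := Algebra.IsAlgebraic.exists_smul_eq_mul ℤ a hc0
    refine ⟨m, hm, x, ?_⟩
    apply RingOfIntegers.coe_injective
    have hc' : algebraMap O K c ≠ 0 := by simpa using hc0
    have e := congrArg (algebraMap O K) hx
    rw [zsmul_eq_mul, map_mul, map_mul, map_intCast] at e
    rw [toRingOfIntegers_apply, map_mul, map_intCast, ← hac, ← mul_div_assoc, e,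
      mul_div_cancel_left₀ _ hc']
  let c := RingOfIntegers.basis K
  choose m hm x hx using fun i => h1 (c i)
  refine ⟨∏ i, m i, Finset.prod_ne_zero_iff.2 fun i _ => hm i, fun y => ?_⟩
  have h2 : ∀ i, ∃ x : O, toRingOfIntegers O K x = ((∏ i, m i : ℤ) : 𝓞 K) * c i := by
    intro i
    obtain ⟨d, hd⟩ := Finset.dvd_prod_of_mem m (Finset.mem_univ i)
    refine ⟨d * x i, ?_⟩
    rw [map_mul, hx, hd]
    push_cast
    rw [map_intCast]
    ring
  choose z hz using h2
  refine ⟨∑ i, c.repr y i • z i, ?_⟩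
  conv_rhs => rw [← c.sum_repr y]
  rw [map_sum, Finset.mul_sum]
  refine Finset.sum_congr rfl fun i _ => ?_
  rw [map_zsmul, hz, mul_smul_comm]

/-- Some positive power of every unit of the maximal order lies in `O`. -/
theorem exists_pow_unit (u : (𝓞 K)ˣ) :
    ∃ k : ℕ, 0 < k ∧ ∃ w : Oˣ, Units.map (toRingOfIntegers O K : O →* 𝓞 K) w = u ^ k := by
  obtain ⟨m, hm, h⟩ := exists_conductor O K
  let I : Ideal (𝓞 K) := Ideal.span {(m : 𝓞 K)}
  have hI : I ≠ ⊥ := by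
    rw [Ne, Ideal.span_singleton_eq_bot]
    exact_mod_cast hm
  have : Finite (𝓞 K ⧸ I) := Ideal.finiteQuotientOfFreeOfNeBot I hI
  have hfin : Finite (𝓞 K ⧸ I)ˣ := inferInstance
  -- With N the order of the unit group modulo m, u^N - 1 lies in m𝓞_K and hence in the image of O.
  -- The same N serves for u⁻¹, so u^N is a unit of O.
  have hpow : ∀ u : (𝓞 K)ˣ, ∃ x : O,
      toRingOfIntegers O K x = ((u ^ Nat.card (𝓞 K ⧸ I)ˣ : (𝓞 K)ˣ) : 𝓞 K) := by
    intro u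
    have h1 : Units.map (Ideal.Quotient.mk I : 𝓞 K →* 𝓞 K ⧸ I) u ^ Nat.card (𝓞 K ⧸ I)ˣ = 1 :=
      pow_card_eq_one'
    rw [← map_pow] at h1
    have h2 : Ideal.Quotient.mk I ((u ^ Nat.card (𝓞 K ⧸ I)ˣ : (𝓞 K)ˣ) : 𝓞 K) =
        Ideal.Quotient.mk I 1 := by
      rw [map_one]; exact congrArg Units.val h1
    rw [Ideal.Quotient.eq, Ideal.mem_span_singleton] at h2
    obtain ⟨y, hy⟩ := h2
    obtain ⟨x, hx⟩ := h y
    exact ⟨x + 1, by rw [map_add, map_one, hx, ← hy, sub_add_cancel]⟩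
  obtain ⟨x, hx⟩ := hpow u
  obtain ⟨y, hy⟩ := hpow u⁻¹
  have hxy : x * y = 1 := by
    apply toRingOfIntegers_injective O K
    rw [map_mul, hx, hy, ← Units.val_mul, ← mul_pow, mul_inv_cancel, one_pow, Units.val_one,
      map_one]
  exact ⟨_, Nat.card_pos, ⟨x, y, hxy, by rwa [mul_comm]⟩, Units.ext hx⟩

variable {O K} in
theorem norm_unit (u : Oˣ) : Algebra.norm ℚ (algebraMap O K u) = 1 ∨
    Algebra.norm ℚ (algebraMap O K u) = -1 := by
  have h := NumberField.isUnit_iff_norm.1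
    (Units.map (toRingOfIntegers O K : O →* 𝓞 K) u).isUnit
  have e : Algebra.norm ℚ (algebraMap O K u) =
      RingOfIntegers.norm ℚ (toRingOfIntegers O K u) := by
    rw [← toRingOfIntegers_apply, RingOfIntegers.coe_norm]
  rw [e]
  exact eq_or_eq_neg_of_abs_eq h

/-- The units of norm one in the unit group of the maximal order. -/
noncomputable def normOneUnitsMap : normOneUnits O K →* (𝓞 K)ˣ :=
  (Units.map (toRingOfIntegers O K : O →* 𝓞 K)).comp (normOneUnits O K).subtype

theorem normOneUnitsMap_injective : Function.Injective (normOneUnitsMap O K) := by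
  intro x y h
  apply Subtype.ext
  apply Units.ext
  exact toRingOfIntegers_injective O K (congrArg Units.val h)

theorem norm_neg_of_odd (hodd : Odd (Module.finrank ℚ K)) (x : K) :
    Algebra.norm ℚ (-x) = - Algebra.norm ℚ x := by
  have e : -x = algebraMap ℚ K (-1) * x := by simp
  rw [e, map_mul, Algebra.norm_algebraMap, hodd.neg_one_pow, neg_one_mul]

/-- In odd degree the only roots of unity are ±1, and N(-1) = -1 excludes -1. -/
theorem isMulTorsionFree_normOneUnits (hodd : Odd (Module.finrank ℚ K)) :
    IsMulTorsionFree (normOneUnits O K) := by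
  have key : ∀ (k : ℕ), k ≠ 0 → ∀ u : normOneUnits O K, u ^ k = 1 → u = 1 := by
    intro k hk u h
    have h1 : normOneUnitsMap O K u ∈ Units.torsion K :=
      isOfFinOrder_iff_pow_eq_one.2 ⟨k, Nat.pos_of_ne_zero hk, by rw [← map_pow, h, map_one]⟩
    apply normOneUnitsMap_injective O K
    rw [map_one]
    refine (Units.torsion_eq_one_or_neg_one_of_odd_finrank hodd ⟨_, h1⟩).resolve_right fun h2 => ?_
    have h3 : toRingOfIntegers O K u.1 = -1 := congrArg Units.val h2
    have hu := u.2
    rw [mem_normOneUnits, ← toRingOfIntegers_apply, h3, map_neg, norm_neg_of_odd K hodd,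
      map_one, map_one] at hu
    norm_num at hu
  refine ⟨fun k hk x y hxy => ?_⟩
  rw [← div_eq_one]
  apply key k hk
  rw [div_pow, div_eq_one]
  exact hxy

/-- The number of units of norm one modulo squares. -/
theorem index_sq_normOneUnits (hodd : Odd (Module.finrank ℚ K)) :
    (powMonoidHom 2 : normOneUnits O K →* normOneUnits O K).range.index = 2 ^ Units.rank K := by
  let L : Additive (normOneUnits O K) →ₗ[ℤ] Additive (𝓞 K)ˣ :=
    (MonoidHom.toAdditive (normOneUnitsMap O K)).toIntLinearMap
  have hL : Function.Injective L := normOneUnitsMap_injective O K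
  have hfin : Module.Finite ℤ (Additive (normOneUnits O K)) := Module.Finite.of_injective L hL
  have htf := isMulTorsionFree_normOneUnits O K hodd
  have hfree : Module.Free ℤ (Additive (normOneUnits O K)) := inferInstance
  let e := LinearEquiv.ofInjective L hL
  have hrank : Module.finrank ℤ (Additive (normOneUnits O K)) = Units.rank K := by
    rw [e.finrank_eq, ← Units.finrank_eq K,
      ← Submodule.finrank_quotient_add_finrank (LinearMap.range L),
      (Module.finrank_eq_zero_iff (R := ℤ) (M := Additive (𝓞 K)ˣ ⧸ LinearMap.range L)).2, zero_add]
    intro x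
    obtain ⟨x, rfl⟩ := Submodule.mkQ_surjective _ x
    obtain ⟨u, rfl⟩ := Additive.ofMul.surjective x
    obtain ⟨k, hk, w, hw⟩ := exists_pow_unit O K u
    -- The power u^k comes from O and has norm ±1; one more squaring makes the norm 1. So the
    -- quotient is torsion and the ranks agree.
    refine ⟨(k * 2 : ℕ), by exact_mod_cast (by omega), ?_⟩
    rw [← map_smul, Submodule.mkQ_apply, Submodule.Quotient.mk_eq_zero]
    have hw2 : w ^ 2 ∈ normOneUnits O K := by
      rw [mem_normOneUnits, Units.val_pow_eq_pow_val, map_pow, map_pow]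
      rcases norm_unit (K := K) w with h | h <;> rw [h] <;> norm_num
    refine ⟨Additive.ofMul ⟨w ^ 2, hw2⟩, ?_⟩
    change Additive.ofMul (Units.map (toRingOfIntegers O K : O →* 𝓞 K) (w ^ 2)) = _
    rw [map_pow, hw, ← pow_mul, ofMul_pow, natCast_zsmul]
  have := AddSubgroup.index_range_nsmul (Additive (normOneUnits O K)) 2
  rw [hrank] at this
  rw [← this, ← Subgroup.index_toAddSubgroup]
  rfl

end Units


/-! ### The order of H(O). -/

section Count

variable (O K : Type*) [CommRing O] [IsDomain O] [Module.Finite ℤ O] [CharZero O]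
  [Field K] [NumberField K] [Algebra O K] [IsFractionRing O K]

theorem mk_eq_one_iff_mem_range (I : (FractionalIdeal O⁰ K)ˣ) :
    ClassGroup.mk K I = 1 ↔ I ∈ (toPrincipalIdeal O K).range := by
  rw [← (ClassGroup.equiv K).injective.eq_iff]
  simp only [ClassGroup.equiv_mk, FractionalIdeal.canonicalEquiv_self, RingEquiv.coe_mulEquiv_refl,
    QuotientGroup.mk'_apply, map_one, QuotientGroup.eq_one_iff]
  rfl

/-- The class of the ideal `I` of a pair `(I, δ)`. -/
noncomputable def pairClass : projectivePairs O K →* ClassGroup O :=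
  (ClassGroup.mk K).comp ((MonoidHom.fst _ _).comp (projectivePairs O K).subtype)

theorem pairClass_apply (p : projectivePairs O K) : pairClass O K p = ClassGroup.mk K p.1.1 := rfl

/-- The pair `((1), u)` attached to a unit `u` of norm one. -/
noncomputable def unitPair : normOneUnits O K →* projectivePairs O K where
  toFun u := ⟨(1, Units.map (algebraMap O K : O →* K) u), by
    constructor
    · change (1 : FractionalIdeal O⁰ K) ^ 2 = FractionalIdeal.spanSingleton O⁰ (algebraMap O K u.1)
      rw [one_pow, ← FractionalIdeal.coeIdeal_span_singleton, Ideal.span_singleton_eq_top.2 u.1.isUnit,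
        FractionalIdeal.coeIdeal_top]
    · change latticeNorm (1 : FractionalIdeal O⁰ K) ^ 2 = Algebra.norm ℚ (algebraMap O K u.1)
      rw [latticeNorm_one, one_pow]
      exact (mem_normOneUnits.1 u.2).symm⟩
  map_one' := by
    apply Subtype.ext
    apply Prod.ext
    · rfl
    · exact map_one _
  map_mul' u v := by
    apply Subtype.ext
    apply Prod.ext
    · exact (one_mul _).symm
    · exact map_mul _ _ _

/-- `(κ)` is the unit ideal if and only if `κ` is a unit of `O`. -/
theorem toPrincipalIdeal_eq_one_iff (κ : Kˣ) : toPrincipalIdeal O K κ = 1 ↔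
    ∃ u : Oˣ, Units.map (algebraMap O K : O →* K) u = κ := by
  have key : ∀ κ : Kˣ, toPrincipalIdeal O K κ = 1 → ∃ x : O, algebraMap O K x = κ := by
    intro κ h
    have h1 := congrArg Units.val h
    rw [coe_toPrincipalIdeal, Units.val_one] at h1
    have h2 : (κ : K) ∈ (1 : FractionalIdeal O⁰ K) := by
      rw [← h1]; exact FractionalIdeal.mem_spanSingleton_self _ _
    exact (FractionalIdeal.mem_one_iff _).1 h2
  constructor
  · intro h
    obtain ⟨x, hx⟩ := key κ h
    obtain ⟨y, hy⟩ := key κ⁻¹ (by rw [map_inv, h, inv_one])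
    have hxy : x * y = 1 := by
      apply IsFractionRing.injective O K
      rw [map_mul, hx, hy, map_one, Units.mul_inv]
    exact ⟨⟨x, y, hxy, by rwa [mul_comm]⟩, Units.ext hx⟩
  · rintro ⟨u, rfl⟩
    apply Units.ext
    rw [coe_toPrincipalIdeal]
    change FractionalIdeal.spanSingleton O⁰ (algebraMap O K u) = 1
    rw [← FractionalIdeal.coeIdeal_span_singleton, Ideal.span_singleton_eq_top.2 u.isUnit,
        FractionalIdeal.coeIdeal_top]

theorem toPrincipalIdeal_neg (κ : Kˣ) : toPrincipalIdeal O K (-κ) = toPrincipalIdeal O K κ := by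
  have h : toPrincipalIdeal O K (-1) = 1 :=
    (toPrincipalIdeal_eq_one_iff O K _).2 ⟨-1, by ext; simp⟩
  rw [← neg_one_mul, map_mul, h, one_mul]

/-- A pair ((1),u) is trivial exactly when u = κ² with κ a unit of the order. Odd degree allows κ to
be replaced by -κ, so that its norm is 1. -/
theorem comap_unitPair (hodd : Odd (Module.finrank ℚ K)) :
    ((trivialPairs O K).subgroupOf (projectivePairs O K)).comap (unitPair O K) =
      (powMonoidHom 2 : normOneUnits O K →* normOneUnits O K).range := by
  ext u
  rw [Subgroup.mem_comap, Subgroup.mem_subgroupOf]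
  constructor
  · rintro ⟨κ, hκ⟩
    have h1 : toPrincipalIdeal O K κ = 1 := congrArg Prod.fst hκ
    have h2 : κ ^ 2 = Units.map (algebraMap O K : O →* K) u.1 := congrArg Prod.snd hκ
    obtain ⟨w, rfl⟩ := (toPrincipalIdeal_eq_one_iff O K κ).1 h1
    have hw : w ^ 2 = u.1 := by
      apply Units.map_injective (f := (algebraMap O K : O →* K)) (IsFractionRing.injective O K)
      rw [map_pow, h2]
    rcases norm_unit (K := K) w with h3 | h3
    · exact ⟨⟨w, h3⟩, Subtype.ext hw⟩
    · refine ⟨⟨-w, ?_⟩, Subtype.ext ?_⟩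
      · rw [mem_normOneUnits, Units.val_neg, map_neg, norm_neg_of_odd K hodd, h3, neg_neg]
      · change (-w) ^ 2 = u.1
        rw [neg_sq, hw]
  · rintro ⟨w, rfl⟩
    refine ⟨Units.map (algebraMap O K : O →* K) w.1, Prod.ext ?_ ?_⟩
    · exact (toPrincipalIdeal_eq_one_iff O K _).2 ⟨w.1, rfl⟩
    · exact (map_pow (Units.map (algebraMap O K : O →* K)) w.1 2).symm

theorem trivialPairs_le_ker :
    (trivialPairs O K).subgroupOf (projectivePairs O K) ≤ (pairClass O K).ker := by
  intro p hp
  obtain ⟨κ, hκ⟩ := Subgroup.mem_subgroupOf.1 hp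
  rw [MonoidHom.mem_ker, pairClass_apply, mk_eq_one_iff_mem_range]
  exact ⟨κ, congrArg Prod.fst hκ⟩

/-- If I = (κ) then u = δ/κ² is a unit, of norm N(I)²/N(κ)² = 1, and (I,δ) = ((κ),κ²)·((1),u). -/
theorem ker_pairClass (hN : ∀ δ : Kˣ, latticeNorm (FractionalIdeal.spanSingleton O⁰ (δ : K)) =
      |Algebra.norm ℚ (δ : K)|) : (pairClass O K).ker =
    (trivialPairs O K).subgroupOf (projectivePairs O K) ⊔ (unitPair O K).range := by
  apply le_antisymm
  · intro p hp
    rw [MonoidHom.mem_ker, pairClass_apply, mk_eq_one_iff_mem_range] at hp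
    obtain ⟨κ, hκ⟩ := hp
    have h1 : (p.1.1 : FractionalIdeal O⁰ K) ^ 2 = FractionalIdeal.spanSingleton O⁰ (p.1.2 : K) :=
      p.2.1
    have h2 : latticeNorm (p.1.1 : FractionalIdeal O⁰ K) ^ 2 = Algebra.norm ℚ (p.1.2 : K) := p.2.2
    have e1 : toPrincipalIdeal O K (p.1.2 * (κ ^ 2)⁻¹) = 1 := by
      rw [map_mul, map_inv, mul_inv_eq_one, map_pow, hκ]
      apply Units.ext
      rw [Units.val_pow_eq_pow_val, coe_toPrincipalIdeal, h1]
    obtain ⟨u, hu⟩ := (toPrincipalIdeal_eq_one_iff O K _).1 e1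
    have hu1 : u ∈ normOneUnits O K := by
      have e2 : algebraMap O K u = (p.1.2 : K) * ((κ : K) ^ 2)⁻¹ := by
        have := congrArg Units.val hu
        rwa [Units.val_mul, Units.val_inv_eq_inv_val, Units.val_pow_eq_pow_val] at this
      have h0 : Algebra.norm ℚ (κ : K) ≠ 0 := Algebra.norm_ne_zero_iff.2 κ.ne_zero
      rw [mem_normOneUnits, e2, map_mul, ← h2, ← hκ, coe_toPrincipalIdeal, hN, sq_abs,
        Algebra.norm_inv, map_pow, mul_inv_cancel₀ (pow_ne_zero 2 h0)]
    have e3 : p = p * (unitPair O K ⟨u, hu1⟩)⁻¹ * unitPair O K ⟨u, hu1⟩ := by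
      rw [inv_mul_cancel_right]
    rw [e3]
    refine Subgroup.mul_mem_sup (Subgroup.mem_subgroupOf.2 ⟨κ, Prod.ext ?_ ?_⟩) ⟨_, rfl⟩
    · change toPrincipalIdeal O K κ = p.1.1 * (1 : (FractionalIdeal O⁰ K)ˣ)⁻¹
      rw [inv_one, mul_one, hκ]
    · change κ ^ 2 = p.1.2 * (Units.map (algebraMap O K : O →* K) u)⁻¹
      rw [hu, mul_inv, inv_inv, mul_inv_cancel_left]
  · refine sup_le (trivialPairs_le_ker O K) ?_
    rintro _ ⟨u, rfl⟩
    rw [MonoidHom.mem_ker, pairClass_apply]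
    exact map_one _

variable {O K}

/-- If I² = (δ), then N(I)² = |N(δ)|, and in odd degree one of ±δ has nonnegative norm. -/
theorem range_pairClass (hodd : Odd (Module.finrank ℚ K))
    (hN : ∀ δ : Kˣ, latticeNorm (FractionalIdeal.spanSingleton O⁰ (δ : K)) =
      |Algebra.norm ℚ (δ : K)|) :
    (pairClass O K).range = twoTorsionClasses O := by
  ext x
  constructor
  · rintro ⟨⟨⟨I, δ⟩, h1, h2⟩, rfl⟩
    change ClassGroup.mk K I ^ 2 = 1
    rw [← map_pow, mk_eq_one_iff_mem_range]
    refine ⟨δ, Units.ext ?_⟩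
    rw [coe_toPrincipalIdeal, Units.val_pow_eq_pow_val]
    exact h1.symm
  · refine ClassGroup.induction (K := K) (fun I => ?_) x
    intro h
    have h : ClassGroup.mk K I ^ 2 = 1 := h
    rw [← map_pow, mk_eq_one_iff_mem_range] at h
    obtain ⟨δ, hδ⟩ := h
    obtain ⟨δ, hδ, hpos⟩ : ∃ δ, toPrincipalIdeal O K δ = I ^ 2 ∧ 0 ≤ Algebra.norm ℚ (δ : K) := by
      rcases le_total 0 (Algebra.norm ℚ (δ : K)) with h | h
      · exact ⟨δ, hδ, h⟩
      · refine ⟨-δ, by rw [toPrincipalIdeal_neg, hδ], ?_⟩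
        rw [Units.val_neg, norm_neg_of_odd K hodd]
        exact neg_nonneg.2 h
    have hδ' : (I : FractionalIdeal O⁰ K) ^ 2 = FractionalIdeal.spanSingleton O⁰ (δ : K) := by
      rw [← Units.val_pow_eq_pow_val, ← hδ, coe_toPrincipalIdeal]
    refine ⟨⟨(I, δ), hδ', ?_⟩, rfl⟩
    change latticeNorm (I : FractionalIdeal O⁰ K) ^ 2 = Algebra.norm ℚ (δ : K)
    rw [sq, ← latticeNorm_mul, ← sq, hδ', hN, abs_of_nonneg hpos]

/-- The index of the trivial pairs is the product of two indices: inside the kernel of `pairClass`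
it counts norm-one units modulo squares, and the kernel itself has index |Cl₂(O)|. -/
theorem card_HGroup (hodd : Odd (Module.finrank ℚ K))
    (hN : ∀ δ : Kˣ, latticeNorm (FractionalIdeal.spanSingleton O⁰ (δ : K)) =
      |Algebra.norm ℚ (δ : K)|) :
    Nat.card (HGroup O K) =
      2 ^ NumberField.Units.rank K * Nat.card (twoTorsionClasses O) := by
  have h1 := Subgroup.relIndex_mul_index (trivialPairs_le_ker O K)
  have h2 : ((trivialPairs O K).subgroupOf (projectivePairs O K)).relIndex (pairClass O K).ker =
      2 ^ NumberField.Units.rank K := by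
    rw [ker_pairClass O K hN, Subgroup.relIndex_sup_left, ← Subgroup.index_comap, comap_unitPair O K hodd,
      index_sq_normOneUnits O K hodd]
  rw [h2, Subgroup.index_ker, range_pairClass hodd hN] at h1
  exact h1.symm

theorem finite_HGroup (hodd : Odd (Module.finrank ℚ K))
    (hN : ∀ δ : Kˣ, latticeNorm (FractionalIdeal.spanSingleton O⁰ (δ : K)) =
      |Algebra.norm ℚ (δ : K)|) : Finite (HGroup O K) := by
  have := finite_classGroup O
  apply Nat.finite_of_card_ne_zero
  rw [card_HGroup hodd hN]
  exact mul_ne_zero (pow_ne_zero _ two_ne_zero) Nat.card_pos.ne'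

end Count


/-! ### Common isotropic subspaces and squares in K. -/

/-- In a chain `E₀ ⊇ E₁ ⊇ ⋯` of subspaces with `T E_{k+1} ⊆ E_k` and
`E_{k+1} ∩ T⁻¹ E_{k+1} ⊆ E_{k+2}`, the codimensions do not increase. -/
theorem finrank_chain {F V : Type*} [Field F] [AddCommGroup V] [Module F V] [FiniteDimensional F V]
    (T : V →ₗ[F] V) (hT : Function.Injective T) (E : ℕ → Submodule F V)
    (h1 : ∀ k, E (k + 1) ≤ E k) (h2 : ∀ k, (E (k + 1)).map T ≤ E k)
    (h3 : ∀ k, E (k + 1) ⊓ (E (k + 1)).comap T ≤ E (k + 2))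
    (h0 : Module.finrank F (E 0) ≤ Module.finrank F (E 1) + 1) (k : ℕ) :
    Module.finrank F (E 0) ≤ Module.finrank F (E k) + k := by
  have key : ∀ k, Module.finrank F (E k) ≤ Module.finrank F (E (k + 1)) + 1 := by
    intro k
    induction k with
    | zero => exact h0
    | succ k ih =>
      -- The sum of E_{k+1} and TE_{k+1} lies in E_k and their intersection in TE_{k+2}, so 2 dim
      -- E_{k+1} ≤ dim E_k + dim E_{k+2}.
      have e1 := Submodule.finrank_sup_add_finrank_inf_eq (E (k + 1)) ((E (k + 1)).map T)
      have e2 : Module.finrank F ((E (k + 1)).map T) = Module.finrank F (E (k + 1)) :=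
        (Submodule.equivMapOfInjective T hT _).finrank_eq.symm
      have e3 : Module.finrank F ((E (k + 1) ⊔ (E (k + 1)).map T : Submodule F V)) ≤
          Module.finrank F (E k) := Submodule.finrank_mono (sup_le (h1 k) (h2 k))
      have e4 : Module.finrank F ((E (k + 1) ⊓ (E (k + 1)).map T : Submodule F V)) ≤
          Module.finrank F (E (k + 1 + 1)) := by
        rw [(Submodule.equivMapOfInjective T hT (E (k + 1 + 1))).finrank_eq]
        refine Submodule.finrank_mono ?_
        rintro _ ⟨hx, x, hx', rfl⟩
        exact ⟨x, h3 k ⟨hx', hx⟩, rfl⟩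
      omega
  induction k with
  | zero => exact le_rfl
  | succ k ih => have := key k; omega

namespace BinaryForm.Root

variable {n : ℕ} {f : BinaryForm n} {K : Type*} [Field K] [NumberField K] {θ : f.Root K}

namespace Frame

variable (b : θ.Frame)

theorem form_symm (z x y : K) : b.form z x y = b.form z y x := by
  rw [form_apply, form_apply, mul_comm x]

theorem form_nondegenerate {z : K} (hz : z ≠ 0) : (b.form z).Nondegenerate := by
  constructor
  · intro x hx; exact b.eq_zero_of_form hz hx
  · intro x hx
    refine b.eq_zero_of_form hz fun y => ?_
    rw [form_symm]; exact hx y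

/-- A common isotropic subspace of dimension `(n-1)/2` of the forms `λ(x y / δ)`, `λ(θ x y / δ)`
is of the form `⟨w, θ w, θ² w, …⟩`. -/
theorem exists_cyclic (V : Submodule ℚ K) {m : ℕ} (hm : n = 2 * m + 1)
    (hV : Module.finrank ℚ V = m) {z : K} (hz : z ≠ 0)
    (h1 : ∀ x ∈ V, ∀ y ∈ V, b.form z x y = 0)
    (h2 : ∀ x ∈ V, ∀ y ∈ V, b.form z (θ.val * x) y = 0) :
    ∃ w : K, w ≠ 0 ∧ ∀ j < m, θ.val ^ j * w ∈ V := by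
  have hm1 : 1 ≤ m := by have := b.three_le; omega
  have hθ : θ.val ≠ 0 := by
    intro h0
    have hb := b.basis.ne_zero ⟨1, by omega⟩
    rw [b.basis_apply, h0] at hb
    simp at hb
  let W : ℕ → Submodule ℚ K := fun k =>
    ⨅ j : Fin k, V.comap (LinearMap.mulLeft ℚ (θ.val ^ (j : ℕ)))
  have hW : ∀ k x, x ∈ W k ↔ ∀ j < k, θ.val ^ j * x ∈ V := fun k x => by
    simp only [W, Submodule.mem_iInf, Submodule.mem_comap, LinearMap.mulLeft_apply]
    exact ⟨fun h j hj => h ⟨j, hj⟩, fun h j => h j j.2⟩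
  -- `W 0` would be all of K. With V^⊥, of dimension m+1, in its place the first step V^⊥ ⊇ V has
  -- codimension one, and θV ⊆ V^⊥ is the isotropy for the second form. After m steps the dimension
  -- is still at least 1.
  let E : ℕ → Submodule ℚ K := fun k =>
    if k = 0 then LinearMap.BilinForm.orthogonal (b.form z) V else W k
  have hE0 : E 0 = LinearMap.BilinForm.orthogonal (b.form z) V := rfl
  have hEs : ∀ k, E (k + 1) = W (k + 1) := fun k => rfl
  have hE1 : E 1 = V := by
    ext x
    rw [hEs, hW]
    exact ⟨fun h => by simpa using h 0 (by omega), fun h j hj => by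
      obtain rfl : j = 0 := by omega
      simpa using h⟩
  have hfr : Module.finrank ℚ (E 0) = m + 1 := by
    rw [hE0, LinearMap.BilinForm.finrank_orthogonal (b.form_nondegenerate hz) V, hV, b.finrank_eq]
    omega
  have hpos := finrank_chain (LinearMap.mulLeft ℚ θ.val) (fun x y h => mul_left_cancel₀ hθ h) E
    ?_ ?_ ?_ ?_ m
  · rw [hfr] at hpos
    have hne : E m ≠ ⊥ := by
      intro h0
      rw [h0, finrank_bot] at hpos
      omega
    obtain ⟨w, hw, hw0⟩ := Submodule.exists_mem_ne_zero_of_ne_bot hne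
    refine ⟨w, hw0, ?_⟩
    rw [← Nat.sub_add_cancel hm1, hEs, hW, Nat.sub_add_cancel hm1] at hw
    exact hw
  · intro k
    cases k with
    | zero =>
      rw [hE1]
      intro x hx y hy
      exact h1 y hy x hx
    | succ k =>
      intro x hx
      rw [hEs, hW] at hx ⊢
      exact fun j hj => hx j (by omega)
  · intro k
    rw [Submodule.map_le_iff_le_comap]
    cases k with
    | zero =>
      rw [hE1]
      intro x hx y hy
      change b.form z y (θ.val * x) = 0
      rw [form_symm]
      exact h2 x hx y hy
    | succ k =>
      intro x hx
      change θ.val * x ∈ E (k + 1)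
      rw [hEs, hW] at hx ⊢
      intro j hj
      rw [← mul_assoc, ← pow_succ]
      exact hx (j + 1) (by omega)
  · rintro k x ⟨hx, hx'⟩
    have hx : x ∈ E (k + 1) := hx
    have hx' : θ.val * x ∈ E (k + 1) := hx'
    rw [hEs, hW] at hx hx'
    have : x ∈ W (k + 2) := by
      rw [hW]
      intro j hj
      rcases Nat.lt_or_ge j (k + 1) with h | h
      · exact hx j h
      · have h3 := hx' k (by omega)
        rw [← mul_assoc, ← pow_succ] at h3
        rwa [show j = k + 1 by omega]
    exact this
  · rw [hfr, hE1, hV]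

/-- The functional λ(z·) vanishes on the same powers of θ as λ, so it is a rational multiple cλ;
nondegeneracy gives z = c. -/
theorem eq_rat_of_lead {z : K} (h : ∀ k, k + 1 < n → b.lead (z * θ.val ^ k) = 0) :
    ∃ c : ℚ, z = algebraMap ℚ K c := by
  have h3 := b.three_le
  refine ⟨f.coef 0 * b.lead (z * θ.val ^ (n - 1)), ?_⟩
  set c := (f.coef 0 : ℚ) * b.lead (z * θ.val ^ (n - 1)) with hc
  rw [← sub_eq_zero]
  apply b.eq_zero_of_lead
  intro y
  have : b.lead ∘ₗ LinearMap.mulLeft ℚ (z - algebraMap ℚ K c) = 0 := by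
    refine b.basis.ext fun i => ?_
    rw [LinearMap.comp_apply, LinearMap.mulLeft_apply, b.basis_apply, sub_mul, map_sub,
      ← Algebra.smul_def, map_smul, smul_eq_mul, LinearMap.zero_apply]
    rcases Nat.lt_or_ge ((i : ℕ) + 1) n with hi | hi
    · rw [h i hi, b.lead_pow_lt hi]; ring
    · have hi : (i : ℕ) = n - 1 := by omega
      rw [hi, b.lead_pow (by omega : n - 1 + 1 = n), hc]
      have := b.coef_zero_ne'
      field_simp
      ring
  exact LinearMap.congr_fun this y

/-- With w from `exists_cyclic`, λ(w²θ^k/δ) vanishes for k < m by the first form, and for m ≤ k ≤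
2m-1 by the second, writing θ^k = θ·θ^{m-1}·θ^{k-m}. Hence w² = cδ with c rational, and taking norms
shows that c is a square. -/
theorem isSquare_of_isotropic (V : Submodule ℚ K) {m : ℕ} (hm : n = 2 * m + 1)
    (hV : Module.finrank ℚ V = m) {δ : Kˣ} (hδ : IsSquare (Algebra.norm ℚ (δ : K)))
    (h1 : ∀ x ∈ V, ∀ y ∈ V, b.form (δ : K)⁻¹ x y = 0)
    (h2 : ∀ x ∈ V, ∀ y ∈ V, b.form (δ : K)⁻¹ (θ.val * x) y = 0) :
    ∃ κ : Kˣ, δ = κ ^ 2 := by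
  have hm1 : 1 ≤ m := by have := b.three_le; omega
  obtain ⟨w, hw, hwV⟩ := b.exists_cyclic V hm hV (inv_ne_zero δ.ne_zero) h1 h2
  obtain ⟨c, hc⟩ := b.eq_rat_of_lead (z := (δ : K)⁻¹ * w ^ 2) (by
    intro k hk
    rcases Nat.lt_or_ge k m with hkm | hkm
    · have := h1 _ (hwV k hkm) _ (hwV 0 (by omega))
      rw [form_apply] at this
      rw [← this]; congr 1; ring
    · have := h2 _ (hwV (m - 1) (by omega)) _ (hwV (k - m) (by omega))
      rw [form_apply] at this
      rw [← this]; congr 1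
      have e : θ.val ^ k = θ.val * θ.val ^ (m - 1) * θ.val ^ (k - m) := by
        rw [← pow_succ', ← pow_add]; congr 1; omega
      rw [e]; ring)
  have hδ0 := δ.ne_zero
  have hc0 : c ≠ 0 := by
    rintro rfl
    rw [map_zero] at hc
    exact mul_ne_zero (inv_ne_zero hδ0) (pow_ne_zero 2 hw) hc
  have hw2 : w ^ 2 = algebraMap ℚ K c * δ := by
    rw [← hc]; field_simp
  have hN := congrArg (Algebra.norm ℚ) hw2
  rw [map_pow, map_mul, Algebra.norm_algebraMap, b.finrank_eq] at hN
  obtain ⟨q, hq⟩ := hδ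
  have hq0 : q ≠ 0 := by
    rintro rfl
    rw [mul_zero] at hq
    exact Algebra.norm_ne_zero_iff.2 hδ0 hq
  -- This is N(w)² = cⁿN(δ) with n = 2m+1 and N(δ) = q².
  have hcs : c = (Algebra.norm ℚ w / (c ^ m * q)) ^ 2 := by
    rw [div_pow, hN, hq, hm]
    field_simp
    ring
  set r := Algebra.norm ℚ w / (c ^ m * q) with hr
  have hr0 : r ≠ 0 := by
    rintro h0
    rw [h0] at hcs
    exact hc0 (by rw [hcs]; ring)
  have hrK : algebraMap ℚ K r ≠ 0 := by simpa using hr0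
  refine ⟨Units.mk0 (w / algebraMap ℚ K r) (div_ne_zero hw hrK), ?_⟩
  apply Units.ext
  rw [Units.val_pow_eq_pow_val, Units.val_mk0, div_pow, hw2, hcs, map_pow,
    mul_div_cancel_left₀ _ (pow_ne_zero 2 hrK)]

variable [IsFractionRing θ.ring K] {b}

theorem gram_quadratic {ε : ℚ} {z : K} {α : Module.Basis (Fin n) ℚ K}
    {A : Matrix (Fin n) (Fin n) ℤ} (hA : ∀ i j, (A i j : ℚ) = ε * b.form z (α i) (α j))
    (w : Fin n → ℚ) : w ⬝ᵥ (A.map (Int.cast : ℤ → ℚ)).mulVec w =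
      ε * b.form z (α.equivFun.symm w) (α.equivFun.symm w) := by
  rw [Module.Basis.equivFun_symm_apply]
  simp only [dotProduct, Matrix.mulVec, Matrix.map_apply, hA, map_sum, map_smul,
    LinearMap.sum_apply, LinearMap.smul_apply, smul_eq_mul, Finset.mul_sum]
  rw [Finset.sum_comm]
  exact Finset.sum_congr rfl fun i _ => Finset.sum_congr rfl fun j _ => by ring

theorem IsGram.isSquare {v : f.FormPair} {I : FractionalIdeal θ.ring⁰ K} {δ : Kˣ}
    {α : Module.Basis (Fin n) ℚ K} (h : b.IsGram v I δ α)
    (hδ : IsSquare (Algebra.norm ℚ (δ : K))) (hv : v.IsReducible) : ∃ κ : Kˣ, δ = κ ^ 2 := by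
  obtain ⟨m, hm⟩ := b.odd
  have h3 := b.three_le
  obtain ⟨W, hW, hiso⟩ := hv
  have hs : ((-1 : ℚ) ^ ((n - 1) / 2)) ≠ 0 := pow_ne_zero _ (by norm_num)
  -- Polarisation: reducibility only gives the vanishing of the quadratic forms.
  have hpol : ∀ z : K, (∀ w ∈ W, b.form z (α.equivFun.symm w) (α.equivFun.symm w) = 0) →
      ∀ x ∈ W.map α.equivFun.symm.toLinearMap, ∀ y ∈ W.map α.equivFun.symm.toLinearMap,
        b.form z x y = 0 := by
    rintro z hz _ ⟨x, hx, rfl⟩ _ ⟨y, hy, rfl⟩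
    have e1 := hz x hx
    have e2 := hz y hy
    have e3 := hz (x + y) (add_mem hx hy)
    have e4 := b.form_symm z (α.equivFun.symm y) (α.equivFun.symm x)
    rw [map_add, map_add, map_add, LinearMap.add_apply, LinearMap.add_apply, e1, e2, e4] at e3
    change b.form z (α.equivFun.symm x) (α.equivFun.symm y) = 0
    linarith
  refine b.isSquare_of_isotropic (W.map α.equivFun.symm.toLinearMap) hm ?_ hδ (hpol _ ?_) ?_
  · rw [LinearEquiv.finrank_map_eq, hW]
    omega
  · intro w hw
    have := (hiso w hw).1
    rw [gram_quadratic h.A_eq] at this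
    exact (mul_eq_zero.1 this).resolve_left hs
  · intro x hx y hy
    rw [← form_mul]
    refine hpol _ ?_ x hx y hy
    intro w hw
    have := (hiso w hw).2
    rw [gram_quadratic h.B_eq] at this
    exact (mul_eq_zero.1 this).resolve_left hs

/-- The span of κ, κθ, …, κθ^{m-1} is isotropic for both forms: after division by κ² the exponents
of θ that occur are at most 2m-1 = n-2, where λ vanishes. -/
theorem IsGram.isReducible {v : f.FormPair} {I : FractionalIdeal θ.ring⁰ K} {κ : Kˣ}
    {α : Module.Basis (Fin n) ℚ K} (h : b.IsGram v I (κ ^ 2) α) : v.IsReducible := by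
  obtain ⟨m, hm⟩ := b.odd
  have h3 := b.three_le
  have hκ := κ.ne_zero
  let u : Fin m → K := fun j => κ * θ.val ^ (j : ℕ)
  have hu : LinearIndependent ℚ u := by
    have h1 := (b.basis.linearIndependent.comp (Fin.castLE (by omega : m ≤ n))
      (Fin.castLE_injective _)).map' (LinearMap.mulLeft ℚ (κ : K))
      (LinearMap.ker_eq_bot.2 fun x y h => mul_left_cancel₀ hκ h)
    have e : u = LinearMap.mulLeft ℚ (κ : K) ∘ b.basis ∘ Fin.castLE (by omega : m ≤ n) :=
      funext fun j => by simp [u, b.basis_apply]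
    rw [e]
    exact h1
  let V := Submodule.span ℚ (Set.range u)
  have hV : Module.finrank ℚ V = m := by
    rw [finrank_span_eq_card hu, Fintype.card_fin]
  have hz : ∀ z : K, (∀ i j, b.form z (u i) (u j) = 0) → ∀ x ∈ V, b.form z x x = 0 := by
    intro z hz x hx
    obtain ⟨c, rfl⟩ := (Submodule.mem_span_range_iff_exists_fun ℚ).1 hx
    simp only [map_sum, map_smul, LinearMap.sum_apply, LinearMap.smul_apply, hz, smul_zero,
      Finset.sum_const_zero]
  have hu1 : ∀ i j, b.form ((κ ^ 2 : Kˣ) : K)⁻¹ (u i) (u j) = 0 := by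
    intro i j
    rw [form_apply, ← b.lead_pow_lt (k := i + j) (by omega)]
    congr 1
    simp only [u, Units.val_pow_eq_pow_val]
    field_simp
    ring
  have hu2 : ∀ i j, b.form (θ.val * ((κ ^ 2 : Kˣ) : K)⁻¹) (u i) (u j) = 0 := by
    intro i j
    rw [form_apply, ← b.lead_pow_lt (k := i + j + 1) (by omega)]
    congr 1
    simp only [u, Units.val_pow_eq_pow_val]
    field_simp
    ring
  refine ⟨V.map α.equivFun.toLinearMap, ?_, ?_⟩
  · rw [LinearEquiv.finrank_map_eq, hV]
    omega
  · rintro _ ⟨x, hx, rfl⟩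
    rw [gram_quadratic h.A_eq, gram_quadratic h.B_eq]
    simp only [LinearEquiv.coe_coe, LinearEquiv.symm_apply_apply]
    rw [hz _ hu1 x hx, hz _ hu2 x hx]
    simp

end Frame

end BinaryForm.Root


/-! ### Reducible orbits and two-torsion ideals. -/

namespace BinaryForm.Root

variable {n : ℕ} {f : BinaryForm n} {K : Type*} [Field K] [NumberField K] {θ : f.Root K}
  [IsFractionRing θ.ring K]

/-- The pair `(J, 1)` attached to an invertible fractional ideal `J` with `J² = O`. -/
def torsionPair (J : twoTorsionIdeals θ.ring K) : projectivePairs θ.ring K :=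
  ⟨(J.1, 1), by
    have hJ : J.1 ^ 2 = 1 := J.2
    constructor
    · change (J.1 : FractionalIdeal θ.ring⁰ K) ^ 2 = _
      rw [← Units.val_pow_eq_pow_val, hJ, Units.val_one, Units.val_one,
        FractionalIdeal.spanSingleton_one]
    · change latticeNorm (J.1 : FractionalIdeal θ.ring⁰ K) ^ 2 = Algebra.norm ℚ ((1 : Kˣ) : K)
      rw [sq, ← latticeNorm_mul, ← Units.val_mul, ← sq, hJ, Units.val_one, Units.val_one,
        latticeNorm_one, map_one]⟩

/-- Equivalence of (J,1) and (J',1) through κ forces κ² = 1, so κ = ±1 and κJ = J. -/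
theorem mk_torsionPair_injective : Function.Injective
    fun J : twoTorsionIdeals θ.ring K => (QuotientGroup.mk (torsionPair J) : HGroup θ.ring K) := by
  intro J J' h
  simp only [QuotientGroup.eq, Subgroup.mem_subgroupOf] at h
  obtain ⟨κ, hκ⟩ := h
  have h1 : toPrincipalIdeal θ.ring K κ = J.1⁻¹ * J'.1 := congrArg Prod.fst hκ
  have h2 : κ ^ 2 = (1 : Kˣ)⁻¹ * 1 := congrArg Prod.snd hκ
  rw [inv_one, one_mul] at h2
  have h3 : toPrincipalIdeal θ.ring K κ = 1 := by
    have h4 : (κ : K) ^ 2 = 1 := by rw [← Units.val_pow_eq_pow_val, h2, Units.val_one]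
    rcases eq_or_eq_neg_of_sq_eq_sq _ _ (h4.trans (one_pow 2).symm) with h | h
    · rw [show κ = 1 from Units.ext h, map_one]
    · rw [show κ = -1 from Units.ext h, toPrincipalIdeal_neg, map_one]
  rw [h3] at h1
  exact Subtype.ext (inv_mul_eq_one.1 h1.symm)

namespace Frame

variable (b : θ.Frame)

include b

theorem isReducible_of_corresponds {v : f.FormPair} {I : FractionalIdeal θ.ring⁰ K}
    (h : θ.Corresponds v I 1) : v.IsReducible := by
  obtain ⟨-, -, α, hα⟩ := (b.corresponds_iff _ _ _).1 h
  rw [← one_pow 2] at hα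
  exact hα.isReducible

/-- The norm N(δ) = N(I)² is a square, so reducibility gives δ = κ², and J = κ⁻¹I satisfies J² = O.
-/
theorem exists_mk_torsionPair (p : projectivePairs θ.ring K) {v : f.FormPair}
    {I : FractionalIdeal θ.ring⁰ K} (h : θ.Corresponds v I p.1.2) (hv : v.IsReducible) :
    ∃ J : twoTorsionIdeals θ.ring K,
      (QuotientGroup.mk (torsionPair J) : HGroup θ.ring K) = QuotientGroup.mk p := by
  obtain ⟨-, -, α, hα⟩ := (b.corresponds_iff _ _ _).1 h
  obtain ⟨κ, hκ⟩ := hα.isSquare ⟨_, (p.2.2.symm.trans (sq _))⟩ hv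
  have h1 : p.1.1 ^ 2 = toPrincipalIdeal θ.ring K p.1.2 := by
    apply Units.ext
    rw [Units.val_pow_eq_pow_val, coe_toPrincipalIdeal]
    exact p.2.1
  refine ⟨⟨(toPrincipalIdeal θ.ring K κ)⁻¹ * p.1.1, ?_⟩, ?_⟩
  · change ((toPrincipalIdeal θ.ring K κ)⁻¹ * p.1.1) ^ 2 = 1
    rw [mul_pow, h1, hκ, map_pow, inv_pow, inv_mul_cancel]
  · rw [QuotientGroup.eq, Subgroup.mem_subgroupOf]
    refine ⟨κ, Prod.ext ?_ ?_⟩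
    · change toPrincipalIdeal θ.ring K κ = ((toPrincipalIdeal θ.ring K κ)⁻¹ * p.1.1)⁻¹ * p.1.1
      rw [mul_inv, inv_inv, inv_mul_cancel_right]
    · change κ ^ 2 = 1⁻¹ * p.1.2
      rw [inv_one, one_mul, hκ]

variable (U : (FractionalIdeal θ.ring⁰ K)ˣ) (hU : (U : FractionalIdeal θ.ring⁰ K) = θ.ideal)

include hU

theorem corresponds_one_iff (J : (FractionalIdeal θ.ring⁰ K)ˣ) (v : f.FormPair) (k : ℕ) :
    θ.Corresponds v (J * θ.ideal ^ k) 1 ↔ ∃ κ : Kˣ, θ.Corresponds v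
      (FractionalIdeal.spanSingleton θ.ring⁰ (κ : K) * J * θ.ideal ^ k) (κ ^ 2) := by
  constructor
  · intro h
    refine ⟨1, ?_⟩
    rwa [Units.val_one, FractionalIdeal.spanSingleton_one, one_mul, one_pow]
  · rintro ⟨κ, h⟩
    have := b.corresponds_scale (I := toPrincipalIdeal θ.ring K κ * J * U ^ k) (v := v)
      (δ := κ ^ 2) (by simpa [hU] using h) κ⁻¹
    rw [← coe_toPrincipalIdeal, ← Units.val_mul, map_inv, inv_pow, inv_mul_cancel, mul_assoc,
      inv_mul_cancel_left, Units.val_mul, Units.val_pow_eq_pow_val, hU] at this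
    exact this

/-- The bijection between the reducible projective orbits and `I₂(O)`. -/
theorem exists_equiv_twoTorsionIdeals (Φ : HGroup θ.ring K ≃ θ.ProjectiveOrbit)
    (hΦ : ∀ (p : projectivePairs θ.ring K) (v : f.FormPair),
      (Φ (QuotientGroup.mk p)).1 = v.orbit ↔
        θ.Corresponds v (p.1.1 * θ.ideal ^ ((n - 3) / 2)) p.1.2) :
    ∃ Ψ : θ.ReducibleProjectiveOrbit ≃ twoTorsionIdeals θ.ring K,
      ∀ (o : θ.ReducibleProjectiveOrbit) (v : f.FormPair), v.orbit = o.1.1 →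
        ∀ J : twoTorsionIdeals θ.ring K, Ψ o = J ↔
          ∃ κ : Kˣ, θ.Corresponds v
            (FractionalIdeal.spanSingleton θ.ring⁰ (κ : K) * J.1 * θ.ideal ^ ((n - 3) / 2))
            (κ ^ 2) := by
  have hred : ∀ J : twoTorsionIdeals θ.ring K, ∃ v : f.FormPair,
      v.orbit = (Φ (QuotientGroup.mk (torsionPair J))).1 ∧ v.IsReducible := by
    intro J
    obtain ⟨v, hv⟩ := b.exists_corresponds U hU (torsionPair J)
    exact ⟨v, ((hΦ _ v).2 hv).symm, b.isReducible_of_corresponds hv⟩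
  let Ω : twoTorsionIdeals θ.ring K → θ.ReducibleProjectiveOrbit := fun J => ⟨_, hred J⟩
  have hΩ : Function.Bijective Ω := by
    constructor
    · intro J J' h
      exact mk_torsionPair_injective (Φ.injective (congrArg Subtype.val h))
    · rintro ⟨o, v, hvo, hv⟩
      obtain ⟨x, rfl⟩ := Φ.surjective o
      obtain ⟨p, rfl⟩ := QuotientGroup.mk_surjective x
      obtain ⟨J, hJ⟩ := b.exists_mk_torsionPair p ((hΦ p v).1 hvo.symm) hv
      exact ⟨J, Subtype.ext (congrArg Φ hJ)⟩
  refine ⟨(Equiv.ofBijective Ω hΩ).symm, fun o v hv J => ?_⟩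
  rw [← b.corresponds_one_iff U hU, Equiv.symm_apply_eq, Equiv.ofBijective_apply]
  refine Iff.trans ?_ (hΦ (torsionPair J) v)
  rw [hv, eq_comm]
  exact ⟨fun h => congrArg (fun o : θ.ReducibleProjectiveOrbit => o.1.1) h,
    fun h => Subtype.ext (Subtype.ext h)⟩

end Frame

end BinaryForm.Root

end BinaryFormOrder

theorem mainTheorem8 (n : ℕ) (hn : Odd n) (hn3 : 3 ≤ n) (f : BinaryFormOrder.BinaryForm n)
    (hprim : f.IsPrimitive) (hirr : f.IsIrreducible) (hnd : f.IsNondegenerate)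
    (K : Type*) [Field K] [NumberField K] (θ : f.Root K) [IsFractionRing θ.ring K] :
    (∃ Φ : BinaryFormOrder.HGroup θ.ring K ≃ θ.ProjectiveOrbit,
      ∀ (p : BinaryFormOrder.projectivePairs θ.ring K) (v : f.FormPair),
        (Φ (QuotientGroup.mk p)).1 = v.orbit ↔
          θ.Corresponds v (p.1.1 * θ.ideal ^ ((n - 3) / 2)) p.1.2) ∧
    Finite θ.ProjectiveOrbit ∧
    Nat.card θ.ProjectiveOrbit =
      2 ^ (NumberField.InfinitePlace.nrRealPlaces K +
        NumberField.InfinitePlace.nrComplexPlaces K - 1) *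
      Nat.card (BinaryFormOrder.twoTorsionClasses θ.ring) ∧
    (∃ Ψ : θ.ReducibleProjectiveOrbit ≃ BinaryFormOrder.twoTorsionIdeals θ.ring K,
      ∀ (o : θ.ReducibleProjectiveOrbit) (v : f.FormPair), v.orbit = o.1.1 →
        ∀ J : BinaryFormOrder.twoTorsionIdeals θ.ring K, Ψ o = J ↔
          ∃ κ : Kˣ, θ.Corresponds v
            (FractionalIdeal.spanSingleton (nonZeroDivisors θ.ring) (κ : K) * J.1 *
              θ.ideal ^ ((n - 3) / 2)) (κ ^ 2)) := by
  obtain ⟨b⟩ := θ.nonempty_frame hirr hn3 hn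
  have hunit := θ.isUnit_ideal (by omega) hprim
  have hodd : Odd (Module.finrank ℚ K) := by rw [b.finrank_eq]; exact hn
  have hrank : NumberField.Units.rank K = NumberField.InfinitePlace.nrRealPlaces K +
      NumberField.InfinitePlace.nrComplexPlaces K - 1 := by
    rw [NumberField.Units.rank,
      NumberField.InfinitePlace.card_eq_nrRealPlaces_add_nrComplexPlaces]
  obtain ⟨Φ, hΦ⟩ := b.exists_equiv hunit.unit hunit.unit_spec
  have hfin := BinaryFormOrder.finite_HGroup hodd b.latticeNorm_spanSingleton
  have hcard := BinaryFormOrder.card_HGroup hodd b.latticeNorm_spanSingleton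
  refine ⟨⟨Φ, hΦ⟩, Finite.of_equiv _ Φ, ?_,
    b.exists_equiv_twoTorsionIdeals hunit.unit hunit.unit_spec Φ hΦ⟩
  rw [← Nat.card_congr Φ, hcard, hrank]
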